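/- **Setting.** A square is inscribed in the unit sphere of $\mathbb R^3$, in the plane facing the viewer; its corners are numbered $1,2,3,4$ counterclockwise. A *tangle* is a subset of the closed unit ball (the ropes), with rope ends at the four corners, considered up to ambient isotopy fixing the boundary sphere pointwise. If the ends are moved along the sphere during the time interval $[0,1]$ (permuting the four corners in the end), the resulting tangle is obtained by shrinking the ropes to the ball of radius $1/2$ and inserting into the shell around it the strands traced out by the moving ends, with time running outwards. The *twist* $T$ exchanges the ends at corners $1$ and $2$ by a half turn about the axis through the midpoint of that side, with $1$ passing over (towards the viewer) and $2$ under; the *turn* $R$ rotates the whole tangle counterclockwise by a quarter turn. The *untangle* consists of two uncrossed ropes, parallel to two opposite sides of the square and joining $1$ to $4$ and $2$ to $3$. The set $\mathcal T$ of *rational tangles* consists of all tangles obtained from the untangle by finitely many moves $T$ and $R$. Let $B_3=\pi_1(\mathrm{Conf}_3(\mathbb C),\{-1,0,1\})$, where $\mathrm{Conf}_3(\mathbb C)$ is the space of unordered triples of distinct points of $\mathbb C$, and where $\beta\beta'$ means first $\beta'$, then $\beta$. Let $\sigma_1$ (resp. $\sigma_2$) be the counterclockwise half turn exchanging $-1$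 and $0$ (resp. $0$ and $1$). Identify $\mathbb C$ with the sphere minus corner $4$ by stereographic projection, so that $-1,0,1$ become corners $1,2,3$ and the lower half plane becomes the front hemisphere. A loop $\gamma$ in $\mathrm{Conf}_3(\mathbb C)$ based at $\{-1,0,1\}$ acts on a tangle, suspended from its end at corner $4$, by moving the other three ends as described by $\gamma$ ("braiding three loose ends"). Let $\Gamma$ be the free group on the letters $R,T$, let $\mathrm{PSL}_2(\mathbb Z)=\mathrm{SL}_2(\mathbb Z)/\{\pm I\}$, and let $\phi:\Gamma\to \mathrm{PSL}_2(\mathbb Z)$ be the homomorphism with $\phi(R)=\begin{pmatrix}0&-1\\1&0\end{pmatrix}$ and $\phi(T)=\begin{pmatrix}1&1\\0&1\end{pmatrix}$. **Statement.** The moves $R$ and $T$ define an action $\rho_1:\Gamma\to\mathrm{Sym}(\mathcal T)$, and braiding three loose ends defines an action $\rho_3:B_3\to\mathrm{Sym}(\mathcal T)$. There is an isomorphism $$e: B_3/Z(B_3)\xrightarrow{\ \cong\ }\mathrm{PSL}_2(\mathbb Z),\qquad \sigma_1\mapsto\begin{pmatrix}1&1\\0&1\end{pmatrix},\quad \sigma_2\mapsto\begin{pmatrix}1&0\\-1&1\end{pmatrix},$$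 and there is an action $\rho:\mathrm{PSL}_2(\mathbb Z)\to\mathrm{Sym}(\mathcal T)$ of matrices on rational tangles through which both actions factor: $$\rho_3(\beta)=\rho\bigl(e(\beta Z(B_3))\bigr)\ \text{ for all }\beta\in B_3,\qquad \rho_1(w)=\rho(\phi(w))\ \text{ for all } w\in\Gamma .$$ -/

import Mathlib

open Matrix MatrixGroups

noncomputable section

namespace TangleTrick

/-! ### Braids -/

/-- Labelled configurations of `n` pairwise distinct points of the plane. -/
abbrev OrderedConf (n : ℕ) : Type := {z : Fin n → ℂ // Function.Injective z}

/-- Two labelled configurations are identified when they occupy the same set of points. -/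
instance confSetoid (n : ℕ) : Setoid (OrderedConf n) where
  r z w := Set.range z.1 = Set.range w.1
  iseqv := ⟨fun _ => rfl, fun h => h.symm, fun h h' => h.trans h'⟩

/-- The space of collections of `n` distinct points of `ℂ`, with the quotient topology. -/
abbrev Conf (n : ℕ) : Type := Quotient (confSetoid n)

/-- The set of points of a configuration. -/
def Conf.points {n : ℕ} (c : Conf n) : Set ℂ :=
  Quotient.lift (fun z : OrderedConf n => Set.range z.1) (fun _ _ h => h) c

theorem base_injective : Function.Injective (![-1, 0, 1] : Fin 3 → ℂ) := by
  intro i j h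
  fin_cases i <;> fin_cases j <;> simp_all [eq_comm] <;> norm_num at h

/-- The base configuration `{-1, 0, 1}`. -/
def base : Conf 3 := ⟦⟨![-1, 0, 1], base_injective⟩⟧

/-- The braid group on three strands. In Mathlib's convention `p * q` is the class of
the loop `q` followed by the loop `p`. -/
abbrev B₃ : Type := FundamentalGroup (Conf 3) base

/-- The class of a loop in the braid group. -/
def braidClass (γ : Path base base) : B₃ :=
  FundamentalGroup.fromPath (Path.Homotopic.Quotient.mk γ)

/-- `exp (π i t)`. -/
def halfTurn (t : unitInterval) : ℂ := Complex.exp (((Real.pi * (t : ℝ) : ℝ) : ℂ) * Complex.I)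

theorem norm_halfTurn (t : unitInterval) : ‖halfTurn t‖ = 1 :=
  Complex.norm_exp_ofReal_mul_I _

theorem halfTurn_zero : halfTurn 0 = 1 := by simp [halfTurn]

theorem halfTurn_one : halfTurn 1 = -1 := by simp [halfTurn]

theorem continuous_halfTurn : Continuous halfTurn := by
  unfold halfTurn; fun_prop

theorem halfTurn_ne (t : unitInterval) (c : ℂ) (hc : 1 < ‖c‖) : halfTurn t ≠ c := by
  rintro rfl; rw [norm_halfTurn] at hc; exact lt_irrefl _ hc

theorem halfTurn_ne_zero (t : unitInterval) : halfTurn t ≠ 0 := Complex.exp_ne_zero _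

theorem sigmaOne_injective (t : unitInterval) :
    Function.Injective
      (![-1 / 2 - halfTurn t / 2, -1 / 2 + halfTurn t / 2, 1] : Fin 3 → ℂ) := by
  have h0 := halfTurn_ne_zero t
  have h3 := halfTurn_ne t 3 (by norm_num)
  have h3' := halfTurn_ne t (-3) (by norm_num)
  intro i j h
  fin_cases i <;> fin_cases j <;> simp at h ⊢
  · exact h0 (by linear_combination -h)
  · exact h3' (by linear_combination -2 * h)
  · exact h0 (by linear_combination h)
  · exact h3 (by linear_combination 2 * h)
  · exact h3' (by linear_combination 2 * h)
  · exact h3 (by linear_combination -2 * h)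

theorem sigmaTwo_injective (t : unitInterval) :
    Function.Injective
      (![-1, 1 / 2 - halfTurn t / 2, 1 / 2 + halfTurn t / 2] : Fin 3 → ℂ) := by
  have h0 := halfTurn_ne_zero t
  have h3 := halfTurn_ne t 3 (by norm_num)
  have h3' := halfTurn_ne t (-3) (by norm_num)
  intro i j h
  fin_cases i <;> fin_cases j <;> simp at h ⊢
  · exact h3 (by linear_combination 2 * h)
  · exact h3' (by linear_combination -2 * h)
  · exact h3 (by linear_combination -2 * h)
  · exact h0 (by linear_combination -h)
  · exact h3' (by linear_combination 2 * h)
  · exact h0 (by linear_combination h)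

/-- The points `-1` and `0` are exchanged by a counterclockwise half turn; `1` stays fixed. -/
def sigmaOnePath : Path base base where
  toFun t := ⟦⟨_, sigmaOne_injective t⟩⟧
  continuous_toFun := by
    refine continuous_quotient_mk'.comp (Continuous.subtype_mk ?_ _)
    refine continuous_pi fun i => ?_
    have := continuous_halfTurn
    fin_cases i <;> simp <;> fun_prop
  source' := by
    refine Quotient.sound ?_
    change Set.range _ = Set.range _
    simp only [halfTurn_zero, Matrix.range_cons, Matrix.range_empty]
    norm_num
  target' := by
    refine Quotient.sound ?_
    change Set.range _ = Set.range _
    simp only [halfTurn_one, Matrix.range_cons, Matrix.range_empty]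
    norm_num
    ext x
    simp only [Set.mem_insert_iff, Set.mem_singleton_iff]
    tauto

/-- The points `0` and `1` are exchanged by a counterclockwise half turn; `-1` stays fixed. -/
def sigmaTwoPath : Path base base where
  toFun t := ⟦⟨_, sigmaTwo_injective t⟩⟧
  continuous_toFun := by
    refine continuous_quotient_mk'.comp (Continuous.subtype_mk ?_ _)
    refine continuous_pi fun i => ?_
    have := continuous_halfTurn
    fin_cases i <;> simp <;> fun_prop
  source' := by
    refine Quotient.sound ?_
    change Set.range _ = Set.range _
    simp only [halfTurn_zero, Matrix.range_cons, Matrix.range_empty]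
    norm_num
  target' := by
    refine Quotient.sound ?_
    change Set.range _ = Set.range _
    simp only [halfTurn_one, Matrix.range_cons, Matrix.range_empty]
    norm_num
    ext x
    simp only [Set.mem_insert_iff, Set.mem_singleton_iff]
    tauto

/-- The standard generators of the braid group. -/
def σ₁ : B₃ := braidClass sigmaOnePath

def σ₂ : B₃ := braidClass sigmaTwoPath

/-! ### Ropes in the unit ball, up to isotopy

The first coordinate of `ℝ³` points to the right, the second one upwards, and the third one
towards the viewer. -/

/-- Euclidean three-space. -/
abbrev E : Type := EuclideanSpace ℝ (Fin 3)

/-- The unit sphere. -/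
abbrev S : Type := Metric.sphere (0 : E) 1

/-- The four positions, in counterclockwise order. They are the corners of a square, which is drawn
with its corner `4` at the top, its corner `1` at the left, `2` at the bottom and `3` at the
right. -/
def pos₁ : E := !₂[-1, 0, 0]

def pos₂ : E := !₂[0, -1, 0]

def pos₃ : E := !₂[1, 0, 0]

def pos₄ : E := !₂[0, 1, 0]

/-- Ambient isotopy, relative to the boundary, of subsets of the closed unit ball: a continuous
family of homeomorphisms, starting at the identity and fixing the unit sphere and everything
outside of it, moves `K` to `K'`. -/
def Isotopic (K K' : Set E) : Prop :=
  ∃ H : unitInterval → (E ≃ₜ E),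
    Continuous (fun p : unitInterval × E => H p.1 p.2) ∧
    H 0 = Homeomorph.refl E ∧
    (∀ t x, 1 ≤ ‖x‖ → H t x = x) ∧
    H 1 '' K = K'

theorem Isotopic.refl (K : Set E) : Isotopic K K :=
  ⟨fun _ => Homeomorph.refl E, continuous_snd, rfl, fun _ _ _ => rfl, by simp⟩

theorem Isotopic.symm {K K' : Set E} (h : Isotopic K K') : Isotopic K' K := by
  obtain ⟨H, hc, h0, hb, rfl⟩ := h
  have hb' : ∀ x, 1 ≤ ‖x‖ → (H 1).symm x = x := fun x hx => by
    rw [Homeomorph.symm_apply_eq, hb 1 x hx]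
  refine ⟨fun t => (H 1).symm.trans (H (unitInterval.symm t)), ?_, ?_, ?_, ?_⟩
  · exact hc.comp (f := fun p : unitInterval × E => (unitInterval.symm p.1, (H 1).symm p.2))
      (by fun_prop)
  · ext x : 1; simp
  · intro t x hx
    simp [hb' x hx, hb _ x hx]
  · simp [h0, Set.image_image]

theorem Isotopic.trans {K K' K'' : Set E} (h : Isotopic K K') (h' : Isotopic K' K'') :
    Isotopic K K'' := by
  obtain ⟨H, hc, h0, hb, rfl⟩ := h
  obtain ⟨G, gc, g0, gb, rfl⟩ := h'
  refine ⟨fun t => (H t).trans (G t), ?_, ?_, ?_, ?_⟩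
  · exact gc.comp (f := fun p : unitInterval × E => (p.1, H p.1 p.2)) (by fun_prop)
  · ext x : 1; simp [h0, g0]
  · intro t x hx
    simp [hb t x hx, gb t x hx]
  · rw [Set.image_image]; rfl

/-- A state of the ropes is recorded by the subset of the closed unit ball which they occupy. -/
instance isotopySetoid : Setoid (Set E) where
  r := Isotopic
  iseqv := ⟨Isotopic.refl, Isotopic.symm, Isotopic.trans⟩

/-- States of the ropes up to isotopy. -/
abbrev Tangle : Type := Quotient isotopySetoid

/-- The rope joining the positions `p` and `q` in the untangled state: it runs straight inwards from
`p`, then parallel to the side of the square from `p` to `q`, then straight outwards to `q`. -/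
def plainRope (p q : E) : Set E :=
  segment ℝ p ((1 / 2 : ℝ) • p) ∪ segment ℝ ((1 / 2 : ℝ) • p) ((1 / 2 : ℝ) • q) ∪
    segment ℝ ((1 / 2 : ℝ) • q) q

/-- The untangle: one rope joins the positions `1` and `4`, the other one joins `2` and `3`. -/
def untangle : Tangle := ⟦plainRope pos₁ pos₄ ∪ plainRope pos₂ pos₃⟧

/-- Moving the rope ends along the sphere: the old ropes are shrunk to the ball of radius `1 / 2`,
and the ends, whose positions at time `t` form the set `m t`, trace out strands in the
surrounding shell, with time running outwards. -/
def attachSet (m : unitInterval → Set S) (K : Set E) : Set E :=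
  (fun x => (1 / 2 : ℝ) • x) '' K ∪
    {x | ∃ t : unitInterval, ∃ p ∈ m t, x = ((1 + (t : ℝ)) / 2) • (p : E)}

theorem attachSet_isotopic (m : unitInterval → Set S) {K K' : Set E} (h : Isotopic K K') :
    Isotopic (attachSet m K) (attachSet m K') := by
  obtain ⟨H, hc, h0, hb, rfl⟩ := h
  let D : E ≃ₜ E := Homeomorph.smulOfNeZero (2 : ℝ) two_ne_zero
  have hD : ∀ x, D x = (2 : ℝ) • x := fun x => rfl
  have hDs : ∀ x, D.symm x = (1 / 2 : ℝ) • x := fun x => by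
    rw [Homeomorph.symm_apply_eq, hD, smul_smul]; norm_num
  have key : ∀ t x, 1 / 2 ≤ ‖x‖ → D.symm (H t (D x)) = x := by
    intro t x hx
    rw [hb t (D x) (by rw [hD, norm_smul]; norm_num; linarith), Homeomorph.symm_apply_apply]
  refine ⟨fun t => (D.trans (H t)).trans D.symm, ?_, ?_, ?_, ?_⟩
  · have : Continuous (fun p : unitInterval × E => H p.1 (D p.2)) :=
      hc.comp (f := fun p : unitInterval × E => (p.1, D p.2)) (by fun_prop)
    exact D.symm.continuous.comp this
  · ext x : 1; simp [h0]
  · intro t x hx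
    exact key t x (by linarith)
  · rw [attachSet, attachSet, Set.image_union]
    congr 1
    · rw [Set.image_image, Set.image_image]
      refine Set.image_congr fun x _ => ?_
      change D.symm (H 1 (D _)) = _
      rw [← hDs, Homeomorph.apply_symm_apply, hDs]
    · rw [Set.EqOn.image_eq_self]
      rintro x ⟨t, p, -, rfl⟩
      refine key 1 _ ?_
      have hp : ‖(p : E)‖ = 1 := mem_sphere_zero_iff_norm.1 p.2
      have ht := t.2.1
      rw [norm_smul, hp, Real.norm_of_nonneg (by linarith)]
      linarith

/-- The effect on tangles of moving the rope ends along the sphere. -/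
def attach (m : unitInterval → Set S) : Tangle → Tangle :=
  Quotient.map (attachSet m) (fun _ _ h => attachSet_isotopic m h)

/-! ### Twists and turns -/

theorem pos₃_mem : pos₃ ∈ Metric.sphere (0 : E) 1 := by
  simp [pos₃, EuclideanSpace.norm_eq, Fin.sum_univ_three]

theorem pos₄_mem : pos₄ ∈ Metric.sphere (0 : E) 1 := by
  simp [pos₄, EuclideanSpace.norm_eq, Fin.sum_univ_three]

/-- The point at angle `θ` on the circle of the unit sphere which has the side from position `1` to
position `2` as a diameter. The angle is `0` at `pos₁` and `π` at `pos₂`, and angles between `0` and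
`π` lie in front of the plane of the square. -/
def twistPoint (θ : ℝ) : E :=
  !₂[(-1 - Real.cos θ) / 2, (-1 + Real.cos θ) / 2, Real.sqrt 2 / 2 * Real.sin θ]

theorem twistPoint_zero : twistPoint 0 = pos₁ := by
  simp [twistPoint, pos₁]; norm_num

theorem twistPoint_pi : twistPoint Real.pi = pos₂ := by
  simp [twistPoint, pos₂]

theorem twistPoint_mem (θ : ℝ) : twistPoint θ ∈ Metric.sphere (0 : E) 1 := by
  rw [mem_sphere_zero_iff_norm, EuclideanSpace.norm_eq, Real.sqrt_eq_one]
  have h := Real.sin_sq_add_cos_sq θ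
  have h2 : Real.sqrt 2 ^ 2 = 2 := Real.sq_sqrt (by norm_num)
  simp only [twistPoint, Real.norm_eq_abs, sq_abs, Fin.sum_univ_three]
  simp
  linear_combination (1 / 4) * Real.sin θ ^ 2 * h2 + (1 / 2) * h

/-- The ends in the positions `1` and `2` are exchanged, with `1` passing over and `2` passing
under; the ends in the positions `3` and `4` do not move. -/
def twistMotion (t : unitInterval) : Set S :=
  {⟨twistPoint (Real.pi * t), twistPoint_mem _⟩,
   ⟨twistPoint (Real.pi * t + Real.pi), twistPoint_mem _⟩,
   ⟨pos₃, pos₃_mem⟩, ⟨pos₄, pos₄_mem⟩}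

/-- The twist move. -/
def twist : Tangle → Tangle := attach twistMotion

/-- The counterclockwise rotation by a quarter turn in the plane of the square. -/
def quarterTurn : E ≃ₜ E where
  toFun x := !₂[-x 1, x 0, x 2]
  invFun x := !₂[x 1, -x 0, x 2]
  left_inv x := by ext i; fin_cases i <;> simp
  right_inv x := by ext i; fin_cases i <;> simp
  continuous_toFun := by
    refine (PiLp.continuous_toLp 2 _).comp (continuous_pi fun i => ?_)
    fin_cases i <;> simp <;> fun_prop
  continuous_invFun := by
    refine (PiLp.continuous_toLp 2 _).comp (continuous_pi fun i => ?_)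
    fin_cases i <;> simp <;> fun_prop

theorem norm_quarterTurn (x : E) : ‖quarterTurn x‖ = ‖x‖ := by
  rw [EuclideanSpace.norm_eq, EuclideanSpace.norm_eq]
  congr 1
  simp [quarterTurn, Fin.sum_univ_three]
  ring

theorem quarterTurn_isotopic {K K' : Set E} (h : Isotopic K K') :
    Isotopic (quarterTurn '' K) (quarterTurn '' K') := by
  obtain ⟨H, hc, h0, hb, rfl⟩ := h
  refine ⟨fun t => (quarterTurn.symm.trans (H t)).trans quarterTurn, ?_, ?_, ?_, ?_⟩
  · have : Continuous (fun p : unitInterval × E => H p.1 (quarterTurn.symm p.2)) :=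
      hc.comp (f := fun p : unitInterval × E => (p.1, quarterTurn.symm p.2)) (by fun_prop)
    exact quarterTurn.continuous.comp this
  · ext x : 1; simp [h0]
  · intro t x hx
    have : ‖quarterTurn.symm x‖ = ‖x‖ := by
      rw [← norm_quarterTurn, Homeomorph.apply_symm_apply]
    simp [hb t (quarterTurn.symm x) (by rw [this]; exact hx)]
  · simp [Set.image_image]

/-- The turn move: everything is rotated counterclockwise by a quarter turn. -/
def turn : Tangle → Tangle :=
  Quotient.map (quarterTurn '' ·) (fun _ _ h => quarterTurn_isotopic h)

/-- Rational tangles: the tangles obtained from the untangle by twists and turns. -/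
inductive IsRational : Tangle → Prop
  | untangle : IsRational untangle
  | twist (τ : Tangle) : IsRational τ → IsRational (twist τ)
  | turn (τ : Tangle) : IsRational τ → IsRational (turn τ)

/-- The set of rational tangles. -/
abbrev RationalTangle : Type := {τ : Tangle // IsRational τ}

/-- The letters `R` (turn) and `T` (twist). -/
inductive Move
  | R
  | T

/-- The effect of a move on tangles. -/
def Move.apply : Move → Tangle → Tangle
  | Move.R => turn
  | Move.T => twist

/-! ### Braiding three loose ends -/

/-- Stereographic projection from `pos₄` identifies the plane with the sphere without `pos₄`;
this is the inverse map `ℂ → S`. It takes `-1`, `0`, `1` to `pos₁`, `pos₂`, `pos₃`, the real line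
to the circle through the four positions, and the lower half plane to the front hemisphere. -/
def toSphere (w : ℂ) : E :=
  !₂[2 * w.re / (Complex.normSq w + 1), (Complex.normSq w - 1) / (Complex.normSq w + 1),
     -(2 * w.im) / (Complex.normSq w + 1)]

theorem toSphere_mem (w : ℂ) : toSphere w ∈ Metric.sphere (0 : E) 1 := by
  have h := Complex.normSq_nonneg w
  have h' : Complex.normSq w + 1 ≠ 0 := by linarith
  rw [mem_sphere_zero_iff_norm, EuclideanSpace.norm_eq, Real.sqrt_eq_one]
  simp only [toSphere, Real.norm_eq_abs, sq_abs, Fin.sum_univ_three]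
  simp
  field_simp
  rw [Complex.normSq_apply]
  ring

theorem toSphere_neg_one : toSphere (-1) = pos₁ := by
  simp [toSphere, pos₁]; norm_num

theorem toSphere_zero : toSphere 0 = pos₂ := by
  simp [toSphere, pos₂]

theorem toSphere_one : toSphere 1 = pos₃ := by
  simp [toSphere, pos₃]; norm_num

/-- The tangle hangs from its end in position `4`, which stays fixed, and the three loose ends move
as prescribed by the braid. -/
def braidMotion (γ : Path base base) (t : unitInterval) : Set S :=
  insert ⟨pos₄, pos₄_mem⟩ ((fun w => (⟨toSphere w, toSphere_mem w⟩ : S)) '' (γ t).points)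

/-- Braiding the three loose ends of a tangle. -/
def braid (γ : Path base base) : Tangle → Tangle := attach (braidMotion γ)

/-! ### Matrices -/

/-- The image of a matrix in `PSL(2, ℤ)`. -/
def toPSL : SL(2, ℤ) →* ProjectiveSpecialLinearGroup (Fin 2) ℤ := QuotientGroup.mk' _

/-- The homomorphism from the free group on `R` and `T` which takes `R` to `[0, -1; 1, 0]` and
`T` to `[1, 1; 0, 1]`. -/
def φ : FreeGroup Move →* ProjectiveSpecialLinearGroup (Fin 2) ℤ :=
  FreeGroup.lift fun
    | Move.R => toPSL ⟨!![0, -1; 1, 0], by simp [Matrix.det_fin_two_of]⟩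
    | Move.T => toPSL ⟨!![1, 1; 0, 1], by simp [Matrix.det_fin_two_of]⟩

end TangleTrick

end

open Matrix MatrixGroups

noncomputable section

namespace TangleTrick

/-! Everything is reduced to the action of `B₃`; the moves `R` and `T` turn out to be the braids `Δ
= σ₁ σ₂ σ₁` and `σ₁` in disguise.

Geometry. A homotopy of loops lifts to labelled configurations, and two motions which are close to
each other are matched by an ambient isotopy, built sphere by sphere in stereographic coordinates.
Compactness and connectedness of the interval then show that braiding depends only on the homotopy
class (`isotopic_of_homotopic`). Two successive shells can be merged into one
(`isotopic_attachSet_attachSet`), so braiding is an action on the tangles which absorb a radial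
shell, in particular on rational tangles.

Group theory. The three-point configurations are the image of a contractible open set of labelled
ones, the ascending configurations. Subdividing a loop into pieces which lift to this set shows that
`σ₁` and `σ₂` generate (`closure_halfTurns`). Conversely, the monodromy of a covering glued from
positive braid words gives a representation for every pair which satisfies the braid relation
(`exists_representation`). Applied to two matrices, this is a surjection of `B₃` onto the modular
group. A normal form for words in `Δ` and `σ₁ σ₂`, together with a sign pattern of matrices, shows
that its kernel is generated by `Δ²` and is the center.

Comparison. In stereographic coordinates a twist is homotopic to `σ₁`. The braid `Δ` rotates all
ends rigidly by `π`; undoing this in the shell rotates the ropes instead, so `Δ` acts as a half turn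
of the ball about the axis through positions 2 and 4, and `Δ²` acts trivially. That half turn is a
quarter turn after a half turn about the axis through the midpoints of the sides 12 and 34, and the
latter does not change a rational tangle (`IsRational.mutation`). Hence `Δ` acts as `R`. The action
factors through the quotient by the center, and `σ₁ σ₂ σ₁` corresponds to the matrix of `R` up to
sign. -/

/-! ### Ambient isotopies from families of bijections -/

/-- A continuous bijection of space which is the identity outside of the unit ball is a
homeomorphism. -/
theorem isHomeomorph_of_eq_outside {f : E → E} (hf : Continuous f) (hbij : Function.Bijective f)
    (hout : ∀ x, 1 ≤ ‖x‖ → f x = x) : IsHomeomorph f := by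
  rw [isHomeomorph_iff_continuous_isClosedMap_bijective]
  refine ⟨hf, ?_, hbij⟩
  -- A map which is the identity off a compact set is proper, hence closed; so continuity of the
  -- inverse never has to be checked separately.
  have : IsProperMap f := by
    rw [isProperMap_iff_tendsto_cocompact]
    refine ⟨hf, Filter.Tendsto.congr' ?_ Filter.tendsto_id⟩
    filter_upwards [(isCompact_closedBall (0 : E) 1).compl_mem_cocompact] with x hx
    refine (hout x ?_).symm
    simp at hx
    exact hx.le
  exact this.isClosedMap

/-- A continuous family of bijections, starting at the identity and fixing the unit sphere and
everything outside of it, is an ambient isotopy. -/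
theorem Isotopic.of_family (H : unitInterval → E → E)
    (hcont : Continuous fun p : unitInterval × E => H p.1 p.2)
    (hbij : ∀ s, Function.Bijective (H s)) (hzero : ∀ x, H 0 x = x)
    (hout : ∀ s x, 1 ≤ ‖x‖ → H s x = x) (K : Set E) : Isotopic K (H 1 '' K) := by
  have hh : ∀ s, IsHomeomorph (H s) := fun s =>
    isHomeomorph_of_eq_outside (hcont.comp (by fun_prop : Continuous fun x : E => (s, x)))
      (hbij s) (hout s)
  refine ⟨fun s => (hh s).homeomorph, hcont, ?_, hout, rfl⟩
  ext x : 1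
  exact hzero x

/-! ### Radial rescaling -/

/-- The map which moves points along rays from the origin, so that the norm changes by `f`. -/
def radialMap (f : ℝ → ℝ) (x : E) : E := (f ‖x‖ / ‖x‖) • x

theorem norm_radialMap {f : ℝ → ℝ} (h0 : f 0 = 0) (hf : ∀ r, 0 ≤ r → 0 ≤ f r) (x : E) :
    ‖radialMap f x‖ = f ‖x‖ := by
  rw [radialMap, norm_smul, Real.norm_of_nonneg (div_nonneg (hf _ (norm_nonneg _)) (norm_nonneg _))]
  rcases eq_or_ne x 0 with rfl | hx
  · simp [h0]
  · have : ‖x‖ ≠ 0 := norm_ne_zero_iff.2 hx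
    field_simp

theorem radialMap_smul {f : ℝ → ℝ} (p : E) (hp : ‖p‖ = 1) {r : ℝ} (hr : 0 < r) :
    radialMap f (r • p) = f r • p := by
  rw [radialMap, norm_smul, hp, Real.norm_of_nonneg hr.le, mul_one, smul_smul]
  congr 1
  field_simp

/-- Away from the origin the defining quotient is continuous. At the origin it is not, but the image
has norm `f ‖x‖`, which tends to zero. -/
theorem continuous_radialMap {A : Type*} [TopologicalSpace A] {f : A → ℝ → ℝ}
    (hf : Continuous fun p : A × ℝ => f p.1 p.2)
    (h0 : ∀ a, f a 0 = 0) (hpos : ∀ a r, 0 ≤ r → 0 ≤ f a r) :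
    Continuous fun p : A × E => radialMap (f p.1) p.2 := by
  have hN : Continuous fun p : A × E => f p.1 ‖p.2‖ :=
    hf.comp (by fun_prop : Continuous fun p : A × E => (p.1, ‖p.2‖))
  rw [continuous_iff_continuousAt]
  rintro ⟨a, x⟩
  rcases eq_or_ne x 0 with rfl | hx
  · have h : Filter.Tendsto (fun p : A × E => ‖radialMap (f p.1) p.2‖) (nhds (a, 0)) (nhds 0) := by
      have := hN.tendsto (a, 0)
      simpa [norm_radialMap (h0 _) (hpos _), h0] using this
    have h' := tendsto_zero_iff_norm_tendsto_zero.2 h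
    simpa [ContinuousAt, radialMap] using h'
  · refine ContinuousAt.smul (ContinuousAt.div hN.continuousAt (by fun_prop) ?_) (by fun_prop)
    simpa using hx

/-- Rays are preserved and `f` is a bijection on radii, so the map is bijective on each ray. -/
theorem radialMap_bijective {f : ℝ → ℝ} (hc : Continuous f) (hm : StrictMono f) (h0 : f 0 = 0)
    (h1 : ∀ r, 1 ≤ r → f r = r) : Function.Bijective (radialMap f) := by
  have hpos : ∀ r, 0 ≤ r → 0 ≤ f r := fun r hr => h0 ▸ hm.monotone hr
  constructor
  · intro x y hxy
    have hn : ‖x‖ = ‖y‖ := by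
      apply hm.injective
      rw [← norm_radialMap h0 hpos, hxy, norm_radialMap h0 hpos]
    rcases eq_or_ne x 0 with rfl | hx
    · rw [norm_zero] at hn
      exact (norm_eq_zero.1 hn.symm).symm
    · have hx' : 0 < ‖x‖ := norm_pos_iff.2 hx
      have : 0 < f ‖x‖ := h0 ▸ hm hx'
      simp only [radialMap, ← hn] at hxy
      exact smul_right_injective E (div_pos this hx').ne' hxy
  · intro y
    rcases eq_or_ne y 0 with rfl | hy
    · exact ⟨0, by simp [radialMap]⟩
    · have hy' : 0 < ‖y‖ := norm_pos_iff.2 hy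
      -- At the right end `max 1 ‖y‖` the function `f` is the identity, so its value there is at
      -- least `‖y‖`.
      obtain ⟨r, hr, hfr⟩ : ‖y‖ ∈ f '' Set.Icc 0 (max 1 ‖y‖) := by
        refine intermediate_value_Icc (by positivity) hc.continuousOn ⟨?_, ?_⟩
        · rw [h0]; exact hy'.le
        · rw [h1 _ (le_max_left _ _)]; exact le_max_right _ _
      have hr0 : 0 < r := by
        rcases hr.1.eq_or_lt with rfl | h
        · rw [h0] at hfr; linarith
        · exact h
      refine ⟨r • (‖y‖⁻¹ • y), ?_⟩
      rw [radialMap_smul _ _ hr0, hfr, smul_smul, mul_inv_cancel₀ hy'.ne', one_smul]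
      rw [norm_smul, norm_inv, norm_norm, inv_mul_cancel₀ hy'.ne']

/-- Strictly increasing functions form a convex set, so the linear interpolation between the
identity and `f` consists of admissible changes of radius. -/
theorem isotopic_radialMap {f : ℝ → ℝ} (hc : Continuous f) (hm : StrictMono f) (h0 : f 0 = 0)
    (h1 : ∀ r, 1 ≤ r → f r = r) (K : Set E) : Isotopic K (radialMap f '' K) := by
  let g : unitInterval → ℝ → ℝ := fun s r => (1 - (s : ℝ)) * r + s * f r
  have g0 : ∀ s, g s 0 = 0 := fun s => by simp [g, h0]
  have g1 : ∀ s r, 1 ≤ r → g s r = r := fun s r hr => by simp only [g, h1 r hr]; ring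
  have gm : ∀ s, StrictMono (g s) := by
    intro s a b hab
    have h := hm hab
    have hs := s.2.1
    have hs' := s.2.2
    simp only [g]
    rcases hs.eq_or_lt with h0 | hs
    · rw [← h0]; linarith
    · have := mul_lt_mul_of_pos_left h hs
      have := mul_le_mul_of_nonneg_left hab.le (sub_nonneg.2 hs')
      linarith
  have gpos : ∀ s r, 0 ≤ r → 0 ≤ g s r := fun s r hr => g0 s ▸ (gm s).monotone hr
  have gc : Continuous fun p : unitInterval × ℝ => g p.1 p.2 := by
    simp only [g]; fun_prop
  have := Isotopic.of_family (fun s => radialMap (g s)) (continuous_radialMap gc g0 gpos)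
    (fun s => radialMap_bijective (gc.comp (by fun_prop : Continuous fun r : ℝ => (s, r))) (gm s)
      (g0 s) (g1 s)) ?_ ?_ K
  · have e : g 1 = f := by ext r; simp [g]
    rwa [e] at this
  · intro x
    rcases eq_or_ne x 0 with rfl | hx
    · simp [radialMap]
    · have : ‖x‖ ≠ 0 := norm_ne_zero_iff.2 hx
      simp [radialMap, g, this]
  · intro s x hx
    have : ‖x‖ ≠ 0 := by positivity
    simp [radialMap, g1 s _ hx, this]

/-! ### Composition of motions -/

/-- The first half of the unit interval. -/
def firstHalf (t : unitInterval) : unitInterval :=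
  ⟨(t : ℝ) / 2, by have := t.2.1; have := t.2.2; constructor <;> linarith⟩

/-- The second half of the unit interval. -/
def secondHalf (t : unitInterval) : unitInterval :=
  ⟨(1 + (t : ℝ)) / 2, by have := t.2.1; have := t.2.2; constructor <;> linarith⟩

theorem exists_firstHalf_or_secondHalf (t : unitInterval) :
    (∃ s, t = firstHalf s) ∨ ∃ s, t = secondHalf s := by
  have h0 := t.2.1
  have h1 := t.2.2
  rcases le_total (t : ℝ) (1 / 2) with h | h
  · exact Or.inl ⟨⟨2 * t, by constructor <;> linarith⟩, Subtype.ext (by simp [firstHalf])⟩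
  · exact Or.inr ⟨⟨2 * t - 1, by constructor <;> linarith⟩, Subtype.ext (by simp [secondHalf])⟩

/-- The change of radii which turns two successive shells into the two halves of one shell. -/
def mergeShells (r : ℝ) : ℝ := max r (min (2 * r) (min (r + 1 / 4) ((1 + r) / 2)))

/-- On nonnegative radii the pieces have slopes 2, 1, 1/2 and 1, with breaks at 1/4, 1/2 and 1. As a
maximum of minima of increasing functions no case distinction is needed. -/
theorem mergeShells_strictMono : StrictMono mergeShells := by
  intro a b hab
  refine max_lt_max hab (min_lt_min (by linarith) (min_lt_min (by linarith) (by linarith)))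

theorem norm_coe_sphere (p : S) : ‖(p : E)‖ = 1 := mem_sphere_zero_iff_norm.1 p.2

theorem attachSet_subset_closedBall (m : unitInterval → Set S) {K : Set E}
    (hK : K ⊆ Metric.closedBall 0 1) : attachSet m K ⊆ Metric.closedBall 0 1 := by
  rintro _ (⟨x, hx, rfl⟩ | ⟨t, p, -, rfl⟩) <;> rw [mem_closedBall_zero_iff, norm_smul]
  · have := mem_closedBall_zero_iff.1 (hK hx)
    norm_num; linarith
  · rw [norm_coe_sphere, Real.norm_of_nonneg (by have := t.2.1; linarith)]
    have := t.2.2; linarith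

/-- Two successive motions of the ends amount to a single one. -/
theorem isotopic_attachSet_attachSet {m m' m'' : unitInterval → Set S}
    (h : ∀ t, m'' (firstHalf t) = m t) (h' : ∀ t, m'' (secondHalf t) = m' t) {K : Set E}
    (hK : K ⊆ Metric.closedBall 0 1) :
    Isotopic (attachSet m' (attachSet m K)) (attachSet m'' K) := by
  have key := isotopic_radialMap (f := mergeShells) (by unfold mergeShells; fun_prop)
    mergeShells_strictMono (by norm_num [mergeShells])
    (fun r hr => max_eq_left
      ((min_le_right _ _).trans ((min_le_right _ _).trans (by linarith))))
    (attachSet m' (attachSet m K))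
  -- After two attachments the radii `[0, 1/4]`, `[1/4, 1/2]`, `[1/2, 1]` hold the ropes and the two
  -- shells. They are taken to `[0, 1/2]`, `[1/2, 3/4]`, `[3/4, 1]`. The hypothesis `hK` keeps the
  -- ropes in the range where radii are doubled.
  have hinner : ∀ x ∈ K, radialMap mergeShells ((1 / 2 : ℝ) • (1 / 2 : ℝ) • x)
      = (1 / 2 : ℝ) • x := by
    intro x hx
    have hx1 := mem_closedBall_zero_iff.1 (hK hx)
    have hn : ‖(1 / 2 : ℝ) • (1 / 2 : ℝ) • x‖ = ‖x‖ / 4 := by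
      rw [norm_smul, norm_smul]; norm_num; ring
    have hx0 := norm_nonneg x
    have hm : mergeShells (‖x‖ / 4) = ‖x‖ / 2 := by
      rw [mergeShells, min_eq_left, max_eq_right] <;> [ring; linarith; skip]
      exact le_min (by linarith) (by linarith)
    rw [radialMap, hn, hm, smul_smul, smul_smul]
    rcases eq_or_ne x 0 with rfl | hx
    · simp
    · have : ‖x‖ ≠ 0 := norm_ne_zero_iff.2 hx
      congr 1
      field_simp
      norm_num
  have hmid : ∀ (t : unitInterval) (p : S),
      radialMap mergeShells ((1 / 2 : ℝ) • ((1 + (t : ℝ)) / 2) • (p : E))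
      = ((1 + (firstHalf t : ℝ)) / 2) • (p : E) := by
    intro t p
    have h0 := t.2.1
    have h1 := t.2.2
    rw [smul_smul, radialMap_smul _ (norm_coe_sphere p) (by linarith)]
    congr 1
    rw [mergeShells, min_eq_right, min_eq_left, max_eq_right, firstHalf]
    · dsimp only; ring
    · linarith
    · linarith
    · exact (min_le_left _ _).trans (by linarith)
  have hout : ∀ (t : unitInterval) (p : S),
      radialMap mergeShells (((1 + (t : ℝ)) / 2) • (p : E))
      = ((1 + (secondHalf t : ℝ)) / 2) • (p : E) := by
    intro t p
    have h0 := t.2.1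
    have h1 := t.2.2
    rw [radialMap_smul _ (norm_coe_sphere p) (by linarith)]
    congr 1
    rw [mergeShells, min_eq_right, min_eq_right, max_eq_right, secondHalf]
    · linarith
    · linarith
    · exact (min_le_right _ _).trans (by linarith)
  convert key using 1
  apply Set.Subset.antisymm
  · rintro _ (⟨x, hx, rfl⟩ | ⟨t, p, hp, rfl⟩)
    · exact ⟨_, Or.inl ⟨_, Or.inl ⟨x, hx, rfl⟩, rfl⟩, hinner x hx⟩
    · rcases exists_firstHalf_or_secondHalf t with ⟨s, rfl⟩ | ⟨s, rfl⟩
      · exact ⟨_, Or.inl ⟨_, Or.inr ⟨s, p, h s ▸ hp, rfl⟩, rfl⟩, hmid s p⟩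
      · exact ⟨_, Or.inr ⟨s, p, h' s ▸ hp, rfl⟩, hout s p⟩
  · rintro _ ⟨_, ⟨_, ⟨x, hx, rfl⟩ | ⟨t, p, hp, rfl⟩, rfl⟩ | ⟨t, p, hp, rfl⟩, rfl⟩
    · exact Or.inl ⟨x, hx, (hinner x hx).symm⟩
    · exact Or.inr ⟨firstHalf t, p, (h t).symm ▸ hp, hmid t p⟩
    · exact Or.inr ⟨secondHalf t, p, (h' t).symm ▸ hp, hout t p⟩

/-! ### Rotations -/

/-- A one-parameter group of linear isometries. -/
structure RotationFamily where
  toFun : ℝ → E → E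
  continuous' : Continuous fun p : ℝ × E => toFun p.1 p.2
  zero' : ∀ x, toFun 0 x = x
  add' : ∀ a b x, toFun (a + b) x = toFun a (toFun b x)
  norm' : ∀ a x, ‖toFun a x‖ = ‖x‖
  smul' : ∀ a (c : ℝ) x, toFun a (c • x) = c • toFun a x

/-- The ends may be rotated back to their final positions while the ropes inside are rotated. -/
theorem isotopic_attachSet_rotate (ρ : RotationFamily) (α : ℝ) {m m' : unitInterval → Set S}
    (h : ∀ t : unitInterval,
      Subtype.val '' m' t = ρ.toFun (α * (1 - t)) '' (Subtype.val '' m t))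
    {K : Set E} (hK : K ⊆ Metric.closedBall 0 1) :
    Isotopic (attachSet m K) (attachSet m' (ρ.toFun α '' K)) := by
  -- The weight is 1 up to radius 1/2, falls linearly to 0 at radius 1, and equals `1 - t` at radius
  -- `(1 + t) / 2`, the layer of time `t`. Each sphere is turned rigidly, so the inverse is the
  -- opposite rotation on the same sphere.
  let c : ℝ → ℝ := fun r => max 0 (min 1 (2 - 2 * r))
  let H : unitInterval → E → E := fun s x => ρ.toFun (s * (α * c ‖x‖)) x
  have hnorm : ∀ s x, ‖H s x‖ = ‖x‖ := fun s x => ρ.norm' _ _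
  have hinv : ∀ a x, ρ.toFun (-a) (ρ.toFun a x) = x := fun a x => by
    rw [← ρ.add', neg_add_cancel, ρ.zero']
  have hinv' : ∀ a x, ρ.toFun a (ρ.toFun (-a) x) = x := fun a x => by
    rw [← ρ.add', add_neg_cancel, ρ.zero']
  have key := Isotopic.of_family H
    (ρ.continuous'.comp (by fun_prop : Continuous fun p : unitInterval × E =>
      ((p.1 : ℝ) * (α * c ‖p.2‖), p.2))) ?_ ?_ ?_ (attachSet m K)
  · have hsmall : ∀ r, r ≤ 1 / 2 → c r = 1 := fun r hr => by
      simp only [c]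
      rw [min_eq_left (by linarith), max_eq_right (by norm_num)]
    have h1 : ∀ x ∈ K, H 1 ((1 / 2 : ℝ) • x) = (1 / 2 : ℝ) • ρ.toFun α x := by
      intro x hx
      have hx1 := mem_closedBall_zero_iff.1 (hK hx)
      simp only [H]
      rw [hsmall, ρ.smul']
      · simp
      · rw [norm_smul]; norm_num; linarith
    have h2 : ∀ (t : unitInterval) (p : E), ‖p‖ = 1 → H 1 (((1 + (t : ℝ)) / 2) • p) =
        ((1 + (t : ℝ)) / 2) • ρ.toFun (α * (1 - t)) p := by
      intro t p hp
      have h0 := t.2.1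
      have h1 := t.2.2
      simp only [H]
      rw [ρ.smul', norm_smul, hp, Real.norm_of_nonneg (by linarith)]
      have : c ((1 + (t : ℝ)) / 2 * 1) = 1 - t := by
        simp only [c]
        rw [min_eq_right (by linarith), max_eq_right (by linarith)]
        ring
      rw [this]
      simp
    convert key using 1
    apply Set.Subset.antisymm
    · rintro _ (⟨_, ⟨x, hx, rfl⟩, rfl⟩ | ⟨t, p, hp, rfl⟩)
      · exact ⟨_, Or.inl ⟨x, hx, rfl⟩, h1 x hx⟩
      · have : (p : E) ∈ Subtype.val '' m' t := ⟨p, hp, rfl⟩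
        rw [h t] at this
        obtain ⟨_, ⟨q, hq, rfl⟩, e⟩ := this
        exact ⟨_, Or.inr ⟨t, q, hq, rfl⟩, by rw [h2 t _ (norm_coe_sphere q), e]⟩
    · rintro _ ⟨_, ⟨x, hx, rfl⟩ | ⟨t, q, hq, rfl⟩, rfl⟩
      · exact Or.inl ⟨_, ⟨x, hx, rfl⟩, (h1 x hx).symm⟩
      · have : ρ.toFun (α * (1 - t)) q ∈ Subtype.val '' m' t := by
          rw [h t]; exact ⟨_, ⟨q, hq, rfl⟩, rfl⟩
        obtain ⟨p, hp, e⟩ := this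
        exact Or.inr ⟨t, p, hp, by rw [h2 t _ (norm_coe_sphere q), e]⟩
  · intro s
    constructor
    · intro x y hxy
      have hn : ‖x‖ = ‖y‖ := by rw [← hnorm s x, hxy, hnorm]
      simp only [H, hn] at hxy
      rw [← hinv _ x, hxy, hinv]
    · intro y
      refine ⟨ρ.toFun (-(s * (α * c ‖y‖))) y, ?_⟩
      simp only [H]
      rw [ρ.norm', hinv']
  · intro x
    simp [H, ρ.zero']
  · intro s x hx
    have : c ‖x‖ = 0 := by
      simp only [c]
      rw [min_eq_right (by linarith), max_eq_left (by linarith)]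
    simp [H, this, ρ.zero']

/-! ### The space of labelled configurations covers the space of configurations -/

theorem isOpen_setOf_injective (n : ℕ) :
    IsOpen {z : Fin n → ℂ | Function.Injective z} := by
  have : {z : Fin n → ℂ | Function.Injective z} = ⋂ i, ⋂ j, {z | i ≠ j → z i ≠ z j} := by
    ext z
    simp only [Set.mem_ofPred_eq, Set.mem_iInter]
    exact ⟨fun h i j hij e => hij (h e), fun h i j e => not_not.1 fun hij => h i j hij e⟩
  rw [this]
  refine isOpen_iInter_of_finite fun i => isOpen_iInter_of_finite fun j => ?_
  by_cases hij : i = j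
  · simp [hij]
  · simpa [hij] using isOpen_ne_fun (continuous_apply i) (continuous_apply j)

instance (n : ℕ) : LocallyCompactSpace (OrderedConf n) :=
  (isOpen_setOf_injective n).locallyCompactSpace

/-- Permutations act on labelled configurations by relabelling. -/
instance relabel (n : ℕ) : MulAction (Equiv.Perm (Fin n)) (OrderedConf n) where
  smul w z := ⟨z.1 ∘ w.symm, z.2.comp w.symm.injective⟩
  one_smul _ := rfl
  mul_smul _ _ _ := rfl

instance (n : ℕ) : ContinuousConstSMul (Equiv.Perm (Fin n)) (OrderedConf n) where
  continuous_const_smul w := by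
    refine Continuous.subtype_mk (continuous_pi fun i => ?_) _
    exact (continuous_apply (w.symm i)).comp continuous_subtype_val

instance (n : ℕ) : IsCancelSMul (Equiv.Perm (Fin n)) (OrderedConf n) where
  right_cancel' w w' z h := by
    have : w.symm = w'.symm := by
      ext i : 1
      exact z.2 (congrFun (congrArg Subtype.val h) i)
    simpa using congrArg Equiv.symm this

/-- Labelled configurations of the same points differ by a permutation of the labels. -/
theorem exists_relabel {n : ℕ} {z w : OrderedConf n} (h : Set.range z.1 = Set.range w.1) :
    ∃ g : Equiv.Perm (Fin n), g • w = z := by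
  let e := (Equiv.ofInjective z.1 z.2).trans
    ((Equiv.setCongr h).trans (Equiv.ofInjective w.1 w.2).symm)
  refine ⟨e.symm, Subtype.ext (funext fun i => ?_)⟩
  have : w.1 (e i) = ((Equiv.ofInjective w.1 w.2) (e i) : ℂ) := rfl
  change w.1 (e i) = z.1 i
  rw [this]
  simp [e]

/-- The configuration of points of a labelled configuration. -/
def unlabel (n : ℕ) : OrderedConf n → Conf n := Quotient.mk (confSetoid n)

theorem unlabel_eq_iff {n : ℕ} {z w : OrderedConf n} :
    unlabel n z = unlabel n w ↔ Set.range z.1 = Set.range w.1 :=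
  Quotient.eq (r := confSetoid n)

/-- A finite group acts freely and continuously on a locally compact Hausdorff space, hence properly
discontinuously, and its orbits are the fibers. -/
theorem isQuotientCoveringMap_unlabel (n : ℕ) :
    IsQuotientCoveringMap (unlabel n) (Equiv.Perm (Fin n)) := by
  have hq : Topology.IsQuotientMap (unlabel n) := isQuotientMap_quotient_mk'
  refine hq.isQuotientCoveringMap_of_properlyDiscontinuousSMul @fun z w => ?_
  rw [unlabel_eq_iff, MulAction.mem_orbit_iff]
  refine ⟨exists_relabel, ?_⟩
  rintro ⟨g, rfl⟩
  exact (Equiv.surjective g.symm).range_comp w.1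

theorem isCoveringMap_unlabel (n : ℕ) : IsCoveringMap (unlabel n) :=
  (isQuotientCoveringMap_unlabel n).isCoveringMap

/-! ### Stereographic projection -/

/-- The homogeneous form of the stereographic projection from `pos₄`. -/
def stereo (x : E) : ℂ := ⟨x 0 / (‖x‖ - x 1), -x 2 / (‖x‖ - x 1)⟩

theorem norm_sq_eq (x : E) : ‖x‖ ^ 2 = x 0 ^ 2 + x 1 ^ 2 + x 2 ^ 2 := by
  rw [EuclideanSpace.norm_eq, Real.sq_sqrt (by positivity), Fin.sum_univ_three]
  simp

theorem apply_one_le_norm (x : E) : x 1 ≤ ‖x‖ := by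
  refine (le_abs_self _).trans (abs_le_of_sq_le_sq' ?_ (norm_nonneg x) |> abs_le.2)
  rw [norm_sq_eq]; nlinarith [sq_nonneg (x 0), sq_nonneg (x 2)]

/-- The condition `x 1 ≠ ‖x‖`, here and below, means that `x` lies off the closed ray from the
origin through `pos₄`; it also excludes the origin. -/
theorem normSq_stereo {x : E} (hx : x 1 ≠ ‖x‖) :
    Complex.normSq (stereo x) = (‖x‖ + x 1) / (‖x‖ - x 1) := by
  have h : ‖x‖ - x 1 ≠ 0 := sub_ne_zero.2 hx.symm
  rw [Complex.normSq_apply, stereo]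
  field_simp
  linear_combination -(norm_sq_eq x)

theorem norm_smul_toSphere_stereo {x : E} (hx : x 1 ≠ ‖x‖) :
    ‖x‖ • toSphere (stereo x) = x := by
  have h : ‖x‖ - x 1 ≠ 0 := sub_ne_zero.2 hx.symm
  have hx0 : ‖x‖ ≠ 0 := fun h0 => hx (by rw [h0, norm_eq_zero.1 h0]; simp)
  have h1 : Complex.normSq (stereo x) + 1 = 2 * ‖x‖ / (‖x‖ - x 1) := by
    rw [normSq_stereo hx]; field_simp; ring
  have h2 : Complex.normSq (stereo x) - 1 = 2 * x 1 / (‖x‖ - x 1) := by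
    rw [normSq_stereo hx]; field_simp; ring
  ext i
  fin_cases i <;> simp [toSphere, h1, h2]
  · simp only [stereo]; field_simp
  · field_simp
  · simp only [stereo, neg_div, mul_neg, neg_neg]; field_simp

theorem norm_toSphere (w : ℂ) : ‖toSphere w‖ = 1 := mem_sphere_zero_iff_norm.1 (toSphere_mem w)

theorem toSphere_apply_one (w : ℂ) :
    (toSphere w) 1 = (Complex.normSq w - 1) / (Complex.normSq w + 1) := rfl

theorem toSphere_apply_one_lt (w : ℂ) : (toSphere w) 1 < 1 := by
  have := Complex.normSq_nonneg w
  rw [toSphere_apply_one, div_lt_one (by linarith)]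
  linarith

theorem stereo_smul_toSphere {r : ℝ} (hr : 0 < r) (w : ℂ) : stereo (r • toSphere w) = w := by
  have h := Complex.normSq_nonneg w
  have h' : Complex.normSq w + 1 ≠ 0 := by linarith
  have h1 : 1 - (toSphere w) 1 = 2 / (Complex.normSq w + 1) := by
    rw [toSphere_apply_one]; field_simp; ring
  have h2 : ‖r • toSphere w‖ - (r • toSphere w) 1 = r * (2 / (Complex.normSq w + 1)) := by
    rw [norm_smul, norm_toSphere, Real.norm_of_nonneg hr.le, ← h1]
    simp
    ring
  apply Complex.ext
  · simp only [stereo, h2]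
    simp [toSphere]
    field_simp
  · simp only [stereo, h2]
    simp [toSphere]
    field_simp

theorem continuous_toSphere : Continuous toSphere := by
  have h : ∀ w : ℂ, Complex.normSq w + 1 ≠ 0 := fun w => by
    have := Complex.normSq_nonneg w; linarith
  refine (PiLp.continuous_toLp 2 _).comp (continuous_pi fun i => ?_)
  have := Complex.continuous_normSq
  fin_cases i
  · exact Continuous.div (by fun_prop) (by fun_prop) h
  · exact Continuous.div (by fun_prop) (by fun_prop) h
  · exact Continuous.div (by fun_prop) (by fun_prop) h

theorem continuousAt_stereo {x : E} (hx : x 1 ≠ ‖x‖) : ContinuousAt stereo x := by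
  have h : ‖x‖ - x 1 ≠ 0 := sub_ne_zero.2 hx.symm
  have h0 : ContinuousAt (fun x : E => x 0 / (‖x‖ - x 1)) x :=
    ContinuousAt.div (by fun_prop) (by fun_prop) h
  have h1 : ContinuousAt (fun x : E => -x 2 / (‖x‖ - x 1)) x :=
    ContinuousAt.div (by fun_prop) (by fun_prop) h
  have : stereo = fun x => Complex.equivRealProdCLM.symm
      (x 0 / (‖x‖ - x 1), -x 2 / (‖x‖ - x 1)) := by
    ext x : 1
    apply Complex.ext <;> simp [stereo]
  rw [this]
  exact Complex.equivRealProdCLM.symm.continuous.continuousAt.comp (h0.prodMk h1)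

/-! ### Small perturbations of the identity of the plane -/

/-- A Lipschitz map with a constant below `1` is a perturbation of the identity by which it
remains bijective. -/
theorem bijective_add_of_lipschitz {v : ℂ → ℂ} {k : NNReal} (hk : k < 1) (hv : LipschitzWith k v) :
    Function.Bijective fun z => z + v z := by
  constructor
  · intro a b hab
    have h1 : a - b = v b - v a := by linear_combination hab
    have h2 : dist a b ≤ k * dist a b := by
      conv_lhs => rw [dist_eq_norm, h1, ← dist_eq_norm, dist_comm]
      exact hv.dist_le_mul a b
    have h3 : (k : ℝ) < 1 := hk
    have h4 : dist a b = 0 := by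
      by_contra h
      have : 0 < dist a b := lt_of_le_of_ne dist_nonneg (Ne.symm h)
      nlinarith
    exact dist_eq_zero.1 h4
  · intro y
    -- A preimage of `y` is a fixed point of `z ↦ y - v z`, which Banach's theorem provides.
    have hc : ContractingWith k fun z => y - v z := by
      refine ⟨hk, LipschitzWith.of_dist_le_mul fun a b => ?_⟩
      rw [dist_sub_left]
      exact hv.dist_le_mul a b
    refine ⟨hc.fixedPoint, ?_⟩
    have := hc.fixedPoint_isFixedPt
    change _ + v _ = y
    rw [Function.IsFixedPt] at this
    linear_combination -this

/-- The vector field which equals `y' i - y i` at the point `y i` and decreases linearly to zero in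
the disc of radius `d` around it. -/
def bumpField (d : ℝ) (y y' : Fin 3 → ℂ) (z : ℂ) : ℂ :=
  ∑ i, ((max 0 (1 - ‖z - y i‖ / d) : ℝ) : ℂ) * (y' i - y i)

/-- Each of the three bumps has slope at most `1 / d` and amplitude at most `d / 6`, so it
contributes 1/6 to the Lipschitz constant. -/
theorem bumpField_lipschitz {d : ℝ} (hd : 0 < d) {y y' : Fin 3 → ℂ}
    (h : ∀ i, ‖y' i - y i‖ ≤ d / 6) (s : unitInterval) :
    LipschitzWith (1 / 2) fun z => (s : ℂ) * bumpField d y y' z := by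
  refine LipschitzWith.of_dist_le_mul fun a b => ?_
  rw [dist_eq_norm, ← mul_sub, norm_mul, bumpField, bumpField, ← Finset.sum_sub_distrib]
  have hs : ‖((s : ℝ) : ℂ)‖ ≤ 1 := by
    rw [Complex.norm_real, Real.norm_of_nonneg s.2.1]; exact s.2.2
  have hterm : ∀ i, ‖((max 0 (1 - ‖a - y i‖ / d) : ℝ) : ℂ) * (y' i - y i) -
      ((max 0 (1 - ‖b - y i‖ / d) : ℝ) : ℂ) * (y' i - y i)‖ ≤ dist a b / d * (d / 6) := by
    intro i
    rw [← sub_mul, norm_mul, ← Complex.ofReal_sub, Complex.norm_real, Real.norm_eq_abs]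
    refine mul_le_mul ?_ (h i) (norm_nonneg _) (by positivity)
    rw [max_comm 0, max_comm 0]
    refine (abs_max_sub_max_le_abs _ _ _).trans ?_
    have : 1 - ‖a - y i‖ / d - (1 - ‖b - y i‖ / d) = (‖b - y i‖ - ‖a - y i‖) / d := by ring
    rw [this, abs_div, abs_of_pos hd]
    refine div_le_div_of_nonneg_right ((abs_norm_sub_norm_le _ _).trans ?_) hd.le
    rw [dist_comm, dist_eq_norm]
    simp
  calc _ ≤ 1 * ∑ i : Fin 3, dist a b / d * (d / 6) := by
        refine mul_le_mul hs ((norm_sum_le _ _).trans (Finset.sum_le_sum fun i _ => hterm i))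
          (norm_nonneg _) zero_le_one
    _ = _ := by
        simp
        field_simp
        ring

theorem bumpField_apply {d : ℝ} (hd : 0 < d) {y y' : Fin 3 → ℂ}
    (h : ∀ i j, i ≠ j → d ≤ ‖y i - y j‖) (i : Fin 3) : bumpField d y y' (y i) = y' i - y i := by
  rw [bumpField, Finset.sum_eq_single i]
  · simp
  · intro j _ hj
    have : 1 ≤ ‖y i - y j‖ / d := (one_le_div hd).2 (h i j hj.symm)
    rw [max_eq_left (by linarith)]
    simp
  · simp

/-- Bounded support is what lets the field extend by zero over the projection center `pos₄`. -/
theorem bumpField_eq_zero {d R : ℝ} (hd : 0 < d) {y y' : Fin 3 → ℂ} (h : ∀ i, ‖y i‖ ≤ R) {z : ℂ}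
    (hz : R + d ≤ ‖z‖) : bumpField d y y' z = 0 := by
  refine Finset.sum_eq_zero fun i _ => ?_
  have h1 : d ≤ ‖z - y i‖ := by
    have := norm_sub_norm_le z (y i)
    have := h i
    linarith
  have : 1 ≤ ‖z - y i‖ / d := (one_le_div hd).2 h1
  rw [max_eq_left (by linarith)]
  simp

theorem bumpField_self (d : ℝ) (y : Fin 3 → ℂ) (z : ℂ) : bumpField d y y z = 0 := by
  simp [bumpField]

theorem continuous_bumpField (d : ℝ) :
    Continuous fun p : (Fin 3 → ℂ) × (Fin 3 → ℂ) × ℂ => bumpField d p.1 p.2.1 p.2.2 := by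
  unfold bumpField
  fun_prop

/-! ### Braiding close braids gives isotopic tangles -/

/-- The map of space which moves the points of a sphere around the origin as the map
`z ↦ z + v z` does in stereographic coordinates. -/
def pushMap (v : ℂ → ℂ) (x : E) : E :=
  if x 1 = ‖x‖ then x else ‖x‖ • toSphere (stereo x + v (stereo x))

theorem pushMap_of_eq_zero {v : ℂ → ℂ} {x : E} (h : v (stereo x) = 0) : pushMap v x = x := by
  rw [pushMap]
  split_ifs with hx
  · rfl
  · rw [h, add_zero, norm_smul_toSphere_stereo hx]

theorem norm_pushMap (v : ℂ → ℂ) (x : E) : ‖pushMap v x‖ = ‖x‖ := by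
  rw [pushMap]
  split_ifs
  · rfl
  · rw [norm_smul, norm_toSphere, norm_norm, mul_one]

theorem pos_of_not_pole {x : E} (hx : x 1 ≠ ‖x‖) : 0 < ‖x‖ := by
  refine norm_pos_iff.2 ?_
  rintro rfl
  simp at hx

theorem smul_toSphere_not_pole {r : ℝ} (hr : 0 < r) (w : ℂ) :
    (r • toSphere w) 1 ≠ ‖r • toSphere w‖ := by
  rw [norm_smul, norm_toSphere, Real.norm_of_nonneg hr.le]
  have := toSphere_apply_one_lt w
  have h : (r • toSphere w) 1 = r * (toSphere w) 1 := rfl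
  rw [h]
  exact (mul_lt_mul_of_pos_left this hr).ne

theorem pushMap_smul_toSphere (v : ℂ → ℂ) {r : ℝ} (hr : 0 < r) (w : ℂ) :
    pushMap v (r • toSphere w) = r • toSphere (w + v w) := by
  rw [pushMap, if_neg (smul_toSphere_not_pole hr w), stereo_smul_toSphere hr, norm_smul,
    norm_toSphere, Real.norm_of_nonneg hr.le, mul_one]

theorem pushMap_pos₄ (v : ℂ → ℂ) {r : ℝ} (hr : 0 ≤ r) : pushMap v (r • pos₄) = r • pos₄ := by
  have h : ‖pos₄‖ = 1 := mem_sphere_zero_iff_norm.1 pos₄_mem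
  rw [pushMap, if_pos]
  rw [norm_smul, h, Real.norm_of_nonneg hr]
  simp [pos₄]

/-- Norms and the ray through `pos₄` are preserved, so bijectivity may be tested on each sphere, in
its stereographic coordinate. The field may therefore vary with the radius. -/
theorem pushMap_bijective {v : ℝ → ℂ → ℂ}
    (hv : ∀ r, Function.Bijective fun z => z + v r z) :
    Function.Bijective fun x : E => pushMap (v ‖x‖) x := by
  have pole : ∀ x : E, (pushMap (v ‖x‖) x) 1 = ‖pushMap (v ‖x‖) x‖ → x 1 = ‖x‖ := by
    intro x h
    by_contra hx
    rw [pushMap, if_neg hx] at h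
    exact smul_toSphere_not_pole (pos_of_not_pole hx) _ h
  constructor
  · intro x y hxy
    dsimp only at hxy
    have hn : ‖x‖ = ‖y‖ := by rw [← norm_pushMap (v ‖x‖) x, hxy, norm_pushMap]
    by_cases hx : x 1 = ‖x‖
    · have hx' : pushMap (v ‖x‖) x = x := if_pos hx
      have hy : y 1 = ‖y‖ := pole y (by rw [← hxy, hx', hx])
      have hy' : pushMap (v ‖y‖) y = y := if_pos hy
      rw [← hx', hxy, hy']
    · have hy : y 1 ≠ ‖y‖ := by
        intro hy
        have hy' : pushMap (v ‖y‖) y = y := if_pos hy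
        exact hx (pole x (by rw [hxy, hy', hy]))
      rw [pushMap, pushMap, if_neg hx, if_neg hy, ← hn] at hxy
      have h1 := congrArg stereo hxy
      rw [stereo_smul_toSphere (pos_of_not_pole hx), stereo_smul_toSphere (pos_of_not_pole hx)]
        at h1
      have h2 := (hv _).1 h1
      rw [← norm_smul_toSphere_stereo hx, h2, hn, norm_smul_toSphere_stereo hy]
  · intro y
    by_cases hy : y 1 = ‖y‖
    · exact ⟨y, if_pos hy⟩
    · obtain ⟨w, hw⟩ := (hv ‖y‖).2 (stereo y)
      have hp := pos_of_not_pole hy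
      refine ⟨‖y‖ • toSphere w, ?_⟩
      dsimp only at hw ⊢
      rw [norm_smul, norm_toSphere, norm_norm, mul_one, pushMap_smul_toSphere _ hp, hw,
        norm_smul_toSphere_stereo hy]

/-- The stereographic coordinate is not continuous along the ray through `pos₄`, but near each point
of that ray either the radius is small or the coordinate is large. In both cases the field vanishes
and the map is the identity. -/
theorem continuous_pushMap {A : Type*} [TopologicalSpace A] {v : A → ℝ → ℂ → ℂ} {R : ℝ}
    (hc : Continuous fun p : A × ℝ × ℂ => v p.1 p.2.1 p.2.2)
    (hR : ∀ a r z, R ≤ ‖z‖ → v a r z = 0) (hr : ∀ a r z, r ≤ 1 / 2 → v a r z = 0) :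
    Continuous fun p : A × E => pushMap (v p.1 ‖p.2‖) p.2 := by
  rw [continuous_iff_continuousAt]
  rintro ⟨a, x⟩
  by_cases hx : x 1 = ‖x‖
  · have key : ∀ᶠ p : A × E in nhds (a, x), pushMap (v p.1 ‖p.2‖) p.2 = p.2 := by
      by_cases h0 : x = 0
      · have : ∀ᶠ p : A × E in nhds (a, x), ‖p.2‖ < 1 / 2 := by
          refine ContinuousAt.eventually_lt (by fun_prop) continuousAt_const ?_
          simp [h0]
        filter_upwards [this] with p hp
        exact pushMap_of_eq_zero (hr _ _ _ hp.le)
      · have h0' : 0 < ‖x‖ := norm_pos_iff.2 h0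
        -- Off the ray this says that the squared norm of the coordinate exceeds `R ^ 2`, by
        -- `normSq_stereo`; without the division it is an open condition which also makes sense on
        -- the ray.
        have : ∀ᶠ p : A × E in nhds (a, x), R ^ 2 * (‖p.2‖ - p.2 1) < ‖p.2‖ + p.2 1 := by
          refine ContinuousAt.eventually_lt (by fun_prop) (by fun_prop) ?_
          simp only [hx]
          linarith
        filter_upwards [this] with p hp
        by_cases hpole : p.2 1 = ‖p.2‖
        · exact if_pos hpole
        · refine pushMap_of_eq_zero (hR _ _ _ ?_)
          have h1 : 0 < ‖p.2‖ - p.2 1 :=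
            sub_pos.2 (lt_of_le_of_ne (apply_one_le_norm _) hpole)
          have h2 := normSq_stereo hpole
          rw [Complex.normSq_eq_norm_sq] at h2
          have h3 : R ^ 2 ≤ ‖stereo p.2‖ ^ 2 := by
            rw [h2, le_div_iff₀ h1]; exact hp.le
          exact le_of_abs_le (abs_le_of_sq_le_sq h3 (norm_nonneg _))
    have hx' : pushMap (v a ‖x‖) x = x := if_pos hx
    have : Filter.Tendsto (fun p : A × E => p.2) (nhds (a, x)) (nhds x) :=
      continuous_snd.tendsto _
    change Filter.Tendsto _ _ (nhds (pushMap (v a ‖x‖) x))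
    rw [hx']
    exact this.congr' (key.mono fun p hp => hp.symm)
  · have hopen : ∀ᶠ p : A × E in nhds (a, x), p.2 1 ≠ ‖p.2‖ :=
      ContinuousAt.eventually_ne (g := fun p : A × E => p.2 1 - ‖p.2‖) (by fun_prop)
        (sub_ne_zero.2 hx) |>.mono fun p hp => sub_ne_zero.1 hp
    have hst : ContinuousAt (fun p : A × E => stereo p.2) (a, x) :=
      ContinuousAt.comp (f := fun p : A × E => p.2) (continuousAt_stereo hx)
        continuous_snd.continuousAt
    have hv : ContinuousAt (fun p : A × E => v p.1 ‖p.2‖ (stereo p.2)) (a, x) :=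
      ContinuousAt.comp (f := fun p : A × E => (p.1, ‖p.2‖, stereo p.2))
        (g := fun p : A × ℝ × ℂ => v p.1 p.2.1 p.2.2) hc.continuousAt
        (continuousAt_fst.prodMk (ContinuousAt.prodMk (by fun_prop) hst))
    have : ContinuousAt (fun p : A × E => ‖p.2‖ • toSphere (stereo p.2 +
        v p.1 ‖p.2‖ (stereo p.2))) (a, x) :=
      ContinuousAt.smul (f := fun p : A × E => ‖p.2‖) (by fun_prop)
        (continuous_toSphere.continuousAt.comp (hst.add hv))
    refine this.congr (hopen.mono fun p hp => ?_)
    simp only [pushMap, if_neg hp]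

/-- The ends on the sphere of a tangle which is suspended from its end at `pos₄`, when the loose
ends are at the points of `c`. -/
def endSet (c : Set ℂ) : Set S :=
  insert ⟨pos₄, pos₄_mem⟩ ((fun w => (⟨toSphere w, toSphere_mem w⟩ : S)) '' c)

/-- On the sphere of radius `(1 + t) / 2` the bump field carries `y t` to `y' t`. Since both motions
start and stop at the same labelled points, the field vanishes on the inner ball and outside the
unit ball. The bounds `d` and `d / 6` make it a small perturbation at every stage. -/
theorem isotopic_of_close {y y' : unitInterval → Fin 3 → ℂ} (hy : Continuous y)
    (hy' : Continuous y') (h0 : y 0 = y' 0) (h1 : y 1 = y' 1) {d : ℝ} (hd : 0 < d)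
    (hsep : ∀ t i j, i ≠ j → d ≤ ‖y t i - y t j‖) (hclose : ∀ t i, ‖y' t i - y t i‖ ≤ d / 6)
    {K : Set E} (hK : K ⊆ Metric.closedBall 0 1) :
    Isotopic (attachSet (fun t => endSet (Set.range (y t))) K)
      (attachSet (fun t => endSet (Set.range (y' t))) K) := by
  -- This recovers the time `t` from the radius `(1 + t) / 2`, clamped to the unit interval.
  let c : ℝ → unitInterval := fun r => Set.projIcc 0 1 zero_le_one (2 * r - 1)
  have hc : Continuous c := continuous_projIcc.comp (by fun_prop)
  have c0 : ∀ r, r ≤ 1 / 2 → c r = 0 := fun r hr =>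
    Set.projIcc_of_le_left _ (by linarith)
  have c1 : ∀ r, 1 ≤ r → c r = 1 := fun r hr =>
    Set.projIcc_of_right_le _ (by linarith)
  have ct : ∀ t : unitInterval, c ((1 + (t : ℝ)) / 2) = t := fun t => by
    have : 2 * ((1 + (t : ℝ)) / 2) - 1 = t := by ring
    simp only [c, this]
    exact Set.projIcc_val _ t
  let v : unitInterval → ℝ → ℂ → ℂ := fun s r z => (s : ℂ) * bumpField d (y (c r)) (y' (c r)) z
  obtain ⟨R, hR⟩ : ∃ R, ∀ t i, ‖y t i‖ ≤ R := by
    obtain ⟨R, hR⟩ := isCompact_univ.exists_bound_of_continuousOn hy.continuousOn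
    exact ⟨R, fun t i => (norm_le_pi_norm (y t) i).trans (hR t trivial)⟩
  have hvc : Continuous fun p : unitInterval × ℝ × ℂ => v p.1 p.2.1 p.2.2 := by
    refine Continuous.mul (by fun_prop) ((continuous_bumpField d).comp
      (f := fun p : unitInterval × ℝ × ℂ => (y (c p.2.1), y' (c p.2.1), p.2.2)) ?_)
    fun_prop
  have hvR : ∀ s r z, R + d ≤ ‖z‖ → v s r z = 0 := fun s r z hz => by
    simp only [v]
    rw [bumpField_eq_zero hd (hR _) hz, mul_zero]
  have hv0 : ∀ s r z, r ≤ 1 / 2 → v s r z = 0 := fun s r z hr => by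
    simp only [v]
    rw [c0 r hr, h0, bumpField_self, mul_zero]
  have hv1 : ∀ s r z, 1 ≤ r → v s r z = 0 := fun s r z hr => by
    simp only [v]
    rw [c1 r hr, h1, bumpField_self, mul_zero]
  have key := Isotopic.of_family (fun s x => pushMap (v s ‖x‖) x) (continuous_pushMap hvc hvR hv0)
    (fun s => pushMap_bijective fun r => bijective_add_of_lipschitz (by norm_num)
      (bumpField_lipschitz hd (hclose (c r)) s))
    (fun x => pushMap_of_eq_zero (by simp [v]))
    (fun s x hx => pushMap_of_eq_zero (hv1 _ _ _ hx))
    (attachSet (fun t => endSet (Set.range (y t))) K)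
  have hin : ∀ x ∈ K, pushMap (v 1 ‖(1 / 2 : ℝ) • x‖) ((1 / 2 : ℝ) • x) = (1 / 2 : ℝ) • x := by
    intro x hx
    have hx1 := mem_closedBall_zero_iff.1 (hK hx)
    refine pushMap_of_eq_zero (hv0 _ _ _ ?_)
    rw [norm_smul]; norm_num; linarith
  have hpole : ∀ t : unitInterval, pushMap (v 1 ‖((1 + (t : ℝ)) / 2) • pos₄‖)
      (((1 + (t : ℝ)) / 2) • pos₄) = ((1 + (t : ℝ)) / 2) • pos₄ := fun t =>
    pushMap_pos₄ _ (by have := t.2.1; linarith)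
  have hend : ∀ (t : unitInterval) i,
      pushMap (v 1 ‖((1 + (t : ℝ)) / 2) • toSphere (y t i)‖)
      (((1 + (t : ℝ)) / 2) • toSphere (y t i)) = ((1 + (t : ℝ)) / 2) • toSphere (y' t i) := by
    intro t i
    have ht : 0 < (1 + (t : ℝ)) / 2 := by have := t.2.1; linarith
    rw [pushMap_smul_toSphere _ ht, norm_smul, norm_toSphere, Real.norm_of_nonneg ht.le, mul_one]
    simp only [v, ct]
    rw [bumpField_apply hd (hsep t)]
    simp
  convert key using 1
  apply Set.Subset.antisymm
  · rintro _ (⟨x, hx, rfl⟩ | ⟨t, p, rfl | ⟨_, ⟨i, rfl⟩, rfl⟩, rfl⟩)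
    · exact ⟨_, Or.inl ⟨x, hx, rfl⟩, hin x hx⟩
    · exact ⟨_, Or.inr ⟨t, _, Or.inl rfl, rfl⟩, hpole t⟩
    · exact ⟨_, Or.inr ⟨t, _, Or.inr ⟨_, ⟨i, rfl⟩, rfl⟩, rfl⟩, hend t i⟩
  · rintro _ ⟨_, ⟨x, hx, rfl⟩ | ⟨t, p, rfl | ⟨_, ⟨i, rfl⟩, rfl⟩, rfl⟩, rfl⟩
    · exact Or.inl ⟨x, hx, (hin x hx).symm⟩
    · exact Or.inr ⟨t, _, Or.inl rfl, hpole t⟩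
    · exact Or.inr ⟨t, _, Or.inr ⟨_, ⟨i, rfl⟩, rfl⟩, hend t i⟩

/-- Homotopic motions of labelled points have the same effect on tangles. -/
theorem isotopic_of_homotopy {F : unitInterval → unitInterval → Fin 3 → ℂ}
    (hF : Continuous fun p : unitInterval × unitInterval => F p.1 p.2)
    (hinj : ∀ s t, Function.Injective (F s t)) (h0 : ∀ s, F s 0 = F 0 0)
    (h1 : ∀ s, F s 1 = F 0 1) {K : Set E} (hK : K ⊆ Metric.closedBall 0 1) :
    Isotopic (attachSet (fun t => endSet (Set.range (F 0 t))) K)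
      (attachSet (fun t => endSet (Set.range (F 1 t))) K) := by
  -- By compactness the distances between the points are bounded below uniformly over the whole
  -- homotopy.
  obtain ⟨d, hd, hsep⟩ : ∃ d > 0, ∀ s t i j, i ≠ j → d ≤ ‖F s t i - F s t j‖ := by
    have : ∀ i j : Fin 3, ∃ d > 0, ∀ s t, i ≠ j → d ≤ ‖F s t i - F s t j‖ := by
      intro i j
      by_cases hij : i = j
      · exact ⟨1, one_pos, fun _ _ h => absurd hij h⟩
      have hcont : Continuous fun p : unitInterval × unitInterval =>
          ‖F p.1 p.2 i - F p.1 p.2 j‖ :=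
        (((continuous_apply i).comp hF).sub ((continuous_apply j).comp hF)).norm
      obtain ⟨p, -, hp⟩ := isCompact_univ.exists_isMinOn Set.univ_nonempty hcont.continuousOn
      refine ⟨‖F p.1 p.2 i - F p.1 p.2 j‖, norm_pos_iff.2 (sub_ne_zero.2 fun h => hij (hinj _ _ h)),
        fun s t _ => hp (Set.mem_univ (s, t))⟩
    choose d hd hsep using this
    refine ⟨Finset.univ.inf' Finset.univ_nonempty fun p : Fin 3 × Fin 3 => d p.1 p.2, ?_, ?_⟩
    · exact (Finset.lt_inf'_iff _).2 fun p _ => hd p.1 p.2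
    · intro s t i j hij
      exact (Finset.inf'_le _ (Finset.mem_univ (i, j))).trans (hsep i j s t hij)
  have huc : UniformContinuous fun p : unitInterval × unitInterval => F p.1 p.2 :=
    CompactSpace.uniformContinuous_of_continuous hF
  obtain ⟨ε, hε, hu⟩ := Metric.uniformContinuous_iff.1 huc (d / 6) (by positivity)
  -- Being isotopic is an equivalence relation which by `isotopic_of_close` holds between nearby
  -- stages, so it holds between any two stages of a connected parameter space.
  refine IsPreconnected.induction₂ (α := unitInterval)
    (P := fun s s' => Isotopic (attachSet (fun t => endSet (Set.range (F s t))) K)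
      (attachSet (fun t => endSet (Set.range (F s' t))) K)) isPreconnected_univ ?_ ?_ ?_
      (Set.mem_univ _) (Set.mem_univ _)
  · intro s _
    have : ∀ᶠ s' in nhdsWithin s Set.univ, dist s s' < ε := by
      rw [nhdsWithin_univ]
      filter_upwards [Metric.ball_mem_nhds s hε] with s' hs'
      rw [dist_comm]; exact hs'
    filter_upwards [this] with s' hs'
    refine isotopic_of_close (hF.comp (by fun_prop : Continuous fun t : unitInterval => (s, t)))
      (hF.comp (by fun_prop : Continuous fun t : unitInterval => (s', t)))
      ((h0 s).trans (h0 s').symm)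
      ((h1 s).trans (h1 s').symm) hd (hsep s) (fun t i => ?_) hK
    have := hu (a := (s', t)) (b := (s, t)) (by
      rw [Prod.dist_eq, dist_self, max_eq_left dist_nonneg, dist_comm]; exact hs')
    rw [← dist_eq_norm]
    exact (dist_le_pi_dist _ _ i).trans this.le
  · intro _ _ _ _ _ _ h h'
    exact h.trans h'
  · intro _ _ _ _ h
    exact h.symm

/-! ### Homotopic braids have the same effect -/

theorem braidMotion_eq (γ : Path base base) (t : unitInterval) :
    braidMotion γ t = endSet (γ t).points := rfl

theorem points_unlabel (z : OrderedConf 3) : (unlabel 3 z).points = Set.range z.1 := rfl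

theorem attachSet_congr {m m' : unitInterval → Set S} (h : ∀ t, m t = m' t) (K : Set E) :
    attachSet m K = attachSet m' K := by
  rw [funext h]

/-- A homotopy relative to the endpoints lifts through the covering by labelled configurations, and
the lifts keep both endpoints fixed. -/
theorem isotopic_of_homotopic {γ γ' : Path base base} (h : γ.Homotopic γ') {K : Set E}
    (hK : K ⊆ Metric.closedBall 0 1) :
    Isotopic (attachSet (braidMotion γ) K) (attachSet (braidMotion γ') K) := by
  let cov := isCoveringMap_unlabel 3
  let e : OrderedConf 3 := ⟨![-1, 0, 1], base_injective⟩
  have hs : ∀ δ : Path base base, δ.toContinuousMap 0 = unlabel 3 e := fun δ => δ.source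
  obtain ⟨F⟩ := cov.homotopicRel_liftPath (γ₀ := γ.toContinuousMap) (γ₁ := γ'.toContinuousMap)
    h e (hs γ) (hs γ')
  have hl : ∀ (δ : Path base base) t, unlabel 3 (cov.liftPath δ.toContinuousMap e (hs δ) t) = δ t :=
    fun δ t => congrFun (cov.liftPath_lifts δ.toContinuousMap e (hs δ)) t
  have key := isotopic_of_homotopy (F := fun s t => (F (s, t)).1)
    (continuous_subtype_val.comp F.continuous) (fun s t => (F (s, t)).2)
    (fun s => congrArg Subtype.val ((F.eq_fst s (Or.inl rfl)).trans (F.eq_fst 0 (Or.inl rfl)).symm))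
    (fun s => congrArg Subtype.val ((F.eq_fst s (Or.inr rfl)).trans (F.eq_fst 0 (Or.inr rfl)).symm))
    hK
  have e0 : ∀ t, endSet (Set.range (F (0, t)).1) = braidMotion γ t := fun t => by
    rw [braidMotion_eq, F.apply_zero, ← hl γ t, points_unlabel]
  have e1 : ∀ t, endSet (Set.range (F (1, t)).1) = braidMotion γ' t := fun t => by
    rw [braidMotion_eq, F.apply_one, ← hl γ' t, points_unlabel]
  rwa [attachSet_congr e0, attachSet_congr e1] at key

theorem isotopic_braidMotion_trans (γ γ' : Path base base) {K : Set E}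
    (hK : K ⊆ Metric.closedBall 0 1) :
    Isotopic (attachSet (braidMotion γ') (attachSet (braidMotion γ) K))
      (attachSet (braidMotion (γ.trans γ')) K) := by
  refine isotopic_attachSet_attachSet (fun t => ?_) (fun t => ?_) hK
  · have := t.2.1
    have := t.2.2
    rw [braidMotion_eq, Path.trans_apply, dif_pos (by simp [firstHalf]; linarith)]
    congr 3
    exact Subtype.ext (by simp [firstHalf]; ring)
  · have := t.2.1
    rw [braidMotion_eq, Path.trans_apply]
    split_ifs with h
    -- At time 1/2 the concatenated path is still given by its first branch; both branches are at
    -- the base configuration there.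
    · have ht : (t : ℝ) = 0 := by simp [secondHalf] at h; linarith
      have ht' : t = 0 := Subtype.ext ht
      subst ht'
      have e : (⟨2 * (secondHalf 0 : ℝ), (unitInterval.mul_pos_mem_iff zero_lt_two).2
          ⟨(secondHalf 0).2.1, h⟩⟩ : unitInterval) = 1 := Subtype.ext (by simp [secondHalf])
      rw [e, γ.target, braidMotion_eq, γ'.source]
    · rw [braidMotion_eq]
      congr 3
      exact Subtype.ext (by simp [secondHalf]; ring)

/-! ### Quotients of the braid group and the modular group -/

theorem toPSL_eq_one_iff (M : SL(2, ℤ)) : toPSL M = 1 ↔ M = 1 ∨ M = -1 := by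
  rw [toPSL, QuotientGroup.mk'_apply, QuotientGroup.eq_one_iff,
    Matrix.SpecialLinearGroup.mem_center_iff]
  constructor
  · rintro ⟨r, hr, h⟩
    rw [Fintype.card_fin] at hr
    rcases mul_self_eq_one_iff.1 ((pow_two r).symm.trans hr) with rfl | rfl
    · left; ext i j; rw [← h]; simp
    · right; ext i j; rw [← h]; simp [Matrix.one_apply]
  · rintro (rfl | rfl)
    · exact ⟨1, by simp, by simp⟩
    · refine ⟨-1, by simp, ?_⟩
      ext i j
      simp [Matrix.one_apply]

theorem toPSL_eq_iff (M N : SL(2, ℤ)) : toPSL M = toPSL N ↔ M = N ∨ M = -N := by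
  rw [← mul_inv_eq_one, ← map_inv, ← map_mul, toPSL_eq_one_iff, mul_inv_eq_one,
    mul_inv_eq_iff_eq_mul, neg_one_mul]

/-- The image of the first generator of the braid group. -/
def matA : SL(2, ℤ) := ⟨!![1, 1; 0, 1], by simp [Matrix.det_fin_two_of]⟩

/-- The image of the second generator of the braid group. -/
def matB : SL(2, ℤ) := ⟨!![1, 0; -1, 1], by simp [Matrix.det_fin_two_of]⟩

theorem closure_matA_matB : Subgroup.closure {matA, matB} = ⊤ := by
  rw [eq_top_iff, ← _root_.SpecialLinearGroup.SL2Z_generators, Subgroup.closure_le]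
  have hA : matA ∈ Subgroup.closure {matA, matB} := Subgroup.subset_closure (by simp)
  have hB : matB ∈ Subgroup.closure {matA, matB} := Subgroup.subset_closure (by simp)
  have hS : ModularGroup.S = (matA * matB * matA)⁻¹ := by decide
  have hT : ModularGroup.T = matA := by decide
  rintro _ (rfl | rfl)
  · rw [hS]; exact inv_mem (mul_mem (mul_mem hA hB) hA)
  · rw [hT]; exact hA

theorem mul_entry (M N : SL(2, ℤ)) (i j : Fin 2) :
    (M * N) i j = M i 0 * N 0 j + M i 1 * N 1 j := by
  rw [Matrix.SpecialLinearGroup.coe_mul, Matrix.mul_apply, Fin.sum_univ_two]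

/-- Matrices with positive diagonal and nonpositive, not both vanishing, other entries. -/
def IsAlternating (M : SL(2, ℤ)) : Prop :=
  1 ≤ M 0 0 ∧ 1 ≤ M 1 1 ∧ M 0 1 ≤ 0 ∧ M 1 0 ≤ 0 ∧ M 0 1 + M 1 0 ≤ -1

section Presentation

variable {Γ : Type*} [Group Γ] {a b : Γ}

/-- Conjugation by `a * b * a` exchanges `a` and `b`, so its square commutes with both generators.
-/
theorem braid_square_central (hab : a * b * a = b * a * b)
    (hgen : Subgroup.closure {a, b} = ⊤) :
    (a * b * a) * (a * b * a) ∈ Subgroup.center Γ := by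
  have h1 : (a * b * a) * a = b * (a * b * a) := by
    rw [hab]; simp only [mul_assoc]; rw [← mul_assoc a b a, hab]; simp only [mul_assoc]
  have h2 : (a * b * a) * b = a * (a * b * a) := by
    rw [mul_assoc, mul_assoc, ← mul_assoc b a b, ← hab]
  rw [Subgroup.mem_center_iff]
  have : ∀ g ∈ Subgroup.closure {a, b},
      g ∈ Subgroup.centralizer {(a * b * a) * (a * b * a)} := by
    intro g hg
    refine (Subgroup.closure_le _).2 ?_ hg
    rintro _ (rfl | rfl)
    · refine Subgroup.mem_centralizer_iff.2 ?_
      rintro _ rfl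
      rw [mul_assoc, h1, ← mul_assoc, h2, mul_assoc]
    · refine Subgroup.mem_centralizer_iff.2 ?_
      rintro _ rfl
      rw [mul_assoc, h2, ← mul_assoc, h1, mul_assoc]
  intro g
  exact (Subgroup.mem_centralizer_iff.1 (this g (hgen ▸ Subgroup.mem_top g)) _ rfl).symm

/-- With `x = a * b * a` and `y = a * b` the group is generated by `x` and `y` subject to `y³ = x²`,
the form which suits normal forms over the free product of cyclic groups of orders 2 and 3. -/
theorem braid_cube (hab : a * b * a = b * a * b) :
    (a * b) * (a * b) * (a * b) = (a * b * a) * (a * b * a) := by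
  have : (a * b) * (a * b) * (a * b) = (a * b * a) * (b * a * b) := by simp only [mul_assoc]
  rw [this, hab]

/-- Normal forms in a group generated by `x` and `y`, with `x² = y³` central. -/
def HasNormalForm (x y g : Γ) : Prop :=
  ∃ (k : ℤ) (i : Fin 3) (j : Fin 2), ∃ w ∈ Submonoid.closure {x * y, x * y * y},
    g = (x * x) ^ k * (y ^ (i : ℕ) * w * x ^ (j : ℕ))

/-- The elements with a normal form contain 1 and are stable under right multiplication by `x`, by
`y` and by powers of the central `x²`. Inverses reduce to these: `x⁻¹ = x · x⁻²` and `y⁻¹ = y² ·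
x⁻²`. -/
theorem hasNormalForm {x y : Γ} (hcube : y * y * y = x * x)
    (hz : ∀ g, g * (x * x) = x * x * g) (hgen : Subgroup.closure {x, y} = ⊤) (g : Γ) :
    HasNormalForm x y g := by
  have hzk : ∀ (k : ℤ) (g : Γ), g * (x * x) ^ k = (x * x) ^ k * g := fun k g =>
    ((show Commute g (x * x) from hz g).zpow_right k)
  have mz : ∀ g (m : ℤ), HasNormalForm x y g → HasNormalForm x y (g * (x * x) ^ m) := by
    rintro g m ⟨k, i, j, w, hw, rfl⟩
    refine ⟨m + k, i, j, w, hw, ?_⟩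
    rw [hzk, _root_.zpow_add]
    simp only [mul_assoc]
  have hcube' : y * (y * y) = x * x := by rw [← mul_assoc, hcube]
  have mx : ∀ g, HasNormalForm x y g → HasNormalForm x y (g * x) := by
    rintro g ⟨k, i, j, w, hw, rfl⟩
    fin_cases j
    · exact ⟨k, i, 1, w, hw, by simp [mul_assoc]⟩
    · have := mz _ 1 ⟨k, i, 0, w, hw, rfl⟩
      convert this using 1
      simp [mul_assoc]
  have my : ∀ g, HasNormalForm x y g → HasNormalForm x y (g * y) := by
    rintro g ⟨k, i, j, w, hw, rfl⟩
    fin_cases j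
    · induction hw using Submonoid.closure_induction_right with
      | one =>
        fin_cases i
        · exact ⟨k, 1, 0, 1, one_mem _, by simp⟩
        · exact ⟨k, 2, 0, 1, one_mem _, by simp [pow_two, mul_assoc]⟩
        · have := mz _ 1 ⟨k, 0, 0, 1, one_mem _, rfl⟩
          convert this using 1
          simp [mul_assoc, pow_two, hcube']
      | mul_right w hw v hv ih =>
        rcases hv with rfl | rfl
        · refine ⟨k, i, 0, w * (x * y * y), mul_mem hw (Submonoid.subset_closure (by simp)), ?_⟩
          simp [mul_assoc]
        -- A syllable `x y²` followed by `y` collapses to `x`, since `y³ = x²` moves into the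
        -- central factor.
        · have := mz _ 1 ⟨k, i, 1, w, hw, rfl⟩
          convert this using 1
          simp [mul_assoc, hcube']
    · refine ⟨k, i, 0, w * (x * y), mul_mem hw (Submonoid.subset_closure (by simp)), ?_⟩
      simp [mul_assoc]
  have hxi : x⁻¹ = x * (x * x) ^ (-1 : ℤ) := by simp
  have hyi : y⁻¹ = y * y * (x * x) ^ (-1 : ℤ) := by rw [← hcube]; simp
  have hg : g ∈ Subgroup.closure {x, y} := hgen ▸ Subgroup.mem_top g
  induction hg using Subgroup.closure_induction_right with
  | one => exact ⟨0, 0, 0, 1, one_mem _, by simp⟩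
  | mul_right g _ v hv ih =>
    rcases hv with rfl | rfl
    · exact mx _ ih
    · exact my _ ih
  | mul_inv_cancel g _ v hv ih =>
    rcases hv with rfl | rfl
    · rw [hxi, ← mul_assoc]; exact mz _ _ (mx _ ih)
    · rw [hyi, ← mul_assoc, ← mul_assoc]; exact mz _ _ (my _ (my _ ih))

theorem closure_braid (hab : a * b * a = b * a * b) (hgen : Subgroup.closure {a, b} = ⊤) :
    Subgroup.closure {a * b * a, a * b} = ⊤ := by
  have hx : a * b * a ∈ Subgroup.closure {a * b * a, a * b} := Subgroup.subset_closure (by simp)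
  have hy : a * b ∈ Subgroup.closure {a * b * a, a * b} := Subgroup.subset_closure (by simp)
  rw [eq_top_iff, ← hgen, Subgroup.closure_le]
  have ha : a = (a * b)⁻¹ * (a * b * a) := by group
  have hb : b = (a * b * a) * (a * b)⁻¹ := by rw [hab]; group
  rintro v (hv | hv)
  · rw [hv]
    have := mul_mem (inv_mem hy) hx
    rwa [← ha] at this
  · rw [Set.mem_singleton_iff.1 hv]
    have := mul_mem hx (inv_mem hy)
    rwa [← hb] at this

variable {h : Γ →* ProjectiveSpecialLinearGroup (Fin 2) ℤ}

/-- Up to sign, the two syllables act on the right by subtracting one column from the other. On an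
alternating matrix this never decreases an absolute value, so no cancellation can occur. The empty
word is separate because the identity has no nonzero entry off the diagonal. -/
theorem word_eq_one_or_alternating (ha : h a = toPSL matA) (hb : h b = toPSL matB) {w : Γ}
    (hw : w ∈ Submonoid.closure {(a * b * a) * (a * b), (a * b * a) * (a * b) * (a * b)}) :
    w = 1 ∨ ∃ M, h w = toPSL M ∧ IsAlternating M := by
  let P : SL(2, ℤ) := ⟨!![1, -1; 0, 1], by simp [Matrix.det_fin_two_of]⟩
  have hP : h ((a * b * a) * (a * b)) = toPSL P := by
    simp only [map_mul, ha, hb]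
    simp only [← map_mul]
    exact (toPSL_eq_iff _ _).2 (Or.inr (by decide))
  have hQ : h ((a * b * a) * (a * b) * (a * b)) = toPSL matB := by
    simp only [map_mul, ha, hb]
    simp only [← map_mul]
    exact (toPSL_eq_iff _ _).2 (Or.inr (by decide))
  have mulP : ∀ M : SL(2, ℤ), (M * P) 0 0 = M 0 0 ∧ (M * P) 0 1 = M 0 1 - M 0 0 ∧
      (M * P) 1 0 = M 1 0 ∧ (M * P) 1 1 = M 1 1 - M 1 0 := fun M => by
    rw [mul_entry, mul_entry, mul_entry, mul_entry]
    simp [P]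
    constructor <;> ring
  have mulQ : ∀ M : SL(2, ℤ), (M * matB) 0 0 = M 0 0 - M 0 1 ∧ (M * matB) 0 1 = M 0 1 ∧
      (M * matB) 1 0 = M 1 0 - M 1 1 ∧ (M * matB) 1 1 = M 1 1 := fun M => by
    rw [mul_entry, mul_entry, mul_entry, mul_entry]
    simp [matB]
    constructor <;> ring
  have altP : IsAlternating P := by simp [IsAlternating, P]
  have altQ : IsAlternating matB := by simp [IsAlternating, matB]
  induction hw using Submonoid.closure_induction_right with
  | one => exact Or.inl rfl
  | mul_right w hw v hv ih =>
    right
    rcases ih with rfl | ⟨M, hM, h1, h2, h3, h4, h5⟩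
    · rcases hv with rfl | rfl
      · exact ⟨P, by rw [one_mul, hP], altP⟩
      · exact ⟨matB, by rw [one_mul, hQ], altQ⟩
    · rcases hv with rfl | rfl
      · refine ⟨M * P, by rw [map_mul, hM, hP, map_mul], ?_⟩
        obtain ⟨e1, e2, e3, e4⟩ := mulP M
        refine ⟨?_, ?_, ?_, ?_, ?_⟩ <;> omega
      · refine ⟨M * matB, by rw [map_mul, hM, hQ, map_mul], ?_⟩
        obtain ⟨e1, e2, e3, e4⟩ := mulQ M
        refine ⟨?_, ?_, ?_, ?_, ?_⟩ <;> omega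

/-- The matrices `±1` have zero entries off the diagonal and equal diagonal entries; for each of the
six pairs `(i, j)` the sign pattern contradicts this. -/
theorem not_pm_one_of_alternating {M : SL(2, ℤ)} (hM : IsAlternating M) (i : Fin 3) (j : Fin 2) :
    toPSL ((matA * matB) ^ (i : ℕ) * M * (matA * matB * matA) ^ (j : ℕ)) ≠ 1 := by
  obtain ⟨h1, h2, h3, h4, h5⟩ := hM
  rw [Ne, toPSL_eq_one_iff]
  have key : ∀ N : SL(2, ℤ), N = 1 ∨ N = -1 → N 0 1 = 0 ∧ N 1 0 = 0 ∧ N 0 0 = N 1 1 := by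
    rintro N (rfl | rfl) <;> simp
  intro h
  have := key _ h
  have hi : (i : ℕ) = 0 ∨ (i : ℕ) = 1 ∨ (i : ℕ) = 2 := by omega
  have hj : (j : ℕ) = 0 ∨ (j : ℕ) = 1 := by omega
  rcases hi with hi | hi | hi <;> rcases hj with hj | hj <;> rw [hi, hj] at this
  all_goals simp only [pow_zero, pow_one, pow_two, one_mul, mul_one, mul_entry] at this
  all_goals try simp [matA, matB] at this
  all_goals omega

/-- In the normal form of a kernel element the middle word must be empty, and then among the six
remaining products only the trivial one maps to 1. What survives is the power of `x²`. -/
theorem mem_zpowers_of_map_eq_one (hab : a * b * a = b * a * b)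
    (hgen : Subgroup.closure {a, b} = ⊤) (ha : h a = toPSL matA) (hb : h b = toPSL matB) {g : Γ}
    (hg : h g = 1) : g ∈ Subgroup.zpowers ((a * b * a) * (a * b * a)) := by
  obtain ⟨k, i, j, w, hw, rfl⟩ := hasNormalForm (braid_cube hab)
    (Subgroup.mem_center_iff.1 (braid_square_central hab hgen)) (closure_braid hab hgen) g
  have hz : h ((a * b * a) * (a * b * a)) = 1 := by
    simp only [map_mul, ha, hb]
    simp only [← map_mul]
    exact (toPSL_eq_one_iff _).2 (Or.inr (by decide))
  have hx : h (a * b * a) = toPSL (matA * matB * matA) := by simp only [map_mul, ha, hb]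
  have hy : h (a * b) = toPSL (matA * matB) := by simp only [map_mul, ha, hb]
  rw [map_mul, map_zpow, hz, _root_.one_zpow, one_mul, map_mul, map_mul, map_pow, map_pow, hx,
    hy] at hg
  rcases word_eq_one_or_alternating ha hb hw with rfl | ⟨M, hM, hM'⟩
  · rw [map_one, mul_one, ← map_pow, ← map_pow, ← map_mul, toPSL_eq_one_iff] at hg
    have : i = 0 ∧ j = 0 := by
      revert hg
      revert i j
      decide
    obtain ⟨rfl, rfl⟩ := this
    simp
  · rw [hM, ← map_pow, ← map_pow, ← map_mul, ← map_mul] at hg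
    exact absurd hg (not_pm_one_of_alternating hM' i j)

theorem surjective_of_generators (ha : h a = toPSL matA) (hb : h b = toPSL matB) :
    Function.Surjective h := by
  intro g
  obtain ⟨M, rfl⟩ := QuotientGroup.mk'_surjective _ g
  have hM : M ∈ Subgroup.closure {matA, matB} := closure_matA_matB ▸ Subgroup.mem_top M
  change toPSL M ∈ h.range
  have : M ∈ h.range.comap toPSL := by
    refine (Subgroup.closure_le _).2 ?_ hM
    rintro _ (rfl | rfl)
    · exact ⟨a, ha⟩
    · exact ⟨b, hb⟩
  exact this

/-- Commuting up to sign with both unipotent generators forces a matrix to be scalar; anticommuting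
is excluded by the determinant. -/
theorem eq_one_of_mem_center {g : ProjectiveSpecialLinearGroup (Fin 2) ℤ}
    (hg : g ∈ Subgroup.center (ProjectiveSpecialLinearGroup (Fin 2) ℤ)) : g = 1 := by
  obtain ⟨M, rfl⟩ := QuotientGroup.mk'_surjective _ g
  change toPSL M = 1
  have hg' := Subgroup.mem_center_iff.1 hg
  have hA : toPSL (matA * M) = toPSL (M * matA) := by
    rw [map_mul, map_mul]; exact hg' _
  have hB : toPSL (matB * M) = toPSL (M * matB) := by
    rw [map_mul, map_mul]; exact hg' _
  have hdet : M 0 0 * M 1 1 - M 0 1 * M 1 0 = 1 := by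
    rw [← Matrix.det_fin_two]; exact M.2
  rw [toPSL_eq_iff] at hA hB
  have ext_iff : ∀ N N' : SL(2, ℤ), N = N' → N 0 0 = N' 0 0 ∧ N 0 1 = N' 0 1 ∧ N 1 0 = N' 1 0 ∧
      N 1 1 = N' 1 1 := by
    rintro N _ rfl; simp
  have h1 : M 1 0 = 0 ∧ M 0 0 = M 1 1 := by
    rcases hA with h | h
    · have := ext_iff _ _ h
      simp only [mul_entry] at this
      simp [matA] at this
      omega
    · have := ext_iff _ _ h
      simp only [Matrix.SpecialLinearGroup.coe_neg, Matrix.neg_apply, mul_entry] at this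
      simp [matA] at this
      have h0 : M 1 0 = 0 := by omega
      have h0' : M 0 0 = 0 := by omega
      rw [h0, h0'] at hdet
      omega
  have h2 : M 0 1 = 0 := by
    rcases hB with h | h
    · have := ext_iff _ _ h
      simp only [mul_entry] at this
      simp [matB] at this
      omega
    · have := ext_iff _ _ h
      simp only [Matrix.SpecialLinearGroup.coe_neg, Matrix.neg_apply, mul_entry] at this
      simp [matB] at this
      omega
  rw [h1.1, h1.2, h2] at hdet
  have hsq : M 1 1 * M 1 1 = 1 := by linarith
  rw [toPSL_eq_one_iff]
  rcases mul_self_eq_one_iff.1 hsq with h | h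
  · left
    ext i j
    fin_cases i <;> fin_cases j <;> simp [h1, h2, h]
  · right
    ext i j
    fin_cases i <;> fin_cases j <;> simp [h1, h2, h]

/-- The kernel consists of powers of a central element. Conversely a surjection takes central
elements to central ones, and the modular group has trivial center. -/
theorem ker_eq_center (hab : a * b * a = b * a * b)
    (hgen : Subgroup.closure {a, b} = ⊤) (ha : h a = toPSL matA) (hb : h b = toPSL matB) :
    h.ker = Subgroup.center Γ := by
  ext g
  refine ⟨fun hg => Subgroup.zpowers_le.2 (braid_square_central hab hgen)
    (mem_zpowers_of_map_eq_one hab hgen ha hb hg), fun hg => ?_⟩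
  refine eq_one_of_mem_center (Subgroup.mem_center_iff.2 fun k => ?_)
  obtain ⟨k, rfl⟩ := surjective_of_generators ha hb k
  rw [← map_mul, ← map_mul, Subgroup.mem_center_iff.1 hg]

end Presentation

/-! ### Ascending configurations

A labelled configuration is ascending when any two points on a common vertical line are labelled
from bottom to top. The ascending configurations form a contractible open set which contains a
labelling of every configuration. -/

/-- The set of ascending labelled configurations. -/
def ascending : Set (Fin 3 → ℂ) :=
  {y | ∀ i j, i < j → (y i).re ≠ (y j).re ∨ (y i).im < (y j).im}

theorem injective_of_mem_ascending {y : Fin 3 → ℂ} (hy : y ∈ ascending) :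
    Function.Injective y := by
  intro i j h
  by_contra hij
  rcases lt_or_gt_of_ne hij with hij | hij
  · have := hy i j hij
    simp [h] at this
  · have := hy j i hij
    simp [h] at this

theorem isOpen_ascending : IsOpen ascending := by
  have : ascending = ⋂ i : Fin 3, ⋂ j : Fin 3,
      {y | i < j → (y i).re ≠ (y j).re ∨ (y i).im < (y j).im} := by
    ext y
    simp only [ascending, Set.mem_ofPred_eq, Set.mem_iInter]
  rw [this]
  refine isOpen_iInter_of_finite fun i => isOpen_iInter_of_finite fun j => ?_
  by_cases hij : i < j
  · simp only [hij, forall_const]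
    have h1 : IsOpen {y : Fin 3 → ℂ | (y i).re ≠ (y j).re} :=
      isOpen_ne_fun (by fun_prop) (by fun_prop)
    have h2 : IsOpen {y : Fin 3 → ℂ | (y i).im < (y j).im} :=
      isOpen_lt (by fun_prop) (by fun_prop)
    exact h1.union h2
  · simp [hij]

theorem mem_ascending_of_re {y : Fin 3 → ℂ} (h : ∀ i j, i ≠ j → (y i).re ≠ (y j).re) :
    y ∈ ascending := fun i j hij => Or.inl (h i j hij.ne)

/-- The star point has its labels stacked from bottom to top on one vertical line. Moving towards it
keeps distinct real parts distinct until the end and only reinforces the vertical order. -/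
theorem starConvex_ascending :
    StarConvex ℝ (fun i : Fin 3 => ((i : ℕ) : ℂ) * Complex.I) ascending := by
  intro y hy a b ha hb hab i j hij
  have hij' : ((i : ℕ) : ℝ) < ((j : ℕ) : ℝ) := by exact_mod_cast hij
  simp only [Pi.add_apply, Pi.smul_apply, Complex.add_re, Complex.add_im, Complex.smul_re,
    Complex.smul_im, Complex.mul_re, Complex.mul_im, Complex.natCast_re, Complex.natCast_im,
    Complex.I_re, Complex.I_im, smul_eq_mul]
  rcases hb.eq_or_lt with rfl | hb
  · right
    have : a = 1 := by linarith
    subst this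
    linarith
  · rcases hy i j hij with h | h
    · left
      intro e
      refine h (mul_left_cancel₀ hb.ne' ?_)
      linarith
    · right
      have h1 := mul_lt_mul_of_pos_left h hb
      have h2 := mul_le_mul_of_nonneg_left hij'.le ha
      linarith

/-- The space of ascending labelled configurations. -/
abbrev Ascending : Type := ascending

instance : ContractibleSpace Ascending := by
  refine starConvex_ascending.contractibleSpace ⟨fun i => ((i : ℕ) : ℂ) * Complex.I, ?_⟩
  intro i j hij
  right
  simpa using hij

/-- Ascending labelled configurations are labelled configurations. -/
def Ascending.toConf (y : Ascending) : OrderedConf 3 := ⟨y.1, injective_of_mem_ascending y.2⟩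

theorem isOpenEmbedding_toConf : Topology.IsOpenEmbedding Ascending.toConf := by
  have h : Topology.IsOpenEmbedding (Subtype.val : OrderedConf 3 → Fin 3 → ℂ) :=
    (isOpen_setOf_injective 3).isOpenEmbedding_subtypeVal
  have h' : Topology.IsOpenEmbedding (Subtype.val ∘ Ascending.toConf) :=
    isOpen_ascending.isOpenEmbedding_subtypeVal
  exact (Topology.IsOpenEmbedding.of_comp_iff _ h).1 h'

/-- The configuration of points of an ascending labelled configuration. -/
def shape : C(Ascending, Conf 3) where
  toFun y := unlabel 3 y.toConf
  continuous_toFun := (isCoveringMap_unlabel 3).continuous.comp isOpenEmbedding_toConf.continuous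

theorem isLocalHomeomorph_shape : IsLocalHomeomorph shape :=
  (isCoveringMap_unlabel 3).isLocalHomeomorph.comp isOpenEmbedding_toConf.isLocalHomeomorph

theorem shape_eq_iff {y y' : Ascending} :
    shape y = shape y' ↔ ∃ w : Equiv.Perm (Fin 3), y'.1 = y.1 ∘ w := by
  change unlabel 3 y.toConf = unlabel 3 y'.toConf ↔ _
  rw [unlabel_eq_iff]
  constructor
  · intro h
    obtain ⟨g, hg⟩ := exists_relabel (z := y'.toConf) (w := y.toConf) h.symm
    exact ⟨g.symm, (congrArg Subtype.val hg).symm⟩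
  · rintro ⟨w, hw⟩
    change Set.range y.1 = Set.range y'.1
    rw [hw, w.surjective.range_comp]

/-- Every labelled configuration may be relabelled from the left to the right, and from bottom to
top on vertical lines. -/
theorem exists_sort {z : Fin 3 → ℂ} (hz : Function.Injective z) :
    ∃ u : Equiv.Perm (Fin 3), z ∘ u ∈ ascending ∧ Monotone fun i => (z (u i)).re := by
  let f : Fin 3 → ℝ ×ₗ ℝ := fun i => toLex ((z i).re, (z i).im)
  have hm : Monotone (f ∘ Tuple.sort f) := Tuple.monotone_sort f
  refine ⟨Tuple.sort f, fun i j hij => ?_, fun i j hij => ?_⟩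
  · rcases Prod.Lex.le_iff.1 (hm hij.le) with h | ⟨h, h'⟩
    · exact Or.inl (ne_of_lt h)
    · right
      refine lt_of_le_of_ne h' fun e => hij.ne ?_
      exact (Tuple.sort f).injective (hz (Complex.ext h e))
  · rcases Prod.Lex.le_iff.1 (hm hij) with h | ⟨h, h'⟩
    · exact h.le
    · exact h.le

theorem shape_surjective : Function.Surjective shape := by
  intro c
  obtain ⟨z, rfl⟩ := Quotient.exists_rep c
  obtain ⟨u, hu, -⟩ := exists_sort z.2
  refine ⟨⟨_, hu⟩, unlabel_eq_iff.2 ?_⟩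
  exact u.surjective.range_comp z.1

/-! ### The cocycle of crossings -/

section Cocycle

variable {G : Type*} [Group G]

/-- The positive braid word in `a` and `b` which takes the standard order of three labels to the
order from the left to the right of the points with these labels, which have the real parts `x`,
`y` and `z`. -/
def crossing (a b : G) (x y z : ℝ) : G :=
  if y < x then
    if z < x then if z < y then a * b * a else b * a else a
  else if z < y then if z < x then a * b else b else 1

-- The word has one letter for each inverted pair of labels. Passing from `r` to `r'` keeps strict
-- inequalities and can only invert pairs that were tied. Since `u` sorts `r` and lists ties in the
-- order of labels, inversions add up and the positive words multiply; the braid relation settles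
-- the choice between the two words of length three.
set_option maxHeartbeats 1000000 in
theorem crossing_eq_mul {a b : G} (hab : a * b * a = b * a * b) {r r' : Fin 3 → ℝ}
    (u : Equiv.Perm (Fin 3)) (hmono : Monotone (r ∘ u))
    (htie : ∀ i j, i < j → r (u i) = r (u j) → u i < u j)
    (hlt : ∀ i j, r i < r j → r' i < r' j) :
    crossing a b (r' 0) (r' 1) (r' 2) =
      crossing a b (r' (u 0)) (r' (u 1)) (r' (u 2)) * crossing a b (r 0) (r 1) (r 2) := by
  have key : ∀ i j, i < j → r (u i) ≤ r (u j) ∧ (u i < u j ∨ r (u i) < r (u j)) ∧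
      (u i < u j ∨ r' (u i) < r' (u j)) := by
    intro i j hij
    have h := hmono hij.le
    rcases h.lt_or_eq with h' | h'
    · exact ⟨h, Or.inr h', Or.inr (hlt _ _ h')⟩
    · exact ⟨h, Or.inl (htie i j hij h'), Or.inl (htie i j hij h')⟩
  obtain ⟨h01, f01, g01⟩ := key 0 1 (by decide)
  obtain ⟨h12, f12, g12⟩ := key 1 2 (by decide)
  obtain ⟨h02, f02, g02⟩ := key 0 2 (by decide)
  have hab' : a * (b * a) = b * (a * b) := by simpa [mul_assoc] using hab
  obtain ⟨p, hp⟩ : ∃ p, u 0 = p := ⟨_, rfl⟩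
  obtain ⟨q, hq⟩ : ∃ q, u 1 = q := ⟨_, rfl⟩
  obtain ⟨s, hs⟩ : ∃ s, u 2 = s := ⟨_, rfl⟩
  have hpq : p ≠ q := by rw [← hp, ← hq]; exact u.injective.ne (by decide)
  have hps : p ≠ s := by rw [← hp, ← hs]; exact u.injective.ne (by decide)
  have hqs : q ≠ s := by rw [← hq, ← hs]; exact u.injective.ne (by decide)
  rw [hp, hq] at h01 f01 g01
  rw [hq, hs] at h12 f12 g12
  rw [hp, hs] at h02 f02 g02
  rw [hp, hq, hs]
  clear hp hq hs hlt htie hmono key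
  fin_cases p <;> fin_cases q <;> first | exact absurd rfl hpq | skip
  all_goals fin_cases s <;> first | exact absurd rfl hps | exact absurd rfl hqs | skip
  all_goals simp at h01 h12 h02 f01 f12 f02 g01 g12 g02 ⊢
  all_goals simp only [crossing]
  all_goals split_ifs <;> first
    | (exfalso; linarith)
    | (simp only [mul_assoc, one_mul]; done)
    | simp only [mul_assoc, hab']

end Cocycle

section Cocycle

variable {G : Type*} [Group G]

/-- The positive braid word which sorts the labels of a configuration. -/
def Ascending.word (a b : G) (y : Ascending) : G :=
  crossing a b (y.1 0).re (y.1 1).re (y.1 2).re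

/-- Near an ascending configuration, the braid words change as if they started from the sorted
configuration. -/
theorem eventually_word_eq {a b : G} (hab : a * b * a = b * a * b) (y : Ascending)
    (u : Equiv.Perm (Fin 3)) (hu : y.1 ∘ u ∈ ascending) (hmono : Monotone fun i => (y.1 (u i)).re) :
    ∀ᶠ y' : Ascending in nhds y, y'.word a b =
      crossing a b (y'.1 (u 0)).re (y'.1 (u 1)).re (y'.1 (u 2)).re * y.word a b := by
  have h : ∀ᶠ y' : Ascending in nhds y, ∀ i j, (y.1 i).re < (y.1 j).re →
      (y'.1 i).re < (y'.1 j).re := by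
    refine Filter.eventually_all.2 fun i => Filter.eventually_all.2 fun j => ?_
    by_cases hij : (y.1 i).re < (y.1 j).re
    · have hc : ∀ k, Continuous fun y' : Ascending => (y'.1 k).re := fun k =>
        Complex.continuous_re.comp ((continuous_apply k).comp continuous_subtype_val)
      filter_upwards [(hc i).continuousAt.eventually_lt (hc j).continuousAt hij] with y' h _
      exact h
    · exact Filter.Eventually.of_forall fun _ h => absurd h hij
  filter_upwards [h] with y' hy'
  refine crossing_eq_mul hab (r := fun i => (y.1 i).re) (r' := fun i => (y'.1 i).re) u hmono ?_ hy'
  intro i j hij e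
  rcases hu i j hij with h | h
  · exact absurd e h
  · by_contra hn
    have hne : u i ≠ u j := u.injective.ne hij.ne
    rcases y.2 (u j) (u i) (lt_of_le_of_ne (not_lt.1 hn) hne.symm) with h' | h'
    · exact h' e.symm
    · exact lt_asymm h h'

/-- For two labellings of a moving configuration, the quotient of the braid words is locally
constant. -/
theorem eventually_cocycle_eq {a b : G} (hab : a * b * a = b * a * b) {A : Type*}
    [TopologicalSpace A] {f f' : A → Ascending} {x : A} (hf : ContinuousAt f x)
    (hf' : ContinuousAt f' x) (hx : ∀ᶠ x' in nhds x, shape (f x') = shape (f' x')) :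
    ∀ᶠ x' in nhds x, ((f' x').word a b)⁻¹ * (f x').word a b =
      ((f' x).word a b)⁻¹ * (f x).word a b := by
  obtain ⟨w, hw⟩ := shape_eq_iff.1 hx.self_of_nhds
  obtain ⟨u, hu, hmono⟩ := exists_sort (injective_of_mem_ascending (f x).2)
  have e : ∀ i, (f x).1 (u i) = (f' x).1 ((w.symm * u) i) := fun i => by
    rw [hw]; simp
  have hu' : (f' x).1 ∘ (w.symm * u) ∈ ascending := by
    have : (f' x).1 ∘ (w.symm * u) = (f x).1 ∘ u := (funext e).symm
    rwa [this]
  have hmono' : Monotone fun i => ((f' x).1 ((w.symm * u) i)).re := by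
    simpa only [← e] using hmono
  -- Both relabelled configurations are close to the same one, and so they agree.
  have hsame : ∀ᶠ x' in nhds x, (f x').1 ∘ u = (f' x').1 ∘ (w.symm * u) := by
    let g : Equiv.Perm (Fin 3) → Ascending → OrderedConf 3 := fun v y => v.symm • y.toConf
    have hg : ∀ v, Continuous (g v) := fun v =>
      (continuous_const_smul v.symm).comp isOpenEmbedding_toConf.continuous
    obtain ⟨U, hU, hinj⟩ := (isCoveringMap_unlabel 3).isLocalHomeomorph.isLocallyInjective
      |> isLocallyInjective_iff_nhds.1 <| g u (f x)
    have h1 := ((hg u).continuousAt.comp hf) hU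
    have h2 : ∀ᶠ x' in nhds x, g (w.symm * u) (f' x') ∈ U := by
      refine ((hg (w.symm * u)).continuousAt.comp hf') ?_
      have : g (w.symm * u) (f' x) = g u (f x) := Subtype.ext (funext fun i => (e i).symm)
      simpa [this] using hU
    filter_upwards [h1, h2, hx] with x' h1 h2 h3
    refine congrArg Subtype.val (hinj h1 h2 ?_)
    rw [unlabel_eq_iff]
    change Set.range ((f x').1 ∘ u) = Set.range ((f' x').1 ∘ (w.symm * u))
    rw [u.surjective.range_comp, (w.symm * u).surjective.range_comp]
    exact unlabel_eq_iff.1 h3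
  filter_upwards [hf.eventually (eventually_word_eq hab (f x) u hu hmono),
    hf'.eventually (eventually_word_eq hab (f' x) (w.symm * u) hu' hmono'), hsame] with x' h1 h2 h3
  have h3' : ∀ i, (f x').1 (u i) = (f' x').1 ((w.symm * u) i) := congrFun h3
  -- The factors which come from the common sorted labelling cancel in the quotient.
  rw [h1, h2, h3', h3', h3']
  group

/-! ### The covering space defined by the cocycle -/

/-- A local inverse of `shape`. -/
def chart (y : Ascending) : OpenPartialHomeomorph Ascending (Conf 3) :=
  (isLocalHomeomorph_shape y).choose

theorem mem_chart_source (y : Ascending) : y ∈ (chart y).source :=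
  (isLocalHomeomorph_shape y).choose_spec.1

theorem coe_chart (y : Ascending) : (chart y : Ascending → Conf 3) = shape :=
  (isLocalHomeomorph_shape y).choose_spec.2.symm

theorem shape_mem_target (y : Ascending) : shape y ∈ (chart y).target := by
  rw [← coe_chart y]; exact (chart y).map_source (mem_chart_source y)

theorem shape_chart_symm {y : Ascending} {c : Conf 3} (hc : c ∈ (chart y).target) :
    shape ((chart y).symm c) = c := by
  rw [← coe_chart y]; exact (chart y).right_inv hc

/-- An ascending labelling of a configuration. -/
def someLabel (c : Conf 3) : Ascending := (shape_surjective c).choose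

theorem shape_someLabel (c : Conf 3) : shape (someLabel c) = c := (shape_surjective c).choose_spec

/-- The coordinates of the principal bundle whose monodromy is the representation of the braid
group which takes the generators to `a` and `b`. -/
def braidBundle [TopologicalSpace G] [DiscreteTopology G] {a b : G}
    (hab : a * b * a = b * a * b) : FiberBundleCore Ascending (Conf 3) G where
  baseSet y := (chart y).target
  isOpen_baseSet y := (chart y).open_target
  indexAt := someLabel
  mem_baseSet_at c := by
    have := shape_mem_target (someLabel c)
    rwa [shape_someLabel] at this
  coordChange i j c v :=
    (((chart j).symm c).word a b)⁻¹ * ((chart i).symm c).word a b * v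
  coordChange_self i c _ v := by group
  continuousOn_coordChange i j := by
    rintro ⟨c, v⟩ ⟨⟨hi, hj⟩, -⟩
    have hi' := (chart i).open_target.mem_nhds hi
    have hj' := (chart j).open_target.mem_nhds hj
    -- The transition functions are locally constant, as a bundle with discrete fiber requires.
    have := eventually_cocycle_eq hab (x := c)
      ((chart i).continuousAt_symm hi) ((chart j).continuousAt_symm hj)
      (by filter_upwards [hi', hj'] with x hx hx'; rw [shape_chart_symm hx, shape_chart_symm hx'])
    have h2 : ∀ᶠ p : Conf 3 × G in nhds (c, v),
        (((chart j).symm p.1).word a b)⁻¹ * ((chart i).symm p.1).word a b * p.2 =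
        (((chart j).symm c).word a b)⁻¹ * ((chart i).symm c).word a b * p.2 := by
      filter_upwards [continuous_fst.continuousAt.eventually this] with p hp
      rw [hp]
    refine ContinuousAt.continuousWithinAt (ContinuousAt.congr ?_ (h2.mono fun p hp => hp.symm))
    exact (continuous_of_discreteTopology (f := fun v : G =>
      (((chart j).symm c).word a b)⁻¹ * ((chart i).symm c).word a b * v)).continuousAt.comp
      continuousAt_snd
  coordChange_comp i j k c _ v := by group

section Monodromy

variable [TopologicalSpace G] [DiscreteTopology G] {a b : G} (hab : a * b * a = b * a * b)

/-- The point of the bundle over `c` with coordinate `v` with respect to the sorted labels. -/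
def bundlePoint (c : Conf 3) (v : G) : (braidBundle hab).TotalSpace :=
  ⟨c, (((chart (someLabel c)).symm c).word a b)⁻¹ * v⟩

theorem bundlePoint_injective (c : Conf 3) : Function.Injective (bundlePoint hab c) := by
  intro v w h
  have := (Bundle.TotalSpace.mk_inj (F := G) (E := (braidBundle hab).Fiber)).1 h
  exact mul_left_cancel (G := G) this

theorem isCoveringMap_braidBundle :
    IsCoveringMap (Bundle.TotalSpace.proj : (braidBundle hab).TotalSpace → Conf 3) :=
  FiberBundle.isCoveringMap (F := G) (E := (braidBundle hab).Fiber)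

/-- The section of the bundle over the ascending configurations. -/
def bundleLift (v : G) : C(Ascending, (braidBundle hab).TotalSpace) where
  toFun y := bundlePoint hab (shape y) (y.word a b * v)
  continuous_toFun := by
    rw [continuous_iff_continuousAt]
    intro y
    rw [FiberBundle.continuousAt_totalSpace]
    refine ⟨shape.continuous.continuousAt, ?_⟩
    let i := someLabel (shape y)
    have hmem : ∀ᶠ y' in nhds y, shape y' ∈ (chart i).target :=
      shape.continuous.continuousAt
        ((chart i).open_target.mem_nhds ((braidBundle hab).mem_baseSet_at (shape y)))
    have hmem' := hmem.self_of_nhds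
    have key := eventually_cocycle_eq hab (x := y) (f := id)
      (f' := fun y' => (chart i).symm (shape y')) continuousAt_id
      (((chart i).continuousAt_symm hmem').comp shape.continuous.continuousAt)
      (by filter_upwards [hmem] with y' hy'; rw [shape_chart_symm hy', id])
    have : ∀ y', (trivializationAt G (braidBundle hab).Fiber
        (bundlePoint hab (shape y) (y.word a b * v)).proj
        (bundlePoint hab (shape y') (y'.word a b * v))).2 =
        (((chart i).symm (shape y')).word a b)⁻¹ * y'.word a b * v := by
      intro y'
      change (((chart i).symm (shape y')).word a b)⁻¹ *
        ((chart (someLabel (shape y'))).symm (shape y')).word a b *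
        ((((chart (someLabel (shape y'))).symm (shape y')).word a b)⁻¹ * (y'.word a b * v)) = _
      group
    simp only [this]
    refine ContinuousAt.congr (f := fun _ => (((chart i).symm (shape y)).word a b)⁻¹ *
      y.word a b * v) continuousAt_const ?_
    filter_upwards [key] with y' hy'
    rw [id, id] at hy'
    rw [hy']

end Monodromy

end Cocycle

/-! ### Paths of ascending configurations and their monodromy -/

/-- The homotopy class of the motions from one ascending configuration to another one. -/
def slide (y y' : Ascending) : Path.Homotopic.Quotient (shape y) (shape y') :=
  (Path.Homotopic.Quotient.mk (PathConnectedSpace.somePath y y')).map shape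

/-- The ascending configurations are contractible, so the choice of the path does not matter. -/
theorem slide_eq {y y' : Ascending} (p : Path y y') :
    slide y y' = Path.Homotopic.Quotient.mk (p.map shape.continuous) := by
  rw [slide, Path.Homotopic.Quotient.mk_map]
  exact congrArg (fun q => Path.Homotopic.Quotient.map q shape) (Subsingleton.elim _ _)

theorem slide_trans (y y' y'' : Ascending) :
    (slide y y').trans (slide y' y'') = slide y y'' := by
  rw [slide_eq (PathConnectedSpace.somePath y y'), slide_eq (PathConnectedSpace.somePath y' y''),
    slide_eq ((PathConnectedSpace.somePath y y').trans (PathConnectedSpace.somePath y' y'')),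
    ← Path.Homotopic.Quotient.mk_trans, Path.map_trans]

theorem slide_self (y : Ascending) : slide y y = Path.Homotopic.Quotient.refl _ := by
  rw [slide_eq (Path.refl y)]
  rfl

/-- `bundleLift` lifts the whole path, so the monodromy is read off at its end. The equations `hy`
and `hy'` allow the endpoints to be `base`, which equals the shape of a labelling only
propositionally. -/
theorem monodromy_slide {G : Type*} [Group G] [TopologicalSpace G] [DiscreteTopology G] {a b : G}
    (hab : a * b * a = b * a * b) {y y' : Ascending} {c c' : Conf 3} (hy : c = shape y)
    (hy' : c' = shape y') (v : G) :
    ((isCoveringMap_braidBundle hab).monodromy ((slide y y').cast hy hy')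
      ⟨bundlePoint hab c (y.word a b * v), rfl⟩).1 = bundlePoint hab c' (y'.word a b * v) := by
  subst hy hy'
  rw [Path.Homotopic.Quotient.cast_rfl_rfl]
  have h := (isCoveringMap_braidBundle hab).monodromy_map
    ((Path.Homotopic.Quotient.mk (PathConnectedSpace.somePath y y')).map (bundleLift hab v))
  exact congrArg Subtype.val h

/-! ### Arriving at a configuration through ascending configurations -/

theorem standard_mem_ascending (w : Equiv.Perm (Fin 3)) :
    (![-1, 0, 1] : Fin 3 → ℂ) ∘ w ∈ ascending := by
  refine mem_ascending_of_re fun i j hij => ?_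
  have : w i ≠ w j := w.injective.ne hij
  simp only [Function.comp_apply]
  generalize w i = a at *
  generalize w j = b at *
  fin_cases a <;> fin_cases b <;> first | exact absurd rfl this | norm_num

/-- The labellings of the base configuration. -/
def standard (w : Equiv.Perm (Fin 3)) : Ascending := ⟨![-1, 0, 1] ∘ w, standard_mem_ascending w⟩

theorem shape_standard (w : Equiv.Perm (Fin 3)) : shape (standard w) = base :=
  unlabel_eq_iff.2 (w.surjective.range_comp (![-1, 0, 1] : Fin 3 → ℂ))

/-- The class of the motions which start from the standard labelling of the base configuration and
arrive at `y` through ascending configurations. -/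
def arrive {c : Conf 3} (y : Ascending) (hy : shape y = c) : Path.Homotopic.Quotient base c :=
  (slide (standard 1) y).cast (shape_standard 1).symm hy.symm

theorem arrive_standard_one : arrive (standard 1) (shape_standard 1) =
    Path.Homotopic.Quotient.refl base := by
  rw [arrive, slide_self]
  rfl

theorem arrive_trans {c c' : Conf 3} {y y' : Ascending} (hy : shape y = c) (hy' : shape y' = c')
    (γ : Path c c') (p : Path y y') (hγ : ∀ t, shape (p t) = γ t) :
    (arrive y hy).trans (Path.Homotopic.Quotient.mk γ) = arrive y' hy' := by
  subst hy hy'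
  have : γ = p.map shape.continuous := by
    ext t
    exact (hγ t).symm
  rw [this, ← slide_eq, arrive, arrive, ← slide_trans (standard 1) y y']
  rfl

/-- A path of ascending configurations. -/
def ascendingPath (y y' : Ascending) (f : unitInterval → Fin 3 → ℂ) (hf : Continuous f)
    (hmem : ∀ t, f t ∈ ascending) (h0 : f 0 = y.1) (h1 : f 1 = y'.1) : Path y y' where
  toFun t := ⟨f t, hmem t⟩
  continuous_toFun := hf.subtype_mk _
  source' := Subtype.ext h0
  target' := Subtype.ext h1

/-- The braid which relabels the base configuration. -/
def relabelBraid (w : Equiv.Perm (Fin 3)) : B₃ :=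
  FundamentalGroup.fromPath (arrive (standard w) (shape_standard w))

theorem relabelBraid_one : relabelBraid 1 = 1 := arrive_standard_one

/-- If the labelling `w` stays ascending while the points move along `γ`, then arriving at `w` and
continuing along `γ` is a way to arrive at the labelling `s * w`. -/
theorem relabelBraid_mul (γ : Path base base) (s w : Equiv.Perm (Fin 3))
    (f : unitInterval → Fin 3 → ℂ) (hf : Continuous f) (hinj : ∀ t, Function.Injective (f t))
    (hγ : ∀ t, γ t = unlabel 3 ⟨f t, hinj t⟩) (hmem : ∀ t, f t ∘ w ∈ ascending)
    (h0 : f 0 = ![-1, 0, 1]) (h1 : f 1 = ![-1, 0, 1] ∘ s) :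
    relabelBraid (s * w) = braidClass γ * relabelBraid w := by
  rw [FundamentalGroup.mul_def]
  refine (arrive_trans (shape_standard w) (shape_standard (s * w)) γ
    (ascendingPath (standard w) (standard (s * w)) (fun t => f t ∘ w) ?_ hmem ?_ ?_)
    fun t => ?_).symm
  · exact continuous_pi fun i => (continuous_apply (w i)).comp hf
  · rw [h0]; rfl
  · rw [h1]; rfl
  · rw [hγ]
    exact unlabel_eq_iff.2 (w.surjective.range_comp (f t))

theorem halfTurn_im (t : unitInterval) : (halfTurn t).im = Real.sin (Real.pi * t) := by
  rw [halfTurn, Complex.exp_ofReal_mul_I_im]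

theorem halfTurn_im_nonneg (t : unitInterval) : 0 ≤ (halfTurn t).im := by
  rw [halfTurn_im]
  have h0 := t.2.1
  have h1 := t.2.2
  have := Real.pi_pos
  exact Real.sin_nonneg_of_nonneg_of_le_pi (by positivity) (by nlinarith)

theorem halfTurn_re_ne_or_im_pos (t : unitInterval) :
    (halfTurn t).re ≠ 0 ∨ 0 < (halfTurn t).im := by
  by_contra! h
  refine halfTurn_ne_zero t (Complex.ext h.1 ?_)
  exact le_antisymm h.2 (halfTurn_im_nonneg t)

/-- During the counterclockwise half turn the point from `-1` passes below the one from `0`. The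
condition `hw` says that it has the smaller label, so the labelling is still ascending when the two
are vertically aligned. -/
theorem relabelBraid_swap_zero_one {w : Equiv.Perm (Fin 3)} (hw : w.symm 0 < w.symm 1) :
    relabelBraid (Equiv.swap 0 1 * w) = σ₁ * relabelBraid w := by
  refine relabelBraid_mul sigmaOnePath _ w
    (fun t => ![-1 / 2 - halfTurn t / 2, -1 / 2 + halfTurn t / 2, 1]) ?_ sigmaOne_injective
    (fun t => rfl) (fun t i j hij => ?_) ?_ ?_
  · refine continuous_pi fun i => ?_
    have := continuous_halfTurn
    fin_cases i <;> simp <;> fun_prop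
  · have hne : w i ≠ w j := w.injective.ne hij.ne
    have hb : ¬ (w i = 1 ∧ w j = 0) := by
      rintro ⟨h1, h2⟩
      rw [← h1, ← h2, Equiv.symm_apply_apply, Equiv.symm_apply_apply] at hw
      exact lt_asymm hw hij
    have h := halfTurn_re_ne_or_im_pos t
    have hr := abs_le.1 ((Complex.abs_re_le_norm (halfTurn t)).trans_eq (norm_halfTurn t))
    simp only [Function.comp_apply]
    generalize w i = a at *
    generalize w j = b at *
    fin_cases a <;> fin_cases b <;> first
      | exact absurd rfl hne
      | exact absurd ⟨rfl, rfl⟩ hb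
      | skip
    · rcases h with h | h
      · left
        intro e
        simp at e
        exact h (by linarith)
      · right
        simp
        linarith
    all_goals
      left
      intro e
      simp at e
      linarith
  · simp only [halfTurn_zero]
    ext i
    fin_cases i <;> norm_num
  · simp only [halfTurn_one]
    ext i
    fin_cases i <;> simp [Equiv.swap_apply_def]

theorem relabelBraid_swap_one_two {w : Equiv.Perm (Fin 3)} (hw : w.symm 1 < w.symm 2) :
    relabelBraid (Equiv.swap 1 2 * w) = σ₂ * relabelBraid w := by
  refine relabelBraid_mul sigmaTwoPath _ w
    (fun t => ![-1, 1 / 2 - halfTurn t / 2, 1 / 2 + halfTurn t / 2]) ?_ sigmaTwo_injective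
    (fun t => rfl) (fun t i j hij => ?_) ?_ ?_
  · refine continuous_pi fun i => ?_
    have := continuous_halfTurn
    fin_cases i <;> simp <;> fun_prop
  · have hne : w i ≠ w j := w.injective.ne hij.ne
    have hb : ¬ (w i = 2 ∧ w j = 1) := by
      rintro ⟨h1, h2⟩
      rw [← h1, ← h2, Equiv.symm_apply_apply, Equiv.symm_apply_apply] at hw
      exact lt_asymm hw hij
    have h := halfTurn_re_ne_or_im_pos t
    have hr := abs_le.1 ((Complex.abs_re_le_norm (halfTurn t)).trans_eq (norm_halfTurn t))
    simp only [Function.comp_apply]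
    generalize w i = a at *
    generalize w j = b at *
    fin_cases a <;> fin_cases b <;> first
      | exact absurd rfl hne
      | exact absurd ⟨rfl, rfl⟩ hb
      | skip
    -- This is the pair of moving points, the only one which can become vertically aligned.
    pick_goal 4
    · rcases h with h | h
      · left
        intro e
        simp at e
        exact h (by linarith)
      · right
        simp
        linarith
    all_goals
      left
      intro e
      simp at e
      linarith
  · simp only [halfTurn_zero]
    ext i
    fin_cases i <;> norm_num
  · simp only [halfTurn_one]
    ext i
    fin_cases i <;> simp [Equiv.swap_apply_def] <;> norm_num

/-! ### The half twist -/

theorem delta_injective (t : unitInterval) :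
    Function.Injective (![-halfTurn t, 0, halfTurn t] : Fin 3 → ℂ) := by
  have h0 := halfTurn_ne_zero t
  have h1 : -halfTurn t ≠ halfTurn t := fun h => h0 (by linear_combination -h / 2)
  intro i j h
  fin_cases i <;> fin_cases j <;> simp at h ⊢
  · exact h0 h
  · exact h1 h
  · exact h0 h
  · exact h0 h.symm
  · exact h1 h.symm
  · exact h0 h

/-- The three points are rotated counterclockwise by a half turn. -/
def deltaPath : Path base base where
  toFun t := unlabel 3 ⟨_, delta_injective t⟩
  continuous_toFun := by
    refine continuous_quotient_mk'.comp (Continuous.subtype_mk ?_ _)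
    refine continuous_pi fun i => ?_
    have := continuous_halfTurn
    fin_cases i <;> simp <;> fun_prop
  source' := by
    refine unlabel_eq_iff.2 ?_
    simp only [halfTurn_zero]
  target' := by
    refine unlabel_eq_iff.2 ?_
    simp only [halfTurn_one, Matrix.range_cons, Matrix.range_empty]
    norm_num
    ext x
    simp only [Set.mem_insert_iff, Set.mem_singleton_iff]
    tauto

theorem relabelBraid_swap_zero_two : relabelBraid (Equiv.swap 0 2) = braidClass deltaPath := by
  have := relabelBraid_mul deltaPath (Equiv.swap 0 2) 1
    (fun t => ![-halfTurn t, 0, halfTurn t]) ?_ delta_injective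
    (fun t => rfl) (fun t i j hij => ?_) ?_ ?_
  · rwa [mul_one, relabelBraid_one, mul_one] at this
  · refine continuous_pi fun i => ?_
    have := continuous_halfTurn
    fin_cases i <;> simp <;> fun_prop
  · rcases halfTurn_re_ne_or_im_pos t with h | h
    · left
      fin_cases i <;> fin_cases j <;> simp at hij ⊢
      · exact h
      · intro e; exact h (by linarith)
      · exact h.symm
    · right
      fin_cases i <;> fin_cases j <;> simp at hij ⊢
      · exact h
      · linarith
      · exact h
  · simp only [halfTurn_zero]
  · simp only [halfTurn_one]
    ext i
    fin_cases i <;> simp [Equiv.swap_apply_def]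

theorem relabelBraid_s₁ : relabelBraid (Equiv.swap 0 1) = σ₁ := by
  have := relabelBraid_swap_zero_one (w := 1) (by decide)
  rwa [mul_one, relabelBraid_one, mul_one] at this

theorem relabelBraid_s₂ : relabelBraid (Equiv.swap 1 2) = σ₂ := by
  have := relabelBraid_swap_one_two (w := 1) (by decide)
  rwa [mul_one, relabelBraid_one, mul_one] at this

theorem relabelBraid_s₁s₂ : relabelBraid (Equiv.swap 0 1 * Equiv.swap 1 2) = σ₁ * σ₂ := by
  rw [relabelBraid_swap_zero_one (by decide), relabelBraid_s₂]

theorem relabelBraid_s₂s₁ : relabelBraid (Equiv.swap 1 2 * Equiv.swap 0 1) = σ₂ * σ₁ := by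
  rw [relabelBraid_swap_one_two (by decide), relabelBraid_s₁]

theorem braidClass_deltaPath : braidClass deltaPath = σ₁ * σ₂ * σ₁ := by
  rw [← relabelBraid_swap_zero_two, mul_assoc, ← relabelBraid_s₂s₁,
    ← relabelBraid_swap_zero_one (by decide)]
  congr 1
  decide

/-- The transposition of the outer points has two reduced words; building its relabelling braid
along each of them gives the two sides. -/
theorem braid_relation : σ₁ * σ₂ * σ₁ = σ₂ * σ₁ * σ₂ := by
  rw [← braidClass_deltaPath, ← relabelBraid_swap_zero_two, mul_assoc, ← relabelBraid_s₁s₂,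
    ← relabelBraid_swap_one_two (by decide)]
  congr 1
  decide

theorem relabelBraid_mem (w : Equiv.Perm (Fin 3)) :
    relabelBraid w ∈ Subgroup.closure {σ₁, σ₂} := by
  have h1 : σ₁ ∈ Subgroup.closure {σ₁, σ₂} := Subgroup.subset_closure (by simp)
  have h2 : σ₂ ∈ Subgroup.closure {σ₁, σ₂} := Subgroup.subset_closure (by simp)
  have : ∀ w : Equiv.Perm (Fin 3), w = 1 ∨ w = Equiv.swap 0 1 ∨ w = Equiv.swap 1 2 ∨
      w = Equiv.swap 0 1 * Equiv.swap 1 2 ∨ w = Equiv.swap 1 2 * Equiv.swap 0 1 ∨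
      w = Equiv.swap 0 2 := by decide
  rcases this w with rfl | rfl | rfl | rfl | rfl | rfl
  · rw [relabelBraid_one]; exact one_mem _
  · rw [relabelBraid_s₁]; exact h1
  · rw [relabelBraid_s₂]; exact h2
  · rw [relabelBraid_s₁s₂]; exact mul_mem h1 h2
  · rw [relabelBraid_s₂s₁]; exact mul_mem h2 h1
  · rw [relabelBraid_swap_zero_two, braidClass_deltaPath]
    exact mul_mem (mul_mem h1 h2) h1

/-! ### The braid group is generated by the two half turns -/

/-- Two ascending labellings of the same configuration are related when the difference of the ways
to arrive at them is a product of half turns. -/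
def Related (y y' : Ascending) : Prop :=
  ∃ (e : shape y' = shape y) (g : Path.Homotopic.Quotient base base),
    FundamentalGroup.fromPath g ∈ Subgroup.closure {σ₁, σ₂} ∧
      arrive y rfl = g.trans (arrive y' e)

theorem Related.refl (y : Ascending) : Related y y := by
  refine ⟨rfl, Path.Homotopic.Quotient.refl base, ?_, ?_⟩
  · exact one_mem (Subgroup.closure {σ₁, σ₂})
  · rw [Path.Homotopic.Quotient.refl_trans]

theorem Related.symm {y y' : Ascending} (h : Related y y') : Related y' y := by
  obtain ⟨e, g, hg, h⟩ := h
  refine ⟨e.symm, g.symm, ?_, ?_⟩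
  · exact inv_mem hg
  -- The configurations are generalized so that the equality of shapes can be substituted away.
  · have : ∀ {c c' : Conf 3} (hc : c = c') (hy : shape y' = c) (hy' : shape y = c)
        (k : shape y = c') (k' : shape y' = c'),
        arrive y k = g.trans (arrive y' k') → arrive y' hy = g.symm.trans (arrive y hy') := by
      rintro c c' rfl hy hy' k k' h
      rw [h, ← Path.Homotopic.Quotient.trans_assoc, Path.Homotopic.Quotient.symm_trans,
        Path.Homotopic.Quotient.refl_trans]
    exact this e rfl e.symm rfl e h

theorem Related.arrive_eq {y y' : Ascending} (h : Related y y') {c : Conf 3} (hy : shape y = c)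
    (hy' : shape y' = c) : ∃ g : Path.Homotopic.Quotient base base,
    FundamentalGroup.fromPath g ∈ Subgroup.closure {σ₁, σ₂} ∧
      arrive y hy = g.trans (arrive y' hy') := by
  subst hy
  exact h.2

theorem Related.trans {y y' y'' : Ascending} (h : Related y y') (h' : Related y' y'') :
    Related y y'' := by
  obtain ⟨e, g, hg, h⟩ := h
  have e' := h'.1.trans e
  obtain ⟨g', hg', h'⟩ := h'.arrive_eq e e'
  refine ⟨e', g.trans g', ?_, ?_⟩
  · exact mul_mem hg' hg
  · rw [h, h', Path.Homotopic.Quotient.trans_assoc]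

/-- Both arrivals are prolonged by the same path of configurations, so their difference does not
change. -/
theorem Related.move {y y' z z' : Ascending} (h : Related y y') (p : Path y z) (p' : Path y' z')
    (hp : ∀ t, shape (p' t) = shape (p t)) : Related z z' := by
  have e : shape z' = shape z := by simpa using hp 1
  obtain ⟨e', g, hg, h⟩ := h
  refine ⟨e, g, hg, ?_⟩
  rw [← arrive_trans rfl rfl (p.map shape.continuous) p (fun t => rfl),
    ← arrive_trans e' e (p.map shape.continuous) p' hp, h, Path.Homotopic.Quotient.trans_assoc]

theorem related_standard (w : Equiv.Perm (Fin 3)) : Related (standard 1) (standard w) := by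
  suffices h : ∀ {c : Conf 3} (hc : base = c) (hy : shape (standard 1) = c)
      (hy' : shape (standard w) = c), ∃ g : Path.Homotopic.Quotient base base,
      FundamentalGroup.fromPath g ∈ Subgroup.closure {σ₁, σ₂} ∧
      arrive (standard 1) hy = g.trans (arrive (standard w) hy') from
    ⟨(shape_standard w).trans (shape_standard 1).symm, h (shape_standard 1).symm rfl _⟩
  rintro c rfl hy hy'
  refine ⟨(arrive (standard w) hy').symm, inv_mem (relabelBraid_mem w), ?_⟩
  rw [Path.Homotopic.Quotient.symm_trans, arrive_standard_one]

/-- With distinct real parts every labelling is ascending, and this persists on the straight line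
from the base configuration. So the claim is transported from `related_standard`. -/
theorem related_sorted {z : Fin 3 → ℂ} (hz : StrictMono fun i => (z i).re) {y y' : Ascending}
    (w w' : Equiv.Perm (Fin 3)) (hy : y.1 = z ∘ w) (hy' : y'.1 = z ∘ w') : Related y y' := by
  suffices h : ∀ (y : Ascending) (w : Equiv.Perm (Fin 3)), y.1 = z ∘ w →
      ∀ y' : Ascending, y'.1 = z → Related y' y by
    have hmem : z ∈ ascending := mem_ascending_of_re fun i j hij => hz.injective.ne hij
    exact (h y w hy ⟨z, hmem⟩ rfl).symm.trans (h y' w' hy' ⟨z, hmem⟩ rfl)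
  intro y w hy y' hy'
  let f : unitInterval → Fin 3 → ℂ := fun t i =>
    ((1 - (t : ℝ) : ℝ) : ℂ) * (![-1, 0, 1] : Fin 3 → ℂ) i + ((t : ℝ) : ℂ) * z i
  have hf : Continuous f := by fun_prop
  have hmono : ∀ t, StrictMono fun i => (f t i).re := by
    intro t i j hij
    have h1 : ((![-1, 0, 1] : Fin 3 → ℂ) i).re < ((![-1, 0, 1] : Fin 3 → ℂ) j).re := by
      fin_cases i <;> fin_cases j <;> simp at hij ⊢
    have h2 := hz hij
    simp only [f, Complex.add_re, Complex.re_ofReal_mul] at h2 ⊢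
    rcases t.2.1.eq_or_lt with h | h
    · rw [← h]; linarith
    · have := mul_lt_mul_of_pos_left h2 h
      have := mul_le_mul_of_nonneg_left h1.le (sub_nonneg.2 t.2.2)
      linarith
  have hmem : ∀ (w : Equiv.Perm (Fin 3)) t, f t ∘ w ∈ ascending := fun w t =>
    mem_ascending_of_re fun i j hij => (hmono t).injective.ne (w.injective.ne hij)
  have hc : ∀ w : Equiv.Perm (Fin 3), Continuous fun t => f t ∘ w := fun w =>
    continuous_pi fun i => (continuous_apply (w i)).comp hf
  have h0 : f 0 = ![-1, 0, 1] := by ext i; simp [f]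
  have h1 : f 1 = z := by ext i; simp [f]
  refine (related_standard w).move
    (ascendingPath _ y' (fun t => f t ∘ (1 : Equiv.Perm (Fin 3))) (hc 1) (hmem 1) ?_ ?_)
    (ascendingPath _ y (fun t => f t ∘ w) (hc w) (hmem w) ?_ ?_) fun t => ?_
  · rw [h0]; rfl
  · rw [h1, hy']; rfl
  · rw [h0]; rfl
  · rw [h1, hy]
  · exact (shape_eq_iff.2 ⟨w, rfl⟩).symm

/-- A small horizontal shear keeps distinct real parts distinct and separates the points of a
vertical line. -/
theorem exists_shear {y : Fin 3 → ℂ} (hy : Function.Injective y) :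
    ∃ ε : ℝ, 0 < ε ∧ ∀ s ∈ Set.Ioc 0 ε, ∀ i j, i ≠ j →
      (y i).re + s * (y i).im ≠ (y j).re + s * (y j).im := by
  have : ∀ᶠ s in nhdsWithin (0 : ℝ) (Set.Ioi 0), ∀ i j, i ≠ j →
      (y i).re + s * (y i).im ≠ (y j).re + s * (y j).im := by
    refine Filter.eventually_all.2 fun i => Filter.eventually_all.2 fun j => ?_
    by_cases hij : i = j
    · exact Filter.Eventually.of_forall fun s h => absurd hij h
    by_cases hre : (y i).re = (y j).re
    · filter_upwards [self_mem_nhdsWithin] with s hs _ h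
      refine hij (hy (Complex.ext hre ?_))
      rw [hre] at h
      exact mul_left_cancel₀ (ne_of_gt hs) (add_left_cancel h)
    · have hc : ∀ k, Continuous fun s : ℝ => (y k).re + s * (y k).im := fun k => by fun_prop
      have := (isOpen_ne_fun (hc i) (hc j)).mem_nhds (x := 0) (by simpa using hre)
      filter_upwards [nhdsWithin_le_nhds this] with s hs _ using hs
  obtain ⟨ε, hε, h⟩ := mem_nhdsGT_iff_exists_Ioc_subset.1 this
  exact ⟨ε, hε, fun s hs => h hs⟩

/-- Both labellings stay ascending during a small shear, after which the real parts are distinct and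
`related_sorted` applies. `Related.move` then carries the relation back. -/
theorem related_of_shape_eq {y y' : Ascending} (h : shape y = shape y') : Related y y' := by
  obtain ⟨w, hw⟩ := shape_eq_iff.1 h
  obtain ⟨ε, hε, hne⟩ := exists_shear (injective_of_mem_ascending y.2)
  let f : unitInterval → Fin 3 → ℂ := fun t i => y.1 i + (((t : ℝ) * ε * (y.1 i).im : ℝ) : ℂ)
  have hf : Continuous f := by fun_prop
  have h0 : f 0 = y.1 := by ext i; simp [f]
  have hre : ∀ t i, (f t i).re = (y.1 i).re + (t : ℝ) * ε * (y.1 i).im := fun t i => by simp [f]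
  have hne' : ∀ t : unitInterval, t ≠ 0 → ∀ i j, i ≠ j → (f t i).re ≠ (f t j).re := by
    intro t ht i j hij
    rw [hre, hre]
    have h1 : (0 : ℝ) < t := lt_of_le_of_ne t.2.1 fun h => ht (Subtype.ext h.symm)
    exact hne _ ⟨mul_pos h1 hε, mul_le_of_le_one_left hε.le t.2.2⟩ i j hij
  have hmem : ∀ t, f t ∈ ascending ∧ f t ∘ w ∈ ascending := by
    intro t
    by_cases ht : t = 0
    · subst ht
      rw [h0, ← hw]
      exact ⟨y.2, y'.2⟩
    · exact ⟨mem_ascending_of_re (hne' t ht),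
        mem_ascending_of_re fun i j hij => hne' t ht _ _ (w.injective.ne hij)⟩
  have hinj := injective_of_mem_ascending (hmem 1).1
  obtain ⟨u, hu, hmono⟩ := exists_sort hinj
  have hs : StrictMono fun i => (f 1 (u i)).re :=
    hmono.strictMono_of_injective fun i j hij => by
      by_contra hne''
      exact hne' 1 one_ne_zero _ _ (u.injective.ne hne'') hij
  have key : Related ⟨f 1, (hmem 1).1⟩ ⟨f 1 ∘ w, (hmem 1).2⟩ := by
    refine related_sorted (z := f 1 ∘ u) hs u.symm (u.symm * w) ?_ ?_
    · ext i; simp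
    · ext i; simp
  have hfw : Continuous fun t => f t ∘ w := continuous_pi fun i => (continuous_apply (w i)).comp hf
  exact key.move
    (ascendingPath y ⟨f 1, (hmem 1).1⟩ f hf (fun t => (hmem t).1) h0 rfl).symm
    (ascendingPath y' ⟨f 1 ∘ w, (hmem 1).2⟩ (fun t => f t ∘ w) hfw (fun t => (hmem t).2)
      (by rw [h0, hw]) rfl).symm
    fun t => (shape_eq_iff.2 ⟨w, rfl⟩).symm

/-- The classes which differ from arriving through ascending configurations by half turns. -/
def IsReachable {c : Conf 3} (q : Path.Homotopic.Quotient base c) : Prop :=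
  ∀ (y : Ascending) (hy : shape y = c), ∃ g : Path.Homotopic.Quotient base base,
    FundamentalGroup.fromPath g ∈ Subgroup.closure {σ₁, σ₂} ∧ q = g.trans (arrive y hy)

theorem isReachable_of_exists {c : Conf 3} {q : Path.Homotopic.Quotient base c} (y : Ascending)
    (hy : shape y = c) (g : Path.Homotopic.Quotient base base)
    (hg : FundamentalGroup.fromPath g ∈ Subgroup.closure {σ₁, σ₂})
    (hq : q = g.trans (arrive y hy)) : IsReachable q := by
  intro y' hy'
  obtain ⟨g', hg', h⟩ := (related_of_shape_eq (hy.trans hy'.symm)).arrive_eq hy hy'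
  refine ⟨g.trans g', mul_mem hg' hg, ?_⟩
  rw [hq, h, Path.Homotopic.Quotient.trans_assoc]

/-- A path inside the target of one chart lifts to ascending configurations, so it only prolongs an
arrival; the labelling at the start may be switched at the cost of half turns. -/
theorem IsReachable.trans {c c' : Conf 3} {q : Path.Homotopic.Quotient base c}
    (hq : IsReachable q) (γ : Path c c') (y : Ascending)
    (hγ : ∀ t, γ t ∈ (chart y).target) :
    IsReachable (q.trans (Path.Homotopic.Quotient.mk γ)) := by
  have hc : c ∈ (chart y).target := by simpa using hγ 0
  have hc' : c' ∈ (chart y).target := by simpa using hγ 1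
  obtain ⟨g, hg, h⟩ := hq _ (shape_chart_symm hc)
  let p : Path ((chart y).symm c) ((chart y).symm c') :=
    { toFun := fun t => (chart y).symm (γ t)
      continuous_toFun := (chart y).continuousOn_symm.comp_continuous γ.continuous hγ
      source' := by simp
      target' := by simp }
  refine isReachable_of_exists _ (shape_chart_symm hc') g hg ?_
  rw [h, Path.Homotopic.Quotient.trans_assoc, arrive_trans _ (shape_chart_symm hc') γ p
    fun t => shape_chart_symm (hγ t)]

theorem isReachable_refl : IsReachable (Path.Homotopic.Quotient.refl base) :=
  isReachable_of_exists (standard 1) (shape_standard 1) (Path.Homotopic.Quotient.refl base)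
    (one_mem (Subgroup.closure {σ₁, σ₂}))
    (by rw [arrive_standard_one, Path.Homotopic.Quotient.refl_trans])

theorem IsReachable.cast {c c' : Conf 3} {q : Path.Homotopic.Quotient base c}
    (hq : IsReachable q) (h : c' = c) : IsReachable (q.cast rfl h) := by
  subst h
  rwa [Path.Homotopic.Quotient.cast_rfl_rfl]

/-- By the Lebesgue number lemma the loop is cut into pieces which lie in chart targets, and
inductively each initial part is reachable. At the end, the standard labelling has trivial arrival
class, so the loop itself is a product of half turns. -/
theorem closure_halfTurns : Subgroup.closure {σ₁, σ₂} = ⊤ := by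
  rw [eq_top_iff]
  intro β _
  obtain ⟨γ, rfl⟩ := Path.Homotopic.Quotient.mk_surjective β
  obtain ⟨t, ht0, htm, ⟨n, hn⟩, ht⟩ := exists_monotone_Icc_subset_open_cover_unitInterval
    (c := fun y : Ascending => γ ⁻¹' (chart y).target)
    (fun y => (chart y).open_target.preimage γ.continuous) (fun s _ => by
      obtain ⟨y, hy⟩ := shape_surjective (γ s)
      refine Set.mem_iUnion.2 ⟨y, ?_⟩
      rw [Set.mem_preimage, ← hy]
      exact shape_mem_target y)
  let γ' (s : unitInterval) : Path base (γ s) := (γ.subpath 0 s).cast γ.source.symm rfl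
  have hγ' : ∀ s s', (Path.Homotopic.Quotient.mk (γ' s)).trans
      (Path.Homotopic.Quotient.mk (γ.subpath s s')) = Path.Homotopic.Quotient.mk (γ' s') := by
    intro s s'
    rw [← Path.Homotopic.Quotient.mk_trans]
    exact Path.Homotopic.Quotient.eq.2
      ⟨(Path.Homotopy.subpathTransSubpath γ 0 s s').pathCast γ.source.symm rfl⟩
  have key : ∀ n, IsReachable (Path.Homotopic.Quotient.mk (γ' (t n))) := by
    intro n
    induction n with
    | zero =>
      rw [ht0]
      convert isReachable_refl.cast γ.source
      rw [← Path.Homotopic.Quotient.mk_refl, ← Path.Homotopic.Quotient.mk_cast]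
      congr 1
      ext s
      simp [γ', Path.subpath]
    | succ n ih =>
      obtain ⟨y, hy⟩ := ht n
      rw [← hγ' (t n)]
      refine ih.trans _ y fun s => ?_
      have : γ.subpath (t n) (t (n + 1)) s ∈ γ '' Set.Icc (t n) (t (n + 1)) := by
        rw [← Path.range_subpath_of_le _ _ _ (htm n.le_succ)]
        exact Set.mem_range_self s
      obtain ⟨r, hr, hr'⟩ := this
      rw [← hr']
      exact hy hr
  have h1 := key n
  rw [hn n le_rfl] at h1
  obtain ⟨g, hg, h⟩ := (h1.cast γ.target.symm) (standard 1) (shape_standard 1)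
  have e : γ = (γ' 1).cast rfl γ.target.symm := by
    ext s
    simp [γ', Path.subpath]
  rw [arrive_standard_one, Path.Homotopic.Quotient.trans_refl, ← Path.Homotopic.Quotient.mk_cast,
    ← e] at h
  rw [h]
  exact hg

/-! ### Representations of the braid group -/

section Representation

variable {G : Type*} [Group G] {a b : G}

theorem standard_word_one : (standard 1).word a b = 1 := by
  simp [Ascending.word, standard, crossing]
  norm_num

theorem standard_word_swap_zero_one : (standard (Equiv.swap 0 1)).word a b = a := by
  simp [Ascending.word, standard, crossing]

theorem standard_word_swap_one_two : (standard (Equiv.swap 1 2)).word a b = b := by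
  simp [Ascending.word, standard, crossing, Equiv.swap_apply_def]
  norm_num

theorem monodromyPerm_relabelBraid [TopologicalSpace G] [DiscreteTopology G]
    (hab : a * b * a = b * a * b) (w : Equiv.Perm (Fin 3)) (v : G) :
    (isCoveringMap_braidBundle hab).monodromyPerm base (relabelBraid w)
      ⟨bundlePoint hab base v, rfl⟩ =
      ⟨bundlePoint hab base ((standard w).word a b * v), rfl⟩ := by
  have := monodromy_slide hab (shape_standard 1).symm (shape_standard w).symm v
  simp only [standard_word_one, one_mul] at this
  exact Subtype.ext this

/-- Monodromy commutes with the right action on the fiber, so it is a left translation. This is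
visible on the generators and passes to products and inverses. -/
theorem exists_monodromyPerm_eq [TopologicalSpace G] [DiscreteTopology G]
    (hab : a * b * a = b * a * b) (β : B₃) : ∃ g : G, ∀ v,
    (isCoveringMap_braidBundle hab).monodromyPerm base β ⟨bundlePoint hab base v, rfl⟩ =
      ⟨bundlePoint hab base (g * v), rfl⟩ := by
  have hβ : β ∈ Subgroup.closure {σ₁, σ₂} := closure_halfTurns ▸ Subgroup.mem_top β
  induction hβ using Subgroup.closure_induction with
  | mem β h =>
    rcases h with rfl | rfl
    · exact ⟨_, fun v => relabelBraid_s₁ ▸ monodromyPerm_relabelBraid hab _ v⟩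
    · exact ⟨_, fun v => relabelBraid_s₂ ▸ monodromyPerm_relabelBraid hab _ v⟩
  | one => exact ⟨1, fun v => by rw [map_one, one_mul]; rfl⟩
  | mul β β' _ _ h h' =>
    obtain ⟨g, hg⟩ := h
    obtain ⟨g', hg'⟩ := h'
    exact ⟨g * g', fun v => by rw [map_mul, Equiv.Perm.mul_apply, hg', hg, mul_assoc]⟩
  | inv β _ h =>
    obtain ⟨g, hg⟩ := h
    exact ⟨g⁻¹, fun v => by rw [map_inv, Equiv.Perm.inv_eq_iff_eq, hg, mul_inv_cancel_left]⟩

/-- Elements which satisfy the braid relation define a representation of the braid group. -/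
theorem exists_representation (hab : a * b * a = b * a * b) :
    ∃ h : B₃ →* G, h σ₁ = a ∧ h σ₂ = b := by
  let _ : TopologicalSpace G := ⊥
  have : DiscreteTopology G := ⟨rfl⟩
  -- The translation is determined by the image of the point with coordinate 1, and this uniqueness
  -- makes it multiplicative.
  choose h hh using exists_monodromyPerm_eq hab
  have huniq : ∀ β g, (isCoveringMap_braidBundle hab).monodromyPerm base β
      ⟨bundlePoint hab base 1, rfl⟩ = ⟨bundlePoint hab base g, rfl⟩ → h β = g := by
    intro β g hg
    rw [hh, mul_one] at hg
    exact bundlePoint_injective hab base (congrArg Subtype.val hg)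
  refine ⟨MonoidHom.mk' h fun β β' => huniq _ _ ?_, huniq _ _ ?_, huniq _ _ ?_⟩
  · rw [map_mul, Equiv.Perm.mul_apply, hh, hh, mul_one]
  · rw [← relabelBraid_s₁, monodromyPerm_relabelBraid, standard_word_swap_zero_one, mul_one]
  · rw [← relabelBraid_s₂, monodromyPerm_relabelBraid, standard_word_swap_one_two, mul_one]

end Representation

theorem toPSL_braid_relation :
    toPSL matA * toPSL matB * toPSL matA = toPSL matB * toPSL matA * toPSL matB := by
  simp only [← map_mul]
  exact (toPSL_eq_iff _ _).2 (Or.inl (by decide))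

/-! ### The center of the braid group -/

/-- The quotient of the braid group by its center is the modular group. -/
theorem exists_quotient_center_equiv :
    ∃ e : B₃ ⧸ Subgroup.center B₃ ≃* Matrix.ProjectiveSpecialLinearGroup (Fin 2) ℤ,
      e (QuotientGroup.mk σ₁) = toPSL matA ∧ e (QuotientGroup.mk σ₂) = toPSL matB := by
  obtain ⟨h, ha, hb⟩ := exists_representation toPSL_braid_relation
  have hker := ker_eq_center braid_relation closure_halfTurns ha hb
  exact ⟨(QuotientGroup.quotientMulEquivOfEq hker.symm).trans
    (QuotientGroup.quotientKerEquivOfSurjective h (surjective_of_generators ha hb)), ha, hb⟩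

theorem center_eq_zpowers :
    Subgroup.center B₃ = Subgroup.zpowers ((σ₁ * σ₂ * σ₁) * (σ₁ * σ₂ * σ₁)) := by
  obtain ⟨h, ha, hb⟩ := exists_representation toPSL_braid_relation
  refine le_antisymm ?_ (Subgroup.zpowers_le.2
    (braid_square_central braid_relation closure_halfTurns))
  rw [← ker_eq_center braid_relation closure_halfTurns ha hb]
  exact fun g hg => mem_zpowers_of_map_eq_one braid_relation closure_halfTurns ha hb hg

/-! ### Symmetries of the ball -/

/-- Homeomorphisms of space which preserve the norm and commute with scaling. -/
structure BallSymmetry where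
  toHomeo : E ≃ₜ E
  norm' : ∀ x, ‖toHomeo x‖ = ‖x‖
  smul' : ∀ (c : ℝ) x, toHomeo (c • x) = c • toHomeo x

namespace BallSymmetry

theorem image_isotopic (f : BallSymmetry) {K K' : Set E} (h : Isotopic K K') :
    Isotopic (f.toHomeo '' K) (f.toHomeo '' K') := by
  obtain ⟨H, hc, h0, hb, rfl⟩ := h
  refine ⟨fun t => (f.toHomeo.symm.trans (H t)).trans f.toHomeo, ?_, ?_, ?_, ?_⟩
  · have : Continuous (fun p : unitInterval × E => H p.1 (f.toHomeo.symm p.2)) :=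
      hc.comp (f := fun p : unitInterval × E => (p.1, f.toHomeo.symm p.2)) (by fun_prop)
    exact f.toHomeo.continuous.comp this
  · ext x : 1; simp [h0]
  · intro t x hx
    have : ‖f.toHomeo.symm x‖ = ‖x‖ := by
      rw [← f.norm', Homeomorph.apply_symm_apply]
    simp [hb t (f.toHomeo.symm x) (by rw [this]; exact hx)]
  · simp [Set.image_image]

/-- The effect of a symmetry on tangles. -/
def act (f : BallSymmetry) : Tangle → Tangle :=
  Quotient.map (f.toHomeo '' ·) fun _ _ h => f.image_isotopic h

theorem act_act {f g h : BallSymmetry} (hfg : ∀ x, f.toHomeo (g.toHomeo x) = h.toHomeo x)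
    (τ : Tangle) : f.act (g.act τ) = h.act τ := by
  induction τ using Quotient.inductionOn with
  | h K =>
    refine congrArg (Quotient.mk isotopySetoid) ?_
    dsimp only
    rw [Set.image_image]
    exact Set.image_congr fun x _ => hfg x

theorem image_subset_closedBall (f : BallSymmetry) {K : Set E} (hK : K ⊆ Metric.closedBall 0 1) :
    f.toHomeo '' K ⊆ Metric.closedBall 0 1 := by
  rintro _ ⟨x, hx, rfl⟩
  rw [mem_closedBall_zero_iff, f.norm']
  exact mem_closedBall_zero_iff.1 (hK hx)

/-- A symmetry commutes with scaling, so it preserves the layers of the shell; the equality holds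
for sets, without an isotopy. -/
theorem image_attachSet (f : BallSymmetry) {m m' : unitInterval → Set S}
    (h : ∀ t, Subtype.val '' m' t = f.toHomeo '' (Subtype.val '' m t)) (K : Set E) :
    f.toHomeo '' attachSet m K = attachSet m' (f.toHomeo '' K) := by
  apply Set.Subset.antisymm
  · rintro _ ⟨_, ⟨x, hx, rfl⟩ | ⟨t, q, hq, rfl⟩, rfl⟩
    · exact Or.inl ⟨_, ⟨x, hx, rfl⟩, (f.smul' _ _).symm⟩
    · have : f.toHomeo q ∈ Subtype.val '' m' t := by
        rw [h t]; exact ⟨_, ⟨q, hq, rfl⟩, rfl⟩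
      obtain ⟨p, hp, e⟩ := this
      exact Or.inr ⟨t, p, hp, by rw [f.smul', e]⟩
  · rintro _ (⟨_, ⟨x, hx, rfl⟩, rfl⟩ | ⟨t, p, hp, rfl⟩)
    · exact ⟨_, Or.inl ⟨x, hx, rfl⟩, f.smul' _ _⟩
    · have : (p : E) ∈ Subtype.val '' m' t := ⟨p, hp, rfl⟩
      rw [h t] at this
      obtain ⟨_, ⟨q, hq, rfl⟩, e⟩ := this
      exact ⟨_, Or.inr ⟨t, q, hq, rfl⟩, by rw [f.smul', e]⟩

theorem act_attach (f : BallSymmetry) {m m' : unitInterval → Set S}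
    (h : ∀ t, Subtype.val '' m' t = f.toHomeo '' (Subtype.val '' m t)) (τ : Tangle) :
    f.act (attach m τ) = attach m' (f.act τ) := by
  induction τ using Quotient.inductionOn with
  | h K => exact congrArg (Quotient.mk isotopySetoid) (f.image_attachSet h K)

/-- The quarter turn in the plane of the square. -/
def quarter : BallSymmetry where
  toHomeo := quarterTurn
  norm' := norm_quarterTurn
  smul' c x := by ext i; fin_cases i <;> simp [quarterTurn]

theorem act_quarter (τ : Tangle) : quarter.act τ = turn τ := rfl

/-- The symmetry given by an involution. -/
def ofInvolution (g : E → E) (hc : Continuous g) (hg : ∀ x, g (g x) = x)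
    (hn : ∀ x, ‖g x‖ = ‖x‖) (hs : ∀ (c : ℝ) x, g (c • x) = c • g x) : BallSymmetry where
  toHomeo := ⟨⟨g, g, hg, hg⟩, hc, hc⟩
  norm' := hn
  smul' := hs

/-- The half turn about the axis through the positions `2` and `4`. -/
def vertical : BallSymmetry :=
  ofInvolution (fun x => !₂[-x 0, x 1, -x 2])
    (by
      refine (PiLp.continuous_toLp 2 _).comp (continuous_pi fun i => ?_)
      fin_cases i <;> simp <;> fun_prop)
    (fun x => by ext i; fin_cases i <;> simp)
    (fun x => by simp [EuclideanSpace.norm_eq, Fin.sum_univ_three])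
    (fun c x => by ext i; fin_cases i <;> simp)

/-- The half turn about the axis through the midpoints of the sides `12` and `34`. -/
def diagonal : BallSymmetry :=
  ofInvolution (fun x => !₂[x 1, x 0, -x 2])
    (by
      refine (PiLp.continuous_toLp 2 _).comp (continuous_pi fun i => ?_)
      fin_cases i <;> simp <;> fun_prop)
    (fun x => by ext i; fin_cases i <;> simp)
    (fun x => by simp [EuclideanSpace.norm_eq, Fin.sum_univ_three, add_comm])
    (fun c x => by ext i; fin_cases i <;> simp)

/-- The half turn about the axis through the midpoints of the sides `23` and `41`. -/
def antidiagonal : BallSymmetry :=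
  ofInvolution (fun x => !₂[-x 1, -x 0, -x 2])
    (by
      refine (PiLp.continuous_toLp 2 _).comp (continuous_pi fun i => ?_)
      fin_cases i <;> simp <;> fun_prop)
    (fun x => by ext i; fin_cases i <;> simp)
    (fun x => by simp [EuclideanSpace.norm_eq, Fin.sum_univ_three, add_comm])
    (fun c x => by ext i; fin_cases i <;> simp)

theorem vertical_apply (x : E) : vertical.toHomeo x = !₂[-x 0, x 1, -x 2] := rfl

theorem diagonal_apply (x : E) : diagonal.toHomeo x = !₂[x 1, x 0, -x 2] := rfl

theorem antidiagonal_apply (x : E) : antidiagonal.toHomeo x = !₂[-x 1, -x 0, -x 2] := rfl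

theorem quarter_apply (x : E) : quarter.toHomeo x = !₂[-x 1, x 0, x 2] := rfl

/-- The axes of the two half turns meet at 45 degrees, so the half turns differ by a quarter turn.
-/
theorem quarter_diagonal (τ : Tangle) : quarter.act (diagonal.act τ) = vertical.act τ := by
  refine act_act (fun x => ?_) τ
  simp [quarter_apply, diagonal_apply, vertical_apply]

theorem diagonal_quarter (τ : Tangle) :
    diagonal.act (quarter.act τ) = quarter.act (antidiagonal.act τ) := by
  induction τ using Quotient.inductionOn with
  | h K =>
    refine congrArg (Quotient.mk isotopySetoid) ?_
    dsimp only
    rw [Set.image_image, Set.image_image]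
    refine Set.image_congr fun x _ => ?_
    simp [quarter_apply, diagonal_apply, antidiagonal_apply]

theorem antidiagonal_quarter (τ : Tangle) :
    antidiagonal.act (quarter.act τ) = quarter.act (diagonal.act τ) := by
  induction τ using Quotient.inductionOn with
  | h K =>
    refine congrArg (Quotient.mk isotopySetoid) ?_
    dsimp only
    rw [Set.image_image, Set.image_image]
    refine Set.image_congr fun x _ => ?_
    simp [quarter_apply, diagonal_apply, antidiagonal_apply]

end BallSymmetry

/-! ### One-parameter rotation groups -/

/-- Rotations about the axis through the positions `2` and `4`. -/
def verticalRotation : RotationFamily where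
  toFun a x := !₂[Real.cos a * x 0 + Real.sin a * x 2, x 1, -Real.sin a * x 0 + Real.cos a * x 2]
  continuous' := by
    refine (PiLp.continuous_toLp 2 _).comp (continuous_pi fun i => ?_)
    fin_cases i <;> simp <;> fun_prop
  zero' x := by ext i; fin_cases i <;> simp
  add' a b x := by
    ext i
    fin_cases i <;> simp [Real.cos_add, Real.sin_add] <;> ring
  norm' a x := by
    rw [EuclideanSpace.norm_eq, EuclideanSpace.norm_eq]
    congr 1
    simp [Fin.sum_univ_three]
    linear_combination (x 0 ^ 2 + x 2 ^ 2) * Real.sin_sq_add_cos_sq a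
  smul' a c x := by
    ext i
    fin_cases i <;> simp <;> ring

/-- Rotations about the axis through the midpoints of the sides `12` and `34`. -/
def diagonalRotation : RotationFamily where
  toFun a x :=
    !₂[((x 0 + x 1) + (Real.cos a * (x 0 - x 1) + Real.sqrt 2 * Real.sin a * x 2)) / 2,
      ((x 0 + x 1) - (Real.cos a * (x 0 - x 1) + Real.sqrt 2 * Real.sin a * x 2)) / 2,
      Real.cos a * x 2 - Real.sqrt 2 / 2 * Real.sin a * (x 0 - x 1)]
  continuous' := by
    refine (PiLp.continuous_toLp 2 _).comp (continuous_pi fun i => ?_)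
    fin_cases i <;> simp <;> fun_prop
  zero' x := by ext i; fin_cases i <;> simp
  add' a b x := by
    have h2 : Real.sqrt 2 ^ 2 = 2 := Real.sq_sqrt (by norm_num)
    ext i
    fin_cases i <;> simp [Real.cos_add, Real.sin_add]
    · linear_combination (Real.sin a * Real.sin b * (x 0 - x 1) / 2) * h2
    · linear_combination (-(Real.sin a * Real.sin b * (x 0 - x 1) / 2)) * h2
    · linear_combination (Real.sin a * Real.sin b * x 2 / 2) * h2
  norm' a x := by
    have h2 : Real.sqrt 2 ^ 2 = 2 := Real.sq_sqrt (by norm_num)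
    rw [EuclideanSpace.norm_eq, EuclideanSpace.norm_eq]
    congr 1
    simp [Fin.sum_univ_three]
    linear_combination ((x 0 - x 1) ^ 2 / 2 + x 2 ^ 2) * Real.sin_sq_add_cos_sq a +
      (Real.sin a ^ 2 * x 2 ^ 2 / 2 + Real.sin a ^ 2 * (x 0 - x 1) ^ 2 / 4) * h2
  smul' a c x := by
    ext i
    fin_cases i <;> simp <;> ring

theorem verticalRotation_pi (x : E) :
    verticalRotation.toFun Real.pi x = BallSymmetry.vertical.toHomeo x := by
  rw [BallSymmetry.vertical_apply]
  ext i
  fin_cases i <;> simp [verticalRotation]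

theorem diagonalRotation_pi (x : E) :
    diagonalRotation.toFun Real.pi x = BallSymmetry.diagonal.toHomeo x := by
  rw [BallSymmetry.diagonal_apply]
  ext i
  fin_cases i <;> simp [diagonalRotation]
  all_goals ring

/-! ### The ends during the motions -/

theorem val_image_endSet (c : Set ℂ) :
    Subtype.val '' endSet c = insert pos₄ (toSphere '' c) := by
  rw [endSet, Set.image_insert_eq, Set.image_image]

theorem val_image_braidMotion_refl (t : unitInterval) :
    Subtype.val '' braidMotion (Path.refl base) t = {pos₄, pos₁, pos₂, pos₃} := by
  have : (Path.refl base t).points = Set.range (![-1, 0, 1] : Fin 3 → ℂ) := rfl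
  rw [braidMotion_eq, val_image_endSet, this]
  simp only [Matrix.range_cons, Matrix.range_empty, Set.union_empty, Set.image_union,
    Set.image_singleton, toSphere_neg_one, toSphere_zero, toSphere_one]
  rfl

theorem val_image_twistMotion (t : unitInterval) :
    Subtype.val '' twistMotion t = {twistPoint (Real.pi * t), twistPoint (Real.pi * t + Real.pi),
      pos₃, pos₄} := by
  simp [twistMotion, Set.image_insert_eq]

namespace BallSymmetry

theorem diagonal_pos₁ : diagonal.toHomeo pos₁ = pos₂ := by
  simp [diagonal_apply, pos₁, pos₂]

theorem diagonal_pos₂ : diagonal.toHomeo pos₂ = pos₁ := by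
  simp [diagonal_apply, pos₁, pos₂]

theorem diagonal_pos₃ : diagonal.toHomeo pos₃ = pos₄ := by
  simp [diagonal_apply, pos₃, pos₄]

theorem diagonal_pos₄ : diagonal.toHomeo pos₄ = pos₃ := by
  simp [diagonal_apply, pos₃, pos₄]

theorem antidiagonal_pos₁ : antidiagonal.toHomeo pos₁ = pos₄ := by
  simp [antidiagonal_apply, pos₁, pos₄]

theorem antidiagonal_pos₂ : antidiagonal.toHomeo pos₂ = pos₃ := by
  simp [antidiagonal_apply, pos₂, pos₃]

theorem antidiagonal_pos₃ : antidiagonal.toHomeo pos₃ = pos₂ := by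
  simp [antidiagonal_apply, pos₂, pos₃]

theorem antidiagonal_pos₄ : antidiagonal.toHomeo pos₄ = pos₁ := by
  simp [antidiagonal_apply, pos₁, pos₄]

theorem quarter_pos₁ : quarter.toHomeo pos₁ = pos₂ := by
  simp [quarter_apply, pos₁, pos₂]

theorem quarter_pos₂ : quarter.toHomeo pos₂ = pos₃ := by
  simp [quarter_apply, pos₂, pos₃]

theorem quarter_pos₃ : quarter.toHomeo pos₃ = pos₄ := by
  simp [quarter_apply, pos₃, pos₄]

theorem quarter_pos₄ : quarter.toHomeo pos₄ = pos₁ := by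
  simp [quarter_apply, pos₁, pos₄]

theorem diagonal_twistPoint (θ : ℝ) :
    diagonal.toHomeo (twistPoint θ) = twistPoint (θ + Real.pi) := by
  rw [diagonal_apply]
  ext i
  fin_cases i <;> simp [twistPoint]
  all_goals ring

theorem image_segment (f : BallSymmetry) (hf : ∀ x y, f.toHomeo (x + y) = f.toHomeo x + f.toHomeo y)
    (p q : E) : f.toHomeo '' segment ℝ p q = segment ℝ (f.toHomeo p) (f.toHomeo q) :=
  _root_.image_segment ℝ
    ({ toFun := f.toHomeo, map_add' := hf, map_smul' := f.smul' } : E →ₗ[ℝ] E).toAffineMap p q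

theorem image_plainRope (f : BallSymmetry)
    (hf : ∀ x y, f.toHomeo (x + y) = f.toHomeo x + f.toHomeo y) (p q : E) :
    f.toHomeo '' plainRope p q = plainRope (f.toHomeo p) (f.toHomeo q) := by
  simp only [plainRope, Set.image_union, f.image_segment hf, f.smul']

theorem diagonal_add (x y : E) :
    diagonal.toHomeo (x + y) = diagonal.toHomeo x + diagonal.toHomeo y := by
  simp only [diagonal_apply]
  ext i
  fin_cases i <;> simp
  all_goals ring

theorem antidiagonal_add (x y : E) :
    antidiagonal.toHomeo (x + y) = antidiagonal.toHomeo x + antidiagonal.toHomeo y := by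
  simp only [antidiagonal_apply]
  ext i
  fin_cases i <;> simp
  all_goals ring

end BallSymmetry

theorem plainRope_symm (p q : E) : plainRope p q = plainRope q p := by
  rw [plainRope, plainRope, segment_symm ℝ p, segment_symm ℝ ((1 / 2 : ℝ) • p) ((1 / 2 : ℝ) • q),
    segment_symm ℝ _ q, Set.union_assoc, Set.union_comm, Set.union_comm (segment ℝ _ _)]

/-! ### Tangles in the unit ball -/

/-- The tangle is represented by a subset of the closed unit ball. -/
def InBall (τ : Tangle) : Prop := ∃ K ⊆ Metric.closedBall (0 : E) 1, (⟦K⟧ : Tangle) = τ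

theorem InBall.attach {τ : Tangle} (h : InBall τ) (m : unitInterval → Set S) :
    InBall (attach m τ) := by
  obtain ⟨K, hK, rfl⟩ := h
  exact ⟨_, attachSet_subset_closedBall m hK, rfl⟩

theorem InBall.turn {τ : Tangle} (h : InBall τ) : InBall (turn τ) := by
  obtain ⟨K, hK, rfl⟩ := h
  exact ⟨_, BallSymmetry.quarter.image_subset_closedBall hK, rfl⟩

theorem inBall_untangle : InBall untangle := by
  refine ⟨_, ?_, rfl⟩
  have hp : ∀ p ∈ ({pos₁, pos₂, pos₃, pos₄} : Set E), p ∈ Metric.closedBall (0 : E) 1 ∧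
      (1 / 2 : ℝ) • p ∈ Metric.closedBall (0 : E) 1 := by
    have : ∀ p : E, ‖p‖ = 1 → p ∈ Metric.closedBall (0 : E) 1 ∧
        (1 / 2 : ℝ) • p ∈ Metric.closedBall (0 : E) 1 := by
      intro p hp
      rw [mem_closedBall_zero_iff, mem_closedBall_zero_iff, norm_smul, hp]
      norm_num
    rintro p (rfl | rfl | rfl | rfl) <;> apply this
    · rw [← toSphere_neg_one, norm_toSphere]
    · rw [← toSphere_zero, norm_toSphere]
    · exact mem_sphere_zero_iff_norm.1 pos₃_mem
    · exact mem_sphere_zero_iff_norm.1 pos₄_mem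
  have hr : ∀ p ∈ ({pos₁, pos₂, pos₃, pos₄} : Set E), ∀ q ∈ ({pos₁, pos₂, pos₃, pos₄} : Set E),
      plainRope p q ⊆ Metric.closedBall (0 : E) 1 := by
    intro p h q h'
    have hc : Convex ℝ (Metric.closedBall (0 : E) 1) := convex_closedBall _ _
    exact Set.union_subset (Set.union_subset (hc.segment_subset (hp p h).1 (hp p h).2)
      (hc.segment_subset (hp p h).2 (hp q h').2)) (hc.segment_subset (hp q h').2 (hp q h').1)
  exact Set.union_subset (hr _ (by simp) _ (by simp)) (hr _ (by simp) _ (by simp))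

theorem braid_eq_of_homotopic {γ γ' : Path base base} (h : γ.Homotopic γ') {τ : Tangle}
    (hτ : InBall τ) : braid γ τ = braid γ' τ := by
  obtain ⟨K, hK, rfl⟩ := hτ
  exact Quotient.sound (isotopic_of_homotopic h hK)

theorem braid_braid (γ γ' : Path base base) {τ : Tangle} (hτ : InBall τ) :
    braid γ' (braid γ τ) = braid (γ.trans γ') τ := by
  obtain ⟨K, hK, rfl⟩ := hτ
  exact Quotient.sound (isotopic_braidMotion_trans γ γ' hK)

/-! ### Half turns about an axis through the positions `2` and `4` -/

/-- The rotation axis passes through the projection center, so rotations become multiplications by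
unit complex numbers. -/
theorem verticalRotation_toSphere (a : ℝ) (w : ℂ) :
    verticalRotation.toFun a (toSphere w) =
      toSphere (Complex.exp (((a : ℝ) : ℂ) * Complex.I) * w) := by
  have h : Complex.normSq (Complex.exp ((a : ℂ) * Complex.I) * w) = Complex.normSq w := by
    rw [Complex.normSq_mul, Complex.normSq_eq_norm_sq, Complex.norm_exp_ofReal_mul_I]
    simp
  have h1 : (Complex.exp ((a : ℂ) * Complex.I) * w).re = Real.cos a * w.re - Real.sin a * w.im := by
    rw [Complex.mul_re, Complex.exp_ofReal_mul_I_re, Complex.exp_ofReal_mul_I_im]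
  have h2 : (Complex.exp ((a : ℂ) * Complex.I) * w).im = Real.cos a * w.im + Real.sin a * w.re := by
    rw [Complex.mul_im, Complex.exp_ofReal_mul_I_re, Complex.exp_ofReal_mul_I_im]
  ext i
  fin_cases i <;> simp only [toSphere, verticalRotation, h, h1, h2] <;> simp <;> ring

theorem verticalRotation_pos₄ (a : ℝ) : verticalRotation.toFun a pos₄ = pos₄ := by
  ext i
  fin_cases i <;> simp [verticalRotation, pos₄]

theorem verticalRotation_pos₂ (a : ℝ) : verticalRotation.toFun a pos₂ = pos₂ := by
  ext i
  fin_cases i <;> simp [verticalRotation, pos₂]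

/-- At time `t` the ends have turned by `π t`; a further rotation by `π (1 - t)` brings them to
rest, while the ropes inside are turned by `π`. -/
theorem braid_deltaPath {τ : Tangle} (hτ : InBall τ) :
    braid deltaPath τ = braid (Path.refl base) (BallSymmetry.vertical.act τ) := by
  obtain ⟨K, hK, rfl⟩ := hτ
  have key := isotopic_attachSet_rotate verticalRotation Real.pi (m := braidMotion deltaPath)
    (m' := braidMotion (Path.refl base)) (fun t => ?_) hK
  · simp only [funext verticalRotation_pi] at key
    exact Quotient.sound key
  · have h : Complex.exp (((Real.pi * (1 - t) : ℝ) : ℂ) * Complex.I) * halfTurn t = -1 := by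
      rw [halfTurn, ← Complex.exp_add, ← Complex.exp_pi_mul_I]
      congr 1
      push_cast
      ring
    have hd : (deltaPath t).points = Set.range (![-halfTurn t, 0, halfTurn t] : Fin 3 → ℂ) := rfl
    rw [val_image_braidMotion_refl, braidMotion_eq, val_image_endSet, hd]
    simp only [Matrix.range_cons, Matrix.range_empty, Set.union_empty, Set.image_union,
      Set.image_singleton, Set.image_insert_eq, verticalRotation_pos₄, verticalRotation_pos₂,
      verticalRotation_toSphere,
      mul_neg, h, neg_neg, toSphere_neg_one, toSphere_zero, toSphere_one]
    ext x
    simp only [Set.mem_insert_iff, Set.mem_union, Set.mem_singleton_iff]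
    tauto

/-! ### Mutation -/

theorem diagonalRotation_twistPoint (a θ : ℝ) :
    diagonalRotation.toFun a (twistPoint θ) = twistPoint (θ + a) := by
  have h2 : Real.sqrt 2 ^ 2 = 2 := Real.sq_sqrt (by norm_num)
  ext i
  fin_cases i <;> simp [diagonalRotation, twistPoint, Real.cos_add, Real.sin_add]
  · linear_combination (Real.sin a * Real.sin θ / 2) * h2
  · linear_combination (-(Real.sin a * Real.sin θ / 2)) * h2
  · ring

theorem diagonalRotation_pos₃ (a : ℝ) : diagonalRotation.toFun a pos₃ =
    BallSymmetry.antidiagonal.toHomeo (twistPoint (Real.pi - a)) := by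
  rw [BallSymmetry.antidiagonal_apply]
  ext i
  fin_cases i <;> simp [diagonalRotation, twistPoint, pos₃] <;> ring

theorem diagonalRotation_pos₄ (a : ℝ) : diagonalRotation.toFun a pos₄ =
    BallSymmetry.antidiagonal.toHomeo (twistPoint (-a)) := by
  rw [BallSymmetry.antidiagonal_apply]
  ext i
  fin_cases i <;> simp [diagonalRotation, twistPoint, pos₄] <;> ring

theorem diagonal_act_twist (τ : Tangle) :
    BallSymmetry.diagonal.act (twist τ) = twist (BallSymmetry.diagonal.act τ) := by
  refine BallSymmetry.act_attach _ (fun t => ?_) τ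
  have h : twistPoint (Real.pi * t + Real.pi + Real.pi) = twistPoint (Real.pi * t) := by
    simp [twistPoint]
  rw [val_image_twistMotion]
  simp only [Set.image_insert_eq, Set.image_singleton, BallSymmetry.diagonal_twistPoint,
    BallSymmetry.diagonal_pos₃, BallSymmetry.diagonal_pos₄, h]
  ext x
  simp only [Set.mem_insert_iff, Set.mem_singleton_iff]
  tauto

/-- Twisting the side `12` has the same effect as twisting the opposite side, for tangles which are
symmetric. -/
theorem antidiagonal_act_twist {τ : Tangle} (hτ : InBall τ)
    (h : BallSymmetry.diagonal.act τ = τ) (h' : BallSymmetry.antidiagonal.act τ = τ) :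
    BallSymmetry.antidiagonal.act (twist τ) = twist τ := by
  obtain ⟨K, hK, rfl⟩ := hτ
  -- This is the twist of the opposite side 34: the image of the twist motion under the half turn
  -- about the other axis. Rotating the shell back holds the ends 1 and 2 still and makes 3 and 4
  -- move in this way.
  let m' : unitInterval → Set S := fun t =>
    Subtype.val ⁻¹' (BallSymmetry.antidiagonal.toHomeo '' (Subtype.val '' twistMotion t))
  have hm' : ∀ t, Subtype.val '' m' t =
      BallSymmetry.antidiagonal.toHomeo '' (Subtype.val '' twistMotion t) := by
    intro t
    refine Set.image_preimage_eq_of_subset ?_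
    rintro _ ⟨_, ⟨p, -, rfl⟩, rfl⟩
    rw [Subtype.range_coe, mem_sphere_zero_iff_norm, BallSymmetry.norm', norm_coe_sphere]
  have h1 : BallSymmetry.antidiagonal.act (twist ⟦K⟧) = attach m' ⟦K⟧ := by
    rw [twist, BallSymmetry.act_attach _ hm', h']
  have key := isotopic_attachSet_rotate diagonalRotation Real.pi (m := twistMotion)
    (m' := m') (fun t => ?_) hK
  · simp only [funext diagonalRotation_pi] at key
    have h2 : twist ⟦K⟧ = attach m' (BallSymmetry.diagonal.act ⟦K⟧) := Quotient.sound key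
    rw [h1, h2, h]
  · have e1 : Real.pi * t + Real.pi * (1 - t) = Real.pi := by ring
    have e2 : Real.pi * t + Real.pi + Real.pi * (1 - t) = 2 * Real.pi := by ring
    have e3 : Real.pi - Real.pi * (1 - t) = Real.pi * t := by ring
    have e4 : twistPoint (2 * Real.pi) = pos₁ := by
      rw [← twistPoint_zero]; simp [twistPoint]
    have e5 : twistPoint (-(Real.pi * (1 - t))) = twistPoint (Real.pi * t + Real.pi) := by
      have : Real.pi * t + Real.pi = -(Real.pi * (1 - t)) + 2 * Real.pi := by ring
      rw [this]
      simp [twistPoint]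
    rw [hm', val_image_twistMotion]
    simp only [Set.image_insert_eq, Set.image_singleton, diagonalRotation_twistPoint,
      diagonalRotation_pos₃, diagonalRotation_pos₄, e1, e2, e3, e4, e5, twistPoint_pi,
      BallSymmetry.antidiagonal_pos₃, BallSymmetry.antidiagonal_pos₄]
    ext x
    simp only [Set.mem_insert_iff, Set.mem_singleton_iff]
    tauto

theorem IsRational.inBall {τ : Tangle} (h : IsRational τ) : InBall τ := by
  induction h with
  | untangle => exact inBall_untangle
  | twist τ _ ih => exact ih.attach _
  | turn τ _ ih => exact ih.turn

/-- Both invariances are proved together: a turn exchanges the two axes, and a twist preserves the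
second invariance only with the help of the first. -/
theorem IsRational.mutation {τ : Tangle} (h : IsRational τ) :
    BallSymmetry.diagonal.act τ = τ ∧ BallSymmetry.antidiagonal.act τ = τ := by
  induction h with
  | untangle =>
    refine ⟨congrArg (Quotient.mk isotopySetoid) ?_, congrArg (Quotient.mk isotopySetoid) ?_⟩
    · dsimp only
      rw [Set.image_union, BallSymmetry.image_plainRope _ BallSymmetry.diagonal_add,
        BallSymmetry.image_plainRope _ BallSymmetry.diagonal_add, BallSymmetry.diagonal_pos₁,
        BallSymmetry.diagonal_pos₂, BallSymmetry.diagonal_pos₃, BallSymmetry.diagonal_pos₄,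
        Set.union_comm]
    · dsimp only
      rw [Set.image_union, BallSymmetry.image_plainRope _ BallSymmetry.antidiagonal_add,
        BallSymmetry.image_plainRope _ BallSymmetry.antidiagonal_add,
        BallSymmetry.antidiagonal_pos₁, BallSymmetry.antidiagonal_pos₂,
        BallSymmetry.antidiagonal_pos₃, BallSymmetry.antidiagonal_pos₄, plainRope_symm pos₄,
        plainRope_symm pos₃]
  | twist τ h ih =>
    exact ⟨by rw [diagonal_act_twist, ih.1], antidiagonal_act_twist h.inBall ih.1 ih.2⟩
  | turn τ _ ih =>
    rw [← BallSymmetry.act_quarter, BallSymmetry.diagonal_quarter,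
      BallSymmetry.antidiagonal_quarter, ih.1, ih.2]
    exact ⟨rfl, rfl⟩

theorem IsRational.turn_eq {τ : Tangle} (h : IsRational τ) :
    TangleTrick.turn τ = BallSymmetry.vertical.act τ := by
  rw [← BallSymmetry.quarter_diagonal, h.mutation.1, BallSymmetry.act_quarter]

/-! ### Twisting is braiding -/

/-- The stereographic coordinate of `twistPoint`. -/
def twistCoord (θ : ℝ) : ℂ := stereo (twistPoint θ)

theorem norm_twistPoint (θ : ℝ) : ‖twistPoint θ‖ = 1 :=
  mem_sphere_zero_iff_norm.1 (twistPoint_mem θ)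

theorem twistPoint_apply_one (θ : ℝ) : twistPoint θ 1 = (-1 + Real.cos θ) / 2 := rfl

theorem twistPoint_not_pole (θ : ℝ) : twistPoint θ 1 ≠ ‖twistPoint θ‖ := by
  rw [norm_twistPoint, twistPoint_apply_one]
  have := Real.cos_le_one θ
  linarith

theorem toSphere_twistCoord (θ : ℝ) : toSphere (twistCoord θ) = twistPoint θ := by
  have := norm_smul_toSphere_stereo (twistPoint_not_pole θ)
  rwa [norm_twistPoint, one_smul] at this

theorem twistCoord_im (θ : ℝ) :
    (twistCoord θ).im = -(Real.sqrt 2 / (3 - Real.cos θ)) * Real.sin θ := by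
  have h : 3 - Real.cos θ ≠ 0 := by have := Real.cos_le_one θ; linarith
  have h' : 1 - (-1 + Real.cos θ) / 2 = (3 - Real.cos θ) / 2 := by ring
  change -twistPoint θ 2 / (‖twistPoint θ‖ - twistPoint θ 1) = _
  rw [norm_twistPoint, twistPoint_apply_one, h']
  change -(Real.sqrt 2 / 2 * Real.sin θ) / _ = _
  field_simp

theorem continuous_twistCoord : Continuous twistCoord := by
  have h : Continuous twistPoint := by
    refine (PiLp.continuous_toLp 2 _).comp (continuous_pi fun i => ?_)
    fin_cases i <;> simp <;> fun_prop
  exact continuous_iff_continuousAt.2 fun θ =>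
    (continuousAt_stereo (twistPoint_not_pole θ)).comp h.continuousAt

theorem twistCoord_zero : twistCoord 0 = -1 := by
  rw [twistCoord, twistPoint_zero, ← toSphere_neg_one, ← one_smul ℝ (toSphere (-1)),
    stereo_smul_toSphere one_pos]

theorem twistCoord_pi : twistCoord Real.pi = 0 := by
  rw [twistCoord, twistPoint_pi, ← toSphere_zero, ← one_smul ℝ (toSphere 0),
    stereo_smul_toSphere one_pos]

theorem twistCoord_pi_add_pi : twistCoord (Real.pi + Real.pi) = -1 := by
  rw [← twistCoord_zero, twistCoord, twistCoord]
  congr 1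
  simp [twistPoint]

/-- The straight-line homotopy between the twist and the half turn of the points `-1` and `0`. -/
def twistHomotopy (s t : unitInterval) : Fin 3 → ℂ :=
  ((1 - s : ℝ) : ℂ) • ![twistCoord (Real.pi * t), twistCoord (Real.pi * t + Real.pi), 1] +
    ((s : ℝ) : ℂ) • ![-1 / 2 - halfTurn t / 2, -1 / 2 + halfTurn t / 2, 1]

theorem twistHomotopy_endpoints (s : unitInterval) :
    twistHomotopy s 0 = ![-1, 0, 1] ∧ twistHomotopy s 1 = ![0, -1, 1] := by
  constructor
  · ext i
    fin_cases i <;> simp [twistHomotopy, twistCoord_zero, twistCoord_pi, halfTurn_zero]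
    all_goals first | ring1 | norm_num
  · ext i
    fin_cases i <;> simp [twistHomotopy, twistCoord_pi_add_pi, twistCoord_pi, halfTurn_one]
    all_goals ring

/-- At intermediate times the moving points lie in opposite open half planes and the third one is
real. These conditions are convex, so the straight-line homotopy has no collisions. The lower half
plane is the front side, where end 1 passes. -/
theorem twistHomotopy_im {s t : unitInterval} (h0 : t ≠ 0) (h1 : t ≠ 1) :
    (twistHomotopy s t 0).im < 0 ∧ 0 < (twistHomotopy s t 1).im ∧ (twistHomotopy s t 2).im = 0 := by
  have hs0 := s.2.1
  have hs1 := s.2.2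
  have ht0 : 0 < (t : ℝ) := lt_of_le_of_ne t.2.1 fun h => h0 (Subtype.ext h.symm)
  have ht1 : (t : ℝ) < 1 := lt_of_le_of_ne t.2.2 fun h => h1 (Subtype.ext h)
  have hpi := Real.pi_pos
  have hsin : 0 < Real.sin (Real.pi * t) :=
    Real.sin_pos_of_pos_of_lt_pi (by positivity) (by nlinarith)
  have hc := Real.cos_le_one (Real.pi * t)
  have hc' := Real.neg_one_le_cos (Real.pi * t)
  have hp : 0 < Real.sqrt 2 / (3 - Real.cos (Real.pi * t)) * Real.sin (Real.pi * t) :=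
    mul_pos (div_pos (by positivity) (by linarith)) hsin
  have hq : 0 < Real.sqrt 2 / (3 + Real.cos (Real.pi * t)) * Real.sin (Real.pi * t) :=
    mul_pos (div_pos (by positivity) (by linarith)) hsin
  have key : ∀ a b : ℝ, 0 < a → 0 < b → 0 < (1 - s) * a + s * b := by
    intro a b ha hb
    rcases hs0.eq_or_lt with h | h
    · rw [← h]; linarith
    · have := mul_pos h hb
      have := mul_nonneg (sub_nonneg.2 hs1) ha.le
      linarith
  have e0 : (twistHomotopy s t 0).im = -((1 - s) * (Real.sqrt 2 / (3 - Real.cos (Real.pi * t)) *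
      Real.sin (Real.pi * t)) + s * (Real.sin (Real.pi * t) / 2)) := by
    simp [twistHomotopy, twistCoord_im, halfTurn_im]
    ring
  have e1 : (twistHomotopy s t 1).im = (1 - s) * (Real.sqrt 2 / (3 + Real.cos (Real.pi * t)) *
      Real.sin (Real.pi * t)) + s * (Real.sin (Real.pi * t) / 2) := by
    simp [twistHomotopy, twistCoord_im, halfTurn_im]
  have e2 : (twistHomotopy s t 2).im = 0 := by
    simp [twistHomotopy]
  rw [e0, e1, e2]
  exact ⟨neg_lt_zero.2 (key _ _ hp (half_pos hsin)), key _ _ hq (half_pos hsin), rfl⟩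

theorem twistHomotopy_injective (s t : unitInterval) :
    Function.Injective (twistHomotopy s t) := by
  by_cases h0 : t = 0
  · rw [h0, (twistHomotopy_endpoints s).1]
    exact base_injective
  by_cases h1 : t = 1
  · rw [h1, (twistHomotopy_endpoints s).2]
    intro i j h
    fin_cases i <;> fin_cases j <;> simp_all [eq_comm] <;> norm_num at h
  obtain ⟨ha, hb, hc⟩ := twistHomotopy_im (s := s) h0 h1
  intro i j h
  have him := congrArg Complex.im h
  fin_cases i <;> fin_cases j <;> simp only [Fin.zero_eta, Fin.mk_one, Fin.reduceFinMk] at him ⊢ <;>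
    linarith

theorem twist_eq_braid {τ : Tangle} (hτ : InBall τ) : twist τ = braid sigmaOnePath τ := by
  obtain ⟨K, hK, rfl⟩ := hτ
  have hcont : Continuous fun p : unitInterval × unitInterval => twistHomotopy p.1 p.2 := by
    have h1 := continuous_twistCoord
    have h2 := continuous_halfTurn
    refine continuous_pi fun i => ?_
    fin_cases i <;> simp [twistHomotopy] <;> fun_prop
  have key := isotopic_of_homotopy hcont twistHomotopy_injective
    (fun s => (twistHomotopy_endpoints s).1.trans (twistHomotopy_endpoints 0).1.symm)
    (fun s => (twistHomotopy_endpoints s).2.trans (twistHomotopy_endpoints 0).2.symm) hK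
  have e0 : ∀ t, endSet (Set.range (twistHomotopy 0 t)) = twistMotion t := by
    intro t
    refine Subtype.val_injective.image_injective ?_
    have : twistHomotopy 0 t =
        ![twistCoord (Real.pi * t), twistCoord (Real.pi * t + Real.pi), 1] := by
      simp [twistHomotopy]
    rw [val_image_endSet, val_image_twistMotion, this]
    simp only [Matrix.range_cons, Matrix.range_empty, Set.union_empty, Set.image_union,
      Set.image_singleton, toSphere_twistCoord, toSphere_one]
    ext x
    simp only [Set.mem_insert_iff, Set.mem_union, Set.mem_singleton_iff]
    tauto
  have e1 : ∀ t, endSet (Set.range (twistHomotopy 1 t)) = braidMotion sigmaOnePath t := by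
    intro t
    have : twistHomotopy 1 t = ![-1 / 2 - halfTurn t / 2, -1 / 2 + halfTurn t / 2, 1] := by
      simp [twistHomotopy]
    rw [this]
    rfl
  rw [attachSet_congr e0, attachSet_congr e1] at key
  exact Quotient.sound key

/-! ### Tangles whose ends are straight -/

/-- Tangles in the unit ball which do not change when their ends are extended radially. -/
def Straight (τ : Tangle) : Prop := InBall τ ∧ braid (Path.refl base) τ = τ

theorem Straight.braid {τ : Tangle} (h : Straight τ) (γ : Path base base) :
    Straight (braid γ τ) :=
  ⟨h.1.attach _, by
    rw [braid_braid _ _ h.1, braid_eq_of_homotopic ⟨Path.Homotopy.transRefl γ⟩ h.1]⟩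

/-- The outer halves of the ropes are already radial, so the untangle is literally two sides of the
square with a radial shell attached. As the constant loop composed with itself is constant, a
further shell changes nothing. -/
theorem untangle_eq :
    untangle = braid (Path.refl base) ⟦segment ℝ pos₁ pos₄ ∪ segment ℝ pos₂ pos₃⟧ := by
  refine congrArg (Quotient.mk isotopySetoid) ?_
  have hseg : ∀ p q : E, (fun x : E => (1 / 2 : ℝ) • x) '' segment ℝ p q =
      segment ℝ ((1 / 2 : ℝ) • p) ((1 / 2 : ℝ) • q) := fun p q =>
    image_segment ℝ ((1 / 2 : ℝ) • (LinearMap.id : E →ₗ[ℝ] E)).toAffineMap p q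
  have hstrand : ∀ (p : E) x, (∃ t : unitInterval, x = ((1 + (t : ℝ)) / 2) • p) ↔
      x ∈ segment ℝ ((1 / 2 : ℝ) • p) p := by
    intro p x
    rw [segment_eq_image]
    constructor
    · rintro ⟨t, rfl⟩
      refine ⟨t, t.2, ?_⟩
      dsimp only
      rw [smul_smul, ← add_smul]
      congr 1
      ring
    · rintro ⟨t, ht, rfl⟩
      refine ⟨⟨t, ht⟩, ?_⟩
      dsimp only
      rw [smul_smul, ← add_smul]
      congr 1
      ring
  have hends : {x | ∃ t : unitInterval, ∃ p ∈ braidMotion (Path.refl base) t,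
      x = ((1 + (t : ℝ)) / 2) • (p : E)} = segment ℝ ((1 / 2 : ℝ) • pos₄) pos₄ ∪
      (segment ℝ ((1 / 2 : ℝ) • pos₁) pos₁ ∪ (segment ℝ ((1 / 2 : ℝ) • pos₂) pos₂ ∪
      segment ℝ ((1 / 2 : ℝ) • pos₃) pos₃)) := by
    ext x
    have : (∃ t : unitInterval, ∃ p ∈ braidMotion (Path.refl base) t,
        x = ((1 + (t : ℝ)) / 2) • (p : E)) ↔ ∃ t : unitInterval,
        ∃ p ∈ ({pos₄, pos₁, pos₂, pos₃} : Set E), x = ((1 + (t : ℝ)) / 2) • p := by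
      refine exists_congr fun t => ?_
      rw [← val_image_braidMotion_refl t, Set.exists_mem_image]
    simp only [Set.mem_union, ← hstrand]
    rw [Set.mem_ofPred_eq, this]
    simp only [Set.mem_insert_iff, Set.mem_singleton_iff, exists_eq_or_imp, exists_eq_left,
      exists_or]
  rw [attachSet, hends, Set.image_union, hseg, hseg, plainRope, plainRope, segment_symm ℝ pos₁,
    segment_symm ℝ pos₂ ((1 / 2 : ℝ) • pos₂)]
  ext x
  simp only [Set.mem_union]
  tauto

theorem straight_untangle : Straight untangle := by
  refine ⟨inBall_untangle, ?_⟩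
  have h : InBall ⟦segment ℝ pos₁ pos₄ ∪ segment ℝ pos₂ pos₃⟧ := by
    refine ⟨_, ?_, rfl⟩
    have hc : Convex ℝ (Metric.closedBall (0 : E) 1) := convex_closedBall _ _
    have h' : ∀ p : E, ‖p‖ = 1 → p ∈ Metric.closedBall (0 : E) 1 := fun p hp =>
      mem_closedBall_zero_iff.2 hp.le
    refine Set.union_subset (hc.segment_subset (h' _ ?_) (h' _ ?_))
      (hc.segment_subset (h' _ ?_) (h' _ ?_))
    · rw [← toSphere_neg_one, norm_toSphere]
    · exact mem_sphere_zero_iff_norm.1 pos₄_mem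
    · rw [← toSphere_zero, norm_toSphere]
    · rw [← toSphere_one, norm_toSphere]
  rw [untangle_eq, braid_braid _ _ h, Path.refl_trans_refl]

theorem IsRational.straight {τ : Tangle} (h : IsRational τ) : Straight τ := by
  induction h with
  | untangle => exact straight_untangle
  | twist τ _ ih =>
    rw [twist_eq_braid ih.1]
    exact ih.braid _
  | turn τ _ ih =>
    refine ⟨ih.1.turn, ?_⟩
    rw [← BallSymmetry.act_quarter]
    refine Eq.trans ?_ (congrArg BallSymmetry.quarter.act ih.2)
    refine (BallSymmetry.act_attach _ (fun t => ?_) τ).symm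
    rw [val_image_braidMotion_refl]
    simp only [Set.image_insert_eq, Set.image_singleton, BallSymmetry.quarter_pos₁,
      BallSymmetry.quarter_pos₂, BallSymmetry.quarter_pos₃, BallSymmetry.quarter_pos₄]
    ext x
    simp only [Set.mem_insert_iff, Set.mem_singleton_iff]
    tauto

theorem Straight.braid_deltaPath {τ : Tangle} (h : Straight τ) :
    TangleTrick.braid deltaPath τ = BallSymmetry.vertical.act τ := by
  rw [TangleTrick.braid_deltaPath h.1]
  refine Eq.trans ?_ (congrArg BallSymmetry.vertical.act h.2)
  refine (BallSymmetry.act_attach _ (fun t => ?_) τ).symm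
  rw [val_image_braidMotion_refl]
  have h1 : BallSymmetry.vertical.toHomeo pos₁ = pos₃ := by
    simp [BallSymmetry.vertical_apply, pos₁, pos₃]
  have h2 : BallSymmetry.vertical.toHomeo pos₂ = pos₂ := by
    simp [BallSymmetry.vertical_apply, pos₂]
  have h3 : BallSymmetry.vertical.toHomeo pos₃ = pos₁ := by
    simp [BallSymmetry.vertical_apply, pos₁, pos₃]
  have h4 : BallSymmetry.vertical.toHomeo pos₄ = pos₄ := by
    simp [BallSymmetry.vertical_apply, pos₄]
  simp only [Set.image_insert_eq, Set.image_singleton, h1, h2, h3, h4]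
  ext x
  simp only [Set.mem_insert_iff, Set.mem_singleton_iff]
  tauto

/-! ### The action of the braid group -/

theorem braidClass_surjective : Function.Surjective braidClass :=
  Path.Homotopic.Quotient.mk_surjective

theorem braidClass_mul (γ γ' : Path base base) :
    braidClass γ * braidClass γ' = braidClass (γ'.trans γ) := by
  rw [FundamentalGroup.mul_def]
  rfl

theorem braid_eq_of_braidClass_eq {γ γ' : Path base base} (h : braidClass γ = braidClass γ')
    {τ : Tangle} (hτ : InBall τ) : braid γ τ = braid γ' τ :=
  braid_eq_of_homotopic (Path.Homotopic.Quotient.eq.1 h) hτ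

/-- The type of tangles with straight ends. -/
abbrev StraightTangle : Type := {τ : Tangle // Straight τ}

instance : SMul B₃ StraightTangle where
  smul β τ := ⟨braid (braidClass_surjective β).choose τ, τ.2.braid _⟩

theorem braidClass_smul (γ : Path base base) (τ : StraightTangle) :
    ((braidClass γ • τ : StraightTangle) : Tangle) = braid γ τ :=
  braid_eq_of_braidClass_eq (braidClass_surjective (braidClass γ)).choose_spec τ.2.1

instance : MulAction B₃ StraightTangle where
  -- The constant loop still attaches a radial shell, so the identity law is exactly straightness.
  one_smul τ := Subtype.ext ((braidClass_smul (Path.refl base) τ).trans τ.2.2)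
  mul_smul β β' τ := by
    obtain ⟨γ, rfl⟩ := braidClass_surjective β
    obtain ⟨γ', rfl⟩ := braidClass_surjective β'
    refine Subtype.ext ?_
    rw [braidClass_mul, braidClass_smul, braidClass_smul, braidClass_smul, braid_braid _ _ τ.2.1]

theorem σ₁_smul (τ : StraightTangle) : ((σ₁ • τ : StraightTangle) : Tangle) = twist τ := by
  rw [σ₁, braidClass_smul, twist_eq_braid τ.2.1]

/-- The half twist of three strands. -/
def Δ : B₃ := σ₁ * σ₂ * σ₁

theorem Δ_smul (τ : StraightTangle) :
    ((Δ • τ : StraightTangle) : Tangle) = BallSymmetry.vertical.act τ := by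
  rw [Δ, ← braidClass_deltaPath, braidClass_smul, τ.2.braid_deltaPath]

theorem Δ_smul_Δ_smul (τ : StraightTangle) : Δ • Δ • τ = τ := by
  refine Subtype.ext ?_
  rw [Δ_smul, Δ_smul]
  generalize (τ : Tangle) = τ
  induction τ using Quotient.inductionOn with
  | h K =>
    refine congrArg (Quotient.mk isotopySetoid) ?_
    dsimp only
    rw [Set.image_image]
    refine (Set.image_congr fun x _ => ?_).trans (Set.image_id K)
    simp only [BallSymmetry.vertical_apply, id]
    ext i
    fin_cases i <;> simp

/-- The center is generated by `Δ * Δ`, which acts as a full turn of the ball. -/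
theorem center_smul {β : B₃} (hβ : β ∈ Subgroup.center B₃) (τ : StraightTangle) : β • τ = τ := by
  have h : Δ * Δ ∈ MulAction.stabilizer B₃ τ := by
    rw [MulAction.mem_stabilizer_iff, mul_smul, Δ_smul_Δ_smul]
  rw [center_eq_zpowers] at hβ
  exact MulAction.mem_stabilizer_iff.1 (Subgroup.zpowers_le.2 h hβ)

theorem σ₂_mul_Δ : σ₂ * Δ = Δ * σ₁ := by
  rw [Δ, ← mul_assoc, ← mul_assoc, ← braid_relation]

/-! ### Braiding rational tangles -/

theorem isRational_σ₁_smul {τ : StraightTangle} (h : IsRational τ) :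
    IsRational (σ₁ • τ : StraightTangle) := by
  rw [σ₁_smul]
  exact h.twist

theorem isRational_Δ_smul {τ : StraightTangle} (h : IsRational τ) :
    IsRational (Δ • τ : StraightTangle) := by
  rw [Δ_smul, ← h.turn_eq]
  exact h.turn

theorem σ₂_smul (τ : StraightTangle) : σ₂ • τ = Δ • σ₁ • Δ • τ := by
  rw [← mul_smul Δ σ₁, ← σ₂_mul_Δ, mul_smul, Δ_smul_Δ_smul]

/-- Rational tangles are closed under twists and turns by definition, but not visibly under their
inverses. Since `Δ²` acts trivially, the inverse of a twist is a positive word in `Δ` and `σ₁`. -/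
theorem σ₁_inv_smul (τ : StraightTangle) : σ₁⁻¹ • τ = Δ • σ₁ • Δ • σ₁ • Δ • τ := by
  rw [inv_smul_eq_iff, ← σ₂_smul, ← mul_smul, ← mul_smul, ← mul_smul]
  change τ = (Δ * Δ) • τ
  rw [mul_smul, Δ_smul_Δ_smul]

theorem isRational_smul (β : B₃) (τ : StraightTangle) (h : IsRational τ) :
    IsRational (β • τ : StraightTangle) := by
  have hσ : ∀ τ : StraightTangle, IsRational τ → IsRational (σ₁⁻¹ • τ : StraightTangle) := by
    intro τ h
    rw [σ₁_inv_smul]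
    exact isRational_Δ_smul (isRational_σ₁_smul (isRational_Δ_smul
      (isRational_σ₁_smul (isRational_Δ_smul h))))
  have hσ₂ : ∀ τ : StraightTangle, σ₂⁻¹ • τ = Δ • σ₁⁻¹ • Δ • τ := by
    intro τ
    rw [inv_smul_eq_iff, σ₂_smul, Δ_smul_Δ_smul, smul_inv_smul, Δ_smul_Δ_smul]
  have hβ : β ∈ Subgroup.closure {σ₁, σ₂} := closure_halfTurns ▸ Subgroup.mem_top β
  induction hβ using Subgroup.closure_induction'' generalizing τ with
  | mem β hβ =>
    rcases hβ with rfl | rfl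
    · exact isRational_σ₁_smul h
    · rw [σ₂_smul]
      exact isRational_Δ_smul (isRational_σ₁_smul (isRational_Δ_smul h))
  | inv_mem β hβ =>
    rcases hβ with rfl | rfl
    · exact hσ τ h
    · rw [hσ₂]
      exact isRational_Δ_smul (hσ _ (isRational_Δ_smul h))
  | one => rwa [one_smul]
  | mul β β' _ _ ih ih' =>
    rw [mul_smul]
    exact ih _ (ih' _ h)

instance : MulAction B₃ RationalTangle where
  smul β τ := ⟨(β • (⟨τ, τ.2.straight⟩ : StraightTangle) : StraightTangle),
    isRational_smul β _ τ.2⟩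
  one_smul τ := Subtype.ext
    (congrArg (fun x : StraightTangle => (x : Tangle))
      (one_smul B₃ (⟨τ, τ.2.straight⟩ : StraightTangle)))
  mul_smul β β' τ := Subtype.ext
    (congrArg (fun x : StraightTangle => (x : Tangle))
      (mul_smul β β' (⟨τ, τ.2.straight⟩ : StraightTangle)))

/-- The action of the braid group on rational tangles. -/
def braidAction : B₃ →* Equiv.Perm RationalTangle := MulAction.toPermHom B₃ RationalTangle

theorem braidAction_braidClass (γ : Path base base) (τ : RationalTangle) :
    (braidAction (braidClass γ) τ : Tangle) = braid γ τ :=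
  braidClass_smul γ ⟨τ, τ.2.straight⟩

theorem braidAction_σ₁ (τ : RationalTangle) : (braidAction σ₁ τ : Tangle) = twist τ :=
  σ₁_smul ⟨τ, τ.2.straight⟩

theorem braidAction_Δ (τ : RationalTangle) : (braidAction Δ τ : Tangle) = turn τ :=
  (Δ_smul ⟨τ, τ.2.straight⟩).trans τ.2.turn_eq.symm

theorem center_le_ker_braidAction : Subgroup.center B₃ ≤ braidAction.ker := fun _ hβ =>
  Equiv.ext fun τ => Subtype.ext
    (congrArg (fun x : StraightTangle => (x : Tangle)) (center_smul hβ ⟨τ, τ.2.straight⟩))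

end TangleTrick

end

/-! ### Factorization of both actions -/

open TangleTrick in
/-- `ρ₁` is the action of the free group on `R` and `T` on rational tangles, `ρ₃` is the action of
the braid group by braiding three loose ends, and `ρ` is the action of matrices through which both
of them factor. -/
theorem corollary4p5 :
    ∃ (ρ₁ : FreeGroup Move →* Equiv.Perm RationalTangle)
      (ρ₃ : B₃ →* Equiv.Perm RationalTangle)
      (e : B₃ ⧸ Subgroup.center B₃ ≃* Matrix.ProjectiveSpecialLinearGroup (Fin 2) ℤ)
      (ρ : Matrix.ProjectiveSpecialLinearGroup (Fin 2) ℤ →* Equiv.Perm RationalTangle),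
      (∀ (g : Move) (τ : RationalTangle), (ρ₁ (FreeGroup.of g) τ : Tangle) = g.apply τ) ∧
      (∀ (γ : Path base base) (τ : RationalTangle), (ρ₃ (braidClass γ) τ : Tangle) = braid γ τ) ∧
      e (QuotientGroup.mk σ₁) = toPSL ⟨!![1, 1; 0, 1], by simp [Matrix.det_fin_two_of]⟩ ∧
      e (QuotientGroup.mk σ₂) = toPSL ⟨!![1, 0; -1, 1], by simp [Matrix.det_fin_two_of]⟩ ∧
      (∀ β : B₃, ρ₃ β = ρ (e (QuotientGroup.mk β))) ∧
      (∀ w : FreeGroup Move, ρ₁ w = ρ (φ w)) := by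
  obtain ⟨e, he₁, he₂⟩ := exists_quotient_center_equiv
  let ρ' : B₃ ⧸ Subgroup.center B₃ →* Equiv.Perm RationalTangle :=
    QuotientGroup.lift _ braidAction center_le_ker_braidAction
  let ρ : Matrix.ProjectiveSpecialLinearGroup (Fin 2) ℤ →* Equiv.Perm RationalTangle :=
    ρ'.comp e.symm.toMonoidHom
  have hρ : ∀ β : B₃, ρ (e (QuotientGroup.mk β)) = braidAction β := fun β =>
    congrArg ρ' (e.symm_apply_apply (QuotientGroup.mk β))
  have hT : φ (FreeGroup.of Move.T) = e (QuotientGroup.mk σ₁) := by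
    rw [he₁, φ, FreeGroup.lift_apply_of]
    rfl
  have hR : φ (FreeGroup.of Move.R) = e (QuotientGroup.mk Δ) := by
    have : e (QuotientGroup.mk Δ) = toPSL (matA * matB * matA) := by
      rw [Δ, QuotientGroup.mk_mul, QuotientGroup.mk_mul, map_mul, map_mul, he₁, he₂, map_mul,
        map_mul]
    rw [this, φ, FreeGroup.lift_apply_of]
    -- The product of the three matrices is minus the matrix of `R`; the sign disappears in the
    -- projective group.
    exact (toPSL_eq_iff _ _).2 (Or.inr (Subtype.ext (by decide)))
  -- Defining the action of the free group through `φ` makes its factorization definitional; it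
  -- remains to see that the letters act as the moves.
  refine ⟨ρ.comp φ, braidAction, e, ρ, ?_, braidAction_braidClass, he₁, he₂,
    fun β => (hρ β).symm, fun w => rfl⟩
  rintro (_ | _) τ
  · rw [MonoidHom.comp_apply, hR, hρ]
    exact braidAction_Δ τ
  · rw [MonoidHom.comp_apply, hT, hρ]
    exact braidAction_σ₁ τ
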